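/- For $0<k<1$ let $\mathrm{sn}(\cdot,k)$ be the meromorphic function on $\mathbb C$ that extends the inverse function of $v=\int_0^{\varphi}\frac{dt}{\sqrt{1-t^2}\sqrt{1-k^2t^2}}$, $-1<\varphi<1$, and let $\mathrm{cn}(\cdot,k)$, $\mathrm{dn}(\cdot,k)$ be the meromorphic extensions to $\mathbb C$ of $\sqrt{1-\mathrm{sn}^2}$ and $\sqrt{1-k^2\mathrm{sn}^2}$ from that real interval. These functions exist, are unique, and $\mathrm{cn}$, $\mathrm{dn}$ are holomorphic away from the poles of $\mathrm{sn}$. The Björling surface of a planar analytic curve $(x,y)$ with base point $p$ is the set of all values of the multivalued map $\Phi(z)=\mathrm{Re}\left(x(z),\,y(z),\,i\int_p^z\sqrt{x'(\zeta)^2+y'(\zeta)^2}\,d\zeta\right)$, taken along all $C^1$ paths $(z(t),w(t))$ on the Riemann surface $w^2=x'(z)^2+y'(z)^2$ that start over $z=p$ with $\mathrm{Re}\,w>0$ (so $w$ is the continued square root). Its conjugate surface is obtained by taking imaginary parts instead. A minimal surface means here a smooth, harmonic, conformal map to $\mathbb R^3$ from an open subset of the plane that is an immersion off a discrete set, with vanishing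 mean curvature. **Ellipse.** Let $a>b>0$, $e=\sqrt{a^2-b^2}/a\in(0,1)$, and let $D$ be $\mathbb C$ without the poles of $\mathrm{sn}(\cdot,e)$. The function $\mathrm{dn}^2(\cdot,e)$ is meromorphic with all residues zero. Every $u\in D$ is joined to $0$ by a $C^1$ path in $D$, and $\int_0^u\mathrm{dn}^2(\sigma,e)\,d\sigma$ does not depend on the path and is a holomorphic primitive of $\mathrm{dn}^2$ on $D$. Put $F(u)=\left(b\,\mathrm{cn}(u,e),\ a\,\mathrm{sn}(u,e),\ i a\int_0^u\mathrm{dn}^2(\sigma,e)\,d\sigma\right)$, $\Psi=\mathrm{Re}\,F$. Then: 1. The substitution $\sin z=\mathrm{sn}(u,e)$ turns Björling's formula for $(b\cos z,a\sin z)$, $p=0$, into $\Psi$: for every $u\in D$ there is a path as above, from $z=0$ with initial root of positive real part, whose endpoint $z$ satisfies $\sin z=\mathrm{sn}(u,e)$ and along which $\left(b\cos z,a\sin z,i\int\sqrt{b^2\sin^2\zeta+a^2\cos^2\zeta}\,d\zeta\right)=F(u)$; conversely, for every such path there is such a $u\in D$. 2. $\Psi(D)$ is the whole Björling surface of the ellipse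 (the Elliptical Catenoid), and $(\mathrm{Im}\,F)(D)$ is its whole conjugate surface (the Elliptical Helicoid). Both $\Psi$ and $\mathrm{Im}\,F$ are minimal surfaces on $D$, and $\Psi$ is an immersion at $u\in D$ exactly when $\mathrm{dn}(u,e)\neq0$. 3. The real axis lies in $D$, $\Psi$ maps it onto the ellipse $X^2/b^2+Y^2/a^2=1$, $Z=0$, and this curve is, up to reparameterization, a geodesic of the surface. **Hyperbola.** Let $a,b>0$, $e=\sqrt{a^2+b^2}/a$, $k=1/e\in(0,1)$, and let $D$ be $\mathbb C$ without the poles of $u\mapsto\mathrm{sn}(u/k,k)$. The function $\sigma\mapsto\mathrm{cn}^2(\sigma/k,k)$ is meromorphic with all residues zero, and its integral from $0$ is well defined on $D$ in the same sense. Put $F(u)=\left(b\,\mathrm{dn}(u/k,k),\ i a k\,\mathrm{sn}(u/k,k),\ a\int_0^u\mathrm{cn}^2(\sigma/k,k)\,d\sigma\right)$. With the substitution $\sinh z=i k\,\mathrm{sn}(u/k,k)$, the values $F(u)$, $u\in D$, are exactly the values of $\left(b\cosh z,a\sinh z,i\int_0^z\sqrt{b^2\sinh^2\zeta+a^2\cosh^2\zeta}\,d\zeta\right)$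 along all paths as above whose initial root has negative real part (in both directions, as in 1). The image $(\mathrm{Re}\,F)(D)$ is the Björling surface of $(b\cosh z,a\sinh z)$, $p=0$, and $(\mathrm{Im}\,F)(D)$ is its conjugate surface. Both are minimal surfaces on $D$, and $\mathrm{Re}\,F$ is an immersion at $u\in D$ exactly when $\mathrm{cn}(u/k,k)\ne0$. The part of the imaginary axis in $D$ is mapped by $\mathrm{Re}\,F$ onto the hyperbola $X^2/b^2-Y^2/a^2=1$, $Z=0$, as a geodesic up to reparameterization. -/

import Mathlib

open Set Filter Topology
open scoped ContDiff

noncomputable section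

/-! ## Jacobi's elliptic functions -/

/-- The incomplete elliptic integral `∫₀^φ dt / (√(1 - t²) √(1 - k² t²))`. -/
def ellipticIntegral (k φ : ℝ) : ℝ :=
  ∫ t in (0 : ℝ)..φ, 1 / (√(1 - t ^ 2) * √(1 - k ^ 2 * t ^ 2))

/-- `f` is a meromorphic function on `ℂ` (with its removable singularities removed, and with the
conventional value `0` at its poles) that takes the value `g φ` at the real point
`v = ∫₀^φ dt / (√(1 - t²) √(1 - k² t²))`, for every `φ ∈ (-1, 1)`. -/
def IsMeromorphicExtension (k : ℝ) (g : ℝ → ℝ) (f : ℂ → ℂ) : Prop :=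
  MeromorphicNFOn f univ ∧
    ∀ φ ∈ Ioo (-1 : ℝ) 1, f (ellipticIntegral k φ : ℂ) = (g φ : ℂ)

/-- `sn` is the meromorphic extension of the inverse function `v ↦ φ` of the elliptic integral. -/
def IsJacobiSn (k : ℝ) (f : ℂ → ℂ) : Prop :=
  IsMeromorphicExtension k (fun φ => φ) f

/-- `cn` is the meromorphic extension of `√(1 - sn²)`. -/
def IsJacobiCn (k : ℝ) (f : ℂ → ℂ) : Prop :=
  IsMeromorphicExtension k (fun φ => √(1 - φ ^ 2)) f

/-- `dn` is the meromorphic extension of `√(1 - k² sn²)`. -/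
def IsJacobiDn (k : ℝ) (f : ℂ → ℂ) : Prop :=
  IsMeromorphicExtension k (fun φ => √(1 - k ^ 2 * φ ^ 2)) f

/-- Jacobi's elliptic sine `sn(·, k)`. -/
def jacobiSn (k : ℝ) : ℂ → ℂ := Classical.epsilon (IsJacobiSn k)

/-- Jacobi's elliptic cosine `cn(·, k)`. -/
def jacobiCn (k : ℝ) : ℂ → ℂ := Classical.epsilon (IsJacobiCn k)

/-- Jacobi's delta function `dn(·, k)`. -/
def jacobiDn (k : ℝ) : ℂ → ℂ := Classical.epsilon (IsJacobiDn k)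

/-- The complement of the set of poles of `sn(·, k)`. -/
def jacobiDomain (k : ℝ) : Set ℂ := {u | 0 ≤ meromorphicOrderAt (jacobiSn k) u}

/-! ## Residues and integrals along paths -/

/-- `R` is the residue of `f` at `p`: the value of `(2πi)⁻¹ ∮ f` over all small circles
around `p`. -/
def IsResidueAt (f : ℂ → ℂ) (p R : ℂ) : Prop :=
  ∀ᶠ r in 𝓝[>] (0 : ℝ), (2 * Real.pi * Complex.I)⁻¹ * (∮ z in C(p, r), f z) = R

/-- `α : [0,1] → U` is a `C¹` path from `p` to `q`. -/
structure IsC1Path (U : Set ℂ) (p q : ℂ) (α : ℝ → ℂ) : Prop where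
  contDiffOn : ContDiffOn ℝ 1 α (Icc 0 1)
  mapsTo : MapsTo α (Icc 0 1) U
  source : α 0 = p
  target : α 1 = q

/-- The integral `∫_α f(σ) dσ`. -/
def pathIntegral (f : ℂ → ℂ) (α : ℝ → ℂ) : ℂ :=
  ∫ t in (0 : ℝ)..1, f (α t) * derivWithin α (Icc 0 1) t

open Classical in
/-- The integral `∫₀^u f(σ) dσ` along some `C¹` path in `U` (and `0` if there is no such path). -/
def integralFromZero (f : ℂ → ℂ) (U : Set ℂ) (u : ℂ) : ℂ :=
  if h : ∃ α, IsC1Path U 0 u α then pathIntegral f h.choose else 0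

/-- The integral of `f` from `0` is a well-defined, single-valued function on `U`: every point of
`U` is joined to `0` in `U`, the integral does not depend on the path, and it is a holomorphic
primitive of `f`. -/
structure IntegralWellDefinedOn (f : ℂ → ℂ) (U : Set ℂ) : Prop where
  joined : ∀ u ∈ U, ∃ α, IsC1Path U 0 u α
  independent : ∀ u α, IsC1Path U 0 u α → pathIntegral f α = integralFromZero f U u
  hasDerivAt : ∀ u ∈ U, HasDerivAt (integralFromZero f U) (f u) u

/-! ## Minimal surfaces -/

/-- Euclidean three-space. -/
abbrev E3 := EuclideanSpace ℝ (Fin 3)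

/-- The real part of a vector of `ℂ³`. -/
def reVec (v : Fin 3 → ℂ) : E3 := WithLp.toLp 2 fun i => (v i).re

/-- The imaginary part of a vector of `ℂ³`. -/
def imVec (v : Fin 3 → ℂ) : E3 := WithLp.toLp 2 fun i => (v i).im

/-- The partial derivative of `X` in the direction `h`
(`h = 1` and `h = i` are the two coordinate directions of the parameter plane). -/
def partialD (h : ℂ) (X : ℂ → E3) (u : ℂ) : E3 := fderiv ℝ X u h

/-- The mean curvature numerator `⟪G X₁₁ - 2 F X₁₂ + E X₂₂, n⟫` vanishes at `u` for every normal
vector `n`, where `E`, `F`, `G` are the coefficients of the first fundamental form. -/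
def HasZeroMeanCurvatureAt (X : ℂ → E3) (u : ℂ) : Prop :=
  let X₁ := partialD 1 X
  let X₂ := partialD Complex.I X
  ∀ n : E3, inner ℝ n (X₁ u) = 0 → inner ℝ n (X₂ u) = 0 →
    inner ℝ n (inner ℝ (X₂ u) (X₂ u) • partialD 1 X₁ u
      - (2 * inner ℝ (X₁ u) (X₂ u)) • partialD 1 X₂ u
      + inner ℝ (X₁ u) (X₁ u) • partialD Complex.I X₂ u) = 0

/-- `X : U → ℝ³` is a (branched) minimal surface in isothermal parameters: a smooth, harmonic and
conformal map that is an immersion away from a discrete set of points, with vanishing mean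
curvature. -/
structure IsMinimalSurfaceOn (X : ℂ → E3) (U : Set ℂ) : Prop where
  isOpen : IsOpen U
  contDiffOn : ContDiffOn ℝ ∞ X U
  harmonic : InnerProductSpace.HarmonicOnNhd X U
  conformal_norm : ∀ u ∈ U, ‖partialD 1 X u‖ = ‖partialD Complex.I X u‖
  conformal_inner : ∀ u ∈ U, inner ℝ (partialD 1 X u) (partialD Complex.I X u) = 0
  immersion : ∀ᶠ u in codiscreteWithin U, Function.Injective (fderiv ℝ X u)
  meanCurvature : ∀ u ∈ U, HasZeroMeanCurvatureAt X u

/-- Near the parameter `t` the curve `X ∘ α` is a regular curve on the immersed surface `X` that is,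
up to a change of its parameter, a geodesic of `X`: for some real `μ` the vector `c'' - μ c'` is
normal to the surface. -/
def IsPregeodesicAt (X : ℂ → E3) (α : ℝ → ℂ) (t : ℝ) : Prop :=
  let c : ℝ → E3 := fun s => X (α s)
  Function.Injective (fderiv ℝ X (α t)) ∧ deriv c t ≠ 0 ∧
    ∃ μ : ℝ, ∀ h : ℂ, inner ℝ (deriv (deriv c) t - μ • deriv c t) (partialD h X (α t)) = 0

/-! ## Björling's formula -/

/-- A `C¹` path `t ↦ (z(t), w(t))`, `0 ≤ t ≤ 1`, starting over `z = p`, on the Riemann surface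
`w² = x'(z)² + y'(z)²` of the integrand of Björling's formula. -/
structure IsBjorlingPath (x y : ℂ → ℂ) (p : ℂ) (z w : ℝ → ℂ) : Prop where
  contDiffOn_z : ContDiffOn ℝ 1 z (Icc 0 1)
  contDiffOn_w : ContDiffOn ℝ 1 w (Icc 0 1)
  source : z 0 = p
  sq_eq : ∀ t ∈ Icc (0 : ℝ) 1, w t ^ 2 = deriv x (z t) ^ 2 + deriv y (z t) ^ 2

/-- The value `(x(z), y(z), i ∫ √(x'(ζ)² + y'(ζ)²) dζ)` of Björling's formula at the endpoint `z(1)`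
of the path, where the square root is continued as `w` along the path. -/
def bjorlingValue (x y : ℂ → ℂ) (z w : ℝ → ℂ) : Fin 3 → ℂ :=
  ![x (z 1), y (z 1), Complex.I * ∫ t in (0 : ℝ)..1, w t * derivWithin z (Icc 0 1) t]

/-- The Björling surface of the curve `(x, y)` with base point `p`: all values of the multivalued map
`Re (x(z), y(z), i ∫_p^z √(x'² + y'²))`, over all paths from `p` along which the square root is
continued, starting from the root with positive real part. -/
def bjorlingSurface (x y : ℂ → ℂ) (p : ℂ) : Set E3 :=
  {q | ∃ z w, IsBjorlingPath x y p z w ∧ 0 < (w 0).re ∧ q = reVec (bjorlingValue x y z w)}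

/-- The conjugate of the Björling surface: the imaginary part replaces the real part. -/
def conjugateBjorlingSurface (x y : ℂ → ℂ) (p : ℂ) : Set E3 :=
  {q | ∃ z w, IsBjorlingPath x y p z w ∧ 0 < (w 0).re ∧ q = imVec (bjorlingValue x y z w)}

/-! ## The surfaces of the ellipse and of the hyperbola -/

/-- The eccentricity of the ellipse with semi-axes `a > b`. -/
def ellipseModulus (a b : ℝ) : ℝ := √(a ^ 2 - b ^ 2) / a

/-- `(b cn(u,e), a sn(u,e), i a ∫₀^u dn²(σ,e) dσ)`. -/
def ellipseCurve (a b : ℝ) (u : ℂ) : Fin 3 → ℂ :=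
  let e := ellipseModulus a b
  ![b * jacobiCn e u, a * jacobiSn e u,
    Complex.I * a * integralFromZero (fun σ => jacobiDn e σ ^ 2) (jacobiDomain e) u]

/-- The parameterization `Ψ` of the Elliptical Catenoid. -/
def ellipticalCatenoid (a b : ℝ) (u : ℂ) : E3 := reVec (ellipseCurve a b u)

/-- The parameterization of the Elliptical Helicoid. -/
def ellipticalHelicoid (a b : ℝ) (u : ℂ) : E3 := imVec (ellipseCurve a b u)

/-- The modulus `k = 1/e`, `e = √(a² + b²)/a`, for the hyperbola `X²/b² - Y²/a² = 1`. -/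
def hyperbolaModulus (a b : ℝ) : ℝ := a / √(a ^ 2 + b ^ 2)

/-- The complement of the set of poles of `u ↦ sn(u/k, k)`. -/
def hyperbolaDomain (a b : ℝ) : Set ℂ :=
  {u | u / (hyperbolaModulus a b : ℂ) ∈ jacobiDomain (hyperbolaModulus a b)}

/-- `(b dn(u/k,k), i a k sn(u/k,k), a ∫₀^u cn²(σ/k,k) dσ)`. -/
def hyperbolaCurve (a b : ℝ) (u : ℂ) : Fin 3 → ℂ :=
  let k := hyperbolaModulus a b
  ![b * jacobiDn k (u / k), Complex.I * a * k * jacobiSn k (u / k),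
    a * integralFromZero (fun σ => jacobiCn k (σ / k) ^ 2) (hyperbolaDomain a b) u]

/-- The parameterization of the Björling surface of the hyperbola. -/
def hyperbolaSurface (a b : ℝ) (u : ℂ) : E3 := reVec (hyperbolaCurve a b u)

/-- The parameterization of its conjugate surface. -/
def hyperbolaConjugate (a b : ℝ) (u : ℂ) : E3 := imVec (hyperbolaCurve a b u)

end

/-! Put `(s, c, d) = (sn, cn, dn)`. These functions solve `s' = c d`, `c' = -s d`, `d' = -k² s c`
and parameterize the curve `S² + C² = 1`, `W² + k² S² = 1`. A Björling path is a path on this curve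
from `(0, 1, 1)`. For the ellipse take `(sin z, cos z, w/a)` with `k = e`, because `a² e² = a² -
b²`. For the hyperbola with the negative root take `(-(i/k) sinh z, -w/a, cosh z)`, because `k² (a²
+ b²) = a²`. The substitution is the lift of such a path to the plane without the poles of `sn`.
There `dz = dn du`, respectively `dz = i k cn dv` with `v = u/k`, so `w dz` becomes `a dn² du`,
respectively `-i a k cn² dv`, which has a single-valued primitive.

Existence on all of `ℂ`: inverting the elliptic integral gives a germ at `0`. Uniqueness for the
differential system proves the duplication formulas for the germ, and iterating them extends `sn`,
`cn`, `dn` and a primitive `E` of `dn²` meromorphically to discs of doubled radius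
(`exists_isJacobiSystem`). The identity theorem spreads the relations to all of `ℂ` and gives
uniqueness.

The main tool is `IsJacobiSystem.continuation`: a solution of the system along a path in the plane
keeps agreeing with `(sn, cn, dn)` and never meets a pole, since it has finite limits while `sn`
tends to infinity at a pole. It yields `lifting`, the values on the two axes, and the symmetries of
`sn`, `cn`, `dn`. Conversely, a path in the domain gives a Björling path by taking a logarithm of
`cn + i sn`, respectively `dn + i k sn`.

The derivative of each curve in `ℂ³` is isotropic and vanishes only at the simple zeros of `dn`,
respectively `cn`; minimality follows for real and imaginary parts alike. Along the conic the
surface meets the plane `Z = 0` orthogonally, so this planar curve is a geodesic up to parameter.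
For the hyperbola the sign of the root is exchanged by `u ↦ -ū` (real part) and by a reflection in
the quarter period (imaginary part). -/

noncomputable section

/-! ## The differential system of Jacobi's elliptic functions -/

/-- The vector field `(s, c, d) ↦ (c d, -s d, -k² s c)`. -/
def jacobiField (k : ℝ) (Y : ℂ × ℂ × ℂ) : ℂ × ℂ × ℂ :=
  (Y.2.1 * Y.2.2, -(Y.1 * Y.2.2), -((k : ℂ) ^ 2 * (Y.1 * Y.2.1)))

lemma contDiff_jacobiField (k : ℝ) : ContDiff ℝ 1 (jacobiField k) := by
  unfold jacobiField
  fun_prop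

lemma exists_lipschitzOnWith_jacobiField (k R : ℝ) :
    ∃ K : NNReal, LipschitzOnWith K (jacobiField k) (Metric.closedBall 0 R) := by
  have hc := contDiff_jacobiField k
  obtain ⟨C, hC⟩ := (isCompact_closedBall (0 : ℂ × ℂ × ℂ) R).exists_bound_of_continuousOn
    (hc.continuous_fderiv one_ne_zero).continuousOn
  refine ⟨C.toNNReal, (convex_closedBall _ _).lipschitzOnWith_of_nnnorm_fderiv_le
    (fun x _ => (hc.differentiable one_ne_zero) x) fun x hx => ?_⟩
  rw [← NNReal.coe_le_coe]
  exact (hC x hx).trans (Real.le_coe_toNNReal C)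

/-- The field is only locally Lipschitz, but by compactness both solutions stay in one ball, where
uniqueness for ordinary differential equations applies. The factor `g` will be the velocity of a
path in the complex plane. -/
lemma eqOn_of_hasDerivWithinAt_jacobiField {k a b : ℝ} {g : ℝ → ℂ} {Y Z : ℝ → ℂ × ℂ × ℂ}
    (hg : ContinuousOn g (Icc a b))
    (hY : ∀ t ∈ Icc a b, HasDerivWithinAt Y (g t • jacobiField k (Y t)) (Icc a b) t)
    (hZ : ∀ t ∈ Icc a b, HasDerivWithinAt Z (g t • jacobiField k (Z t)) (Icc a b) t)
    (h : Y a = Z a) : EqOn Y Z (Icc a b) := by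
  have hYc : ContinuousOn Y (Icc a b) := fun t ht => (hY t ht).continuousWithinAt
  have hZc : ContinuousOn Z (Icc a b) := fun t ht => (hZ t ht).continuousWithinAt
  obtain ⟨M, hM⟩ := isCompact_Icc.exists_bound_of_continuousOn hg
  obtain ⟨R₁, hR₁⟩ := isCompact_Icc.exists_bound_of_continuousOn hYc
  obtain ⟨R₂, hR₂⟩ := isCompact_Icc.exists_bound_of_continuousOn hZc
  obtain ⟨K, hK⟩ := exists_lipschitzOnWith_jacobiField k (max R₁ R₂)
  have hd : ∀ {X : ℝ → ℂ × ℂ × ℂ} {X' : ℂ × ℂ × ℂ} {t : ℝ}, t ∈ Ico a b →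
      HasDerivWithinAt X X' (Icc a b) t → HasDerivWithinAt X X' (Ici t) t := fun ht hX =>
    hX.mono_of_mem_nhdsWithin (mem_of_superset (Icc_mem_nhdsGE ht.2)
      (Icc_subset_Icc_left ht.1))
  refine ODE_solution_unique_of_mem_Icc_right (v := fun t y => g t • jacobiField k y)
    (s := fun _ => Metric.closedBall 0 (max R₁ R₂)) (K := M.toNNReal * K) (fun t ht => ?_)
    hYc (fun t ht => hd ht (hY t (Ico_subset_Icc_self ht))) (fun t ht => ?_)
    hZc (fun t ht => hd ht (hZ t (Ico_subset_Icc_self ht))) (fun t ht => ?_) h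
  · refine LipschitzOnWith.of_dist_le_mul fun x hx y hy => ?_
    rw [dist_eq_norm, ← smul_sub, norm_smul, NNReal.coe_mul, mul_assoc, ← dist_eq_norm]
    exact mul_le_mul ((hM t (Ico_subset_Icc_self ht)).trans (Real.le_coe_toNNReal M))
      (hK.dist_le_mul x hx y hy) dist_nonneg (NNReal.coe_nonneg _)
  · simpa using Or.inl (hR₁ t (Ico_subset_Icc_self ht))
  · simpa using Or.inr (hR₂ t (Ico_subset_Icc_self ht))

/-- Restriction to the rays `t ↦ t z` reduces complex solutions to real ones with constant velocity
`z`. -/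
lemma eventuallyEq_of_hasDerivAt_jacobiField {k : ℝ} {Y Z : ℂ → ℂ × ℂ × ℂ}
    (hY : ∀ᶠ z in 𝓝 0, HasDerivAt Y (jacobiField k (Y z)) z)
    (hZ : ∀ᶠ z in 𝓝 0, HasDerivAt Z (jacobiField k (Z z)) z) (h : Y 0 = Z 0) :
    Y =ᶠ[𝓝 0] Z := by
  obtain ⟨r, hr, hball⟩ := Metric.eventually_nhds_iff_ball.1 (hY.and hZ)
  refine Metric.eventually_nhds_iff_ball.2 ⟨r, hr, fun z hz => ?_⟩
  have hmem : ∀ t ∈ Icc (0 : ℝ) 1, (t : ℂ) * z ∈ Metric.ball (0 : ℂ) r := fun t ht => by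
    rw [mem_ball_zero_iff] at hz ⊢
    rw [norm_mul, Complex.norm_real, Real.norm_of_nonneg ht.1]
    nlinarith [ht.2, norm_nonneg z]
  have hline : ∀ t : ℝ, HasDerivAt (fun t : ℝ => (t : ℂ) * z) z t := fun t => by
    simpa using (Complex.ofRealCLM.hasDerivAt (x := t)).mul_const z
  have key := eqOn_of_hasDerivWithinAt_jacobiField (k := k) (a := 0) (b := 1) (g := fun _ => z)
    (Y := fun t => Y (t * z)) (Z := fun t => Z (t * z)) continuousOn_const
    (fun t ht => ((hball _ (hmem t ht)).1.scomp t (hline t)).hasDerivWithinAt)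
    (fun t ht => ((hball _ (hmem t ht)).2.scomp t (hline t)).hasDerivWithinAt) (by simpa using h)
  simpa using key (right_mem_Icc.2 zero_le_one)

/-- A branch of `√(1 - κ z²)` on the unit disc, needed for `κ = 1` and `κ = k²`. Written as an
exponential, it visibly has no zeros. -/
lemma hasDerivAt_exp_log_half {κ z : ℂ} (hκ : ‖κ‖ ≤ 1) (hz : z ∈ Metric.ball (0 : ℂ) 1) :
    Complex.exp (Complex.log (1 - κ * z ^ 2) / 2) ^ 2 = 1 - κ * z ^ 2 ∧
    HasDerivAt (fun z => Complex.exp (Complex.log (1 - κ * z ^ 2) / 2))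
      (-(κ * z) / Complex.exp (Complex.log (1 - κ * z ^ 2) / 2)) z := by
  have hlt : ‖κ * z ^ 2‖ < 1 := by
    rw [mem_ball_zero_iff] at hz
    rw [norm_mul, norm_pow]
    nlinarith [norm_nonneg z, norm_nonneg κ, mul_nonneg (norm_nonneg z) (norm_nonneg κ)]
  have hslit : 1 - κ * z ^ 2 ∈ Complex.slitPlane := by
    left
    have := (Complex.abs_re_le_norm (κ * z ^ 2)).trans_lt hlt
    have := (abs_lt.1 this).2
    simp only [Complex.sub_re, Complex.one_re]
    linarith
  have hne := Complex.slitPlane_ne_zero hslit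
  have hsq : Complex.exp (Complex.log (1 - κ * z ^ 2) / 2) ^ 2 = 1 - κ * z ^ 2 := by
    rw [← Complex.exp_nat_mul, Nat.cast_ofNat, mul_div_cancel₀ _ two_ne_zero, Complex.exp_log hne]
  refine ⟨hsq, ?_⟩
  have h1 : HasDerivAt (fun z : ℂ => 1 - κ * z ^ 2) (-(κ * (2 * z))) z := by
    simpa using ((hasDerivAt_pow 2 z).const_mul κ).const_sub 1
  refine (((h1.clog hslit).div_const 2).cexp).congr_deriv ?_
  set p := Complex.exp (Complex.log (1 - κ * z ^ 2) / 2) with hp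
  have hp0 : p ≠ 0 := Complex.exp_ne_zero _
  rw [← hsq]
  field_simp

/-- The germs at `0` of `sn`, `cn`, `dn` and of `∫ dn²`. -/
structure IsJacobiGerm (k : ℝ) (Y : ℂ → ℂ × ℂ × ℂ) (E : ℂ → ℂ) : Prop where
  hasDerivAt : ∀ᶠ z in 𝓝 0, HasDerivAt Y (jacobiField k (Y z)) z
  hasDerivAt_E : ∀ᶠ z in 𝓝 0, HasDerivAt E ((Y z).2.2 ^ 2) z
  zero : Y 0 = (0, 1, 1)
  zero_E : E 0 = 0

/-- The germ of `sn` is the local inverse of the complex elliptic integral `G`. Composing it with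
the two square roots gives `cn` and `dn`, so the quadratic relations are built in. -/
lemma exists_isJacobiGerm {k : ℝ} (hk0 : 0 < k) (hk1 : k < 1) :
    ∃ Y E, IsJacobiGerm k Y E ∧ ∀ᶠ z in 𝓝 0,
      (Y z).1 ^ 2 + (Y z).2.1 ^ 2 = 1 ∧ (Y z).2.2 ^ 2 + k ^ 2 * (Y z).1 ^ 2 = 1 := by
  have hk2 : ‖(k : ℂ) ^ 2‖ ≤ 1 := by
    rw [norm_pow, Complex.norm_real, Real.norm_of_nonneg hk0.le]
    nlinarith
  set p : ℂ → ℂ := fun z => Complex.exp (Complex.log (1 - 1 * z ^ 2) / 2) with hpdef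
  set q : ℂ → ℂ := fun z => Complex.exp (Complex.log (1 - (k : ℂ) ^ 2 * z ^ 2) / 2) with hqdef
  have hp : ∀ z ∈ Metric.ball (0 : ℂ) 1, p z ^ 2 = 1 - 1 * z ^ 2 ∧
      HasDerivAt p (-(1 * z) / p z) z := fun z hz => hasDerivAt_exp_log_half (by simp) hz
  have hq : ∀ z ∈ Metric.ball (0 : ℂ) 1, q z ^ 2 = 1 - (k : ℂ) ^ 2 * z ^ 2 ∧
      HasDerivAt q (-((k : ℂ) ^ 2 * z) / q z) z := fun z hz => hasDerivAt_exp_log_half hk2 hz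
  have hp0 : ∀ z, p z ≠ 0 := fun z => Complex.exp_ne_zero _
  have hq0 : ∀ z, q z ≠ 0 := fun z => Complex.exp_ne_zero _
  have hdiff : DifferentiableOn ℂ (fun z => (p z * q z)⁻¹) (Metric.ball 0 1) := fun z hz =>
    (((hp z hz).2.mul (hq z hz).2).differentiableAt.inv
      (mul_ne_zero (hp0 z) (hq0 z))).differentiableWithinAt
  obtain ⟨G, hG0, hG⟩ := hdiff.isExactOn_ball.with_val_at 0 0
  have hmem0 : (0 : ℂ) ∈ Metric.ball (0 : ℂ) 1 := Metric.mem_ball_self one_pos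
  have hGan : AnalyticAt ℂ G 0 := DifferentiableOn.analyticAt
    (fun z hz => (hG z hz).differentiableAt.differentiableWithinAt) (Metric.ball_mem_nhds 0 one_pos)
  have hG' : deriv G 0 ≠ 0 := by
    rw [(hG 0 hmem0).deriv]
    exact inv_ne_zero (mul_ne_zero (hp0 0) (hq0 0))
  -- From `G (s u) = u` and `G' = 1/(p q)` one reads off `s' = p(s) q(s)`.
  set s := hGan.hasStrictDerivAt.localInverse _ _ _ hG' with hs
  have hsan : AnalyticAt ℂ s 0 := by
    have := hGan.analyticAt_localInverse hG'
    rwa [hG0] at this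
  have hs0 : s 0 = 0 := by
    have : s (G 0) = 0 := HasStrictFDerivAt.localInverse_apply_image ..
    rwa [hG0] at this
  have hinv : ∀ᶠ u in 𝓝 (0 : ℂ), G (s u) = u := by
    have := HasStrictDerivAt.eventually_right_inverse (hGan.hasStrictDerivAt) hG'
    rwa [hG0] at this
  have hball : ∀ᶠ u in 𝓝 (0 : ℂ), s u ∈ Metric.ball (0 : ℂ) 1 :=
    hsan.continuousAt.eventually_mem (by rw [hs0]; exact Metric.ball_mem_nhds 0 one_pos)
  have hs' : ∀ᶠ u in 𝓝 (0 : ℂ), HasDerivAt s (p (s u) * q (s u)) u := by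
    filter_upwards [hinv.eventually_nhds, hball, hsan.eventually_analyticAt] with u hu hub hua
    have h1 := (hG _ hub).comp u hua.differentiableAt.hasDerivAt
    have h2 := (h1.congr_of_eventuallyEq (f₁ := fun u => u)
      (hu.mono fun v hv => hv.symm)).unique (hasDerivAt_id' u)
    have h3 := hua.differentiableAt.hasDerivAt
    have := mul_ne_zero (hp0 (s u)) (hq0 (s u))
    rw [inv_mul_eq_one₀ this] at h2
    rwa [← h2] at h3
  have hY : ∀ᶠ u in 𝓝 (0 : ℂ), HasDerivAt (fun u => (s u, p (s u), q (s u)))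
      (jacobiField k (s u, p (s u), q (s u))) u := by
    filter_upwards [hs', hball] with u hu hub
    have h1 := (hp _ hub).2.comp u hu
    have h2 := (hq _ hub).2.comp u hu
    have hp1 := hp0 (s u)
    have hq1 := hq0 (s u)
    refine (hu.prodMk (h1.prodMk h2)).congr_deriv ?_
    simp only [jacobiField, Prod.mk.injEq, true_and]
    constructor <;> field_simp
  obtain ⟨r, hr, hrb⟩ := Metric.eventually_nhds_iff_ball.1 hY
  have hd2 : DifferentiableOn ℂ (fun u => q (s u) ^ 2) (Metric.ball 0 r) := fun z hz =>
    ((show HasDerivAt (fun u => q (s u)) _ z from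
      (hrb z hz).snd.snd).differentiableAt.pow 2).differentiableWithinAt
  obtain ⟨E, hE0, hE⟩ := hd2.isExactOn_ball.with_val_at 0 0
  refine ⟨fun u => (s u, p (s u), q (s u)), E, ⟨hY, ?_, ?_, hE0⟩, ?_⟩
  · exact Metric.eventually_nhds_iff_ball.2 ⟨r, hr, hE⟩
  · simp [hs0, hpdef, hqdef]
  · filter_upwards [hball] with u hu
    rw [(hp _ hu).1, (hq _ hu).1]
    constructor <;> ring

/-! ### Duplication formulas -/

/-- The duplication formula for `(sn, cn, dn)`. -/
def jacobiDup (k : ℝ) (Y : ℂ × ℂ × ℂ) : ℂ × ℂ × ℂ :=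
  (2 * Y.1 * Y.2.1 * Y.2.2 / (1 - k ^ 2 * Y.1 ^ 4),
    (Y.2.1 ^ 2 - Y.1 ^ 2 * Y.2.2 ^ 2) / (1 - k ^ 2 * Y.1 ^ 4),
    (Y.2.2 ^ 2 - k ^ 2 * Y.1 ^ 2 * Y.2.1 ^ 2) / (1 - k ^ 2 * Y.1 ^ 4))

/-- The duplication formula for `∫ dn²`. -/
def jacobiDupE (k : ℝ) (Y : ℂ × ℂ × ℂ) (e : ℂ) : ℂ := 2 * e - k ^ 2 * Y.1 ^ 2 * (jacobiDup k Y).1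

/-- This and the next two identities compare quotient-rule numerators for the coordinates of
`jacobiDup`, with `K = k²`, modulo the two quadratic relations. -/
lemma jacobiDup_deriv_fst {s c d K : ℂ} (hc : c ^ 2 = 1 - s ^ 2) (hd : d ^ 2 = 1 - K * s ^ 2) :
    ((2 * (c * d) * c + 2 * s * -(s * d)) * d + 2 * s * c * -(K * (s * c))) * (1 - K * s ^ 4) -
        2 * s * c * d * -(K * (4 * s ^ 3 * (c * d))) =
      2 * ((c ^ 2 - s ^ 2 * d ^ 2) * (d ^ 2 - K * s ^ 2 * c ^ 2)) := by
  grind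

lemma jacobiDup_deriv_snd {s c d K : ℂ} (hd : d ^ 2 = 1 - K * s ^ 2) : (2 * c * -(s * d) - (2 * s * (c * d) * d ^ 2 + s ^ 2 * (2 * d * -(K * (s * c))))) *
        (1 - K * s ^ 4) - (c ^ 2 - s ^ 2 * d ^ 2) * -(K * (4 * s ^ 3 * (c * d))) =
      2 * -(2 * s * c * d * (d ^ 2 - K * s ^ 2 * c ^ 2)) := by
  grind

lemma jacobiDup_deriv_trd {s c d K : ℂ} (hc : c ^ 2 = 1 - s ^ 2) (hd : d ^ 2 = 1 - K * s ^ 2) : (2 * d * -(K * (s * c)) - (K * (2 * s * (c * d)) * c ^ 2 + K * s ^ 2 * (2 * c * -(s * d)))) *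
        (1 - K * s ^ 4) - (d ^ 2 - K * s ^ 2 * c ^ 2) * -(K * (4 * s ^ 3 * (c * d))) =
      2 * -(K * (2 * s * c * d * (c ^ 2 - s ^ 2 * d ^ 2))) := by
  grind

lemma jacobiDupE_deriv {s c d K Δ : ℂ} (hc : c ^ 2 = 1 - s ^ 2) (hd : d ^ 2 = 1 - K * s ^ 2) (hΔ : Δ = 1 - K * s ^ 4) : 2 * d ^ 2 * Δ ^ 2 - K * (2 * s * (c * d)) * (2 * s * c * d) * Δ - K * s ^ 2 * (2 * ((c ^ 2 - s ^ 2 * d ^ 2) *  (d ^ 2 - K * s ^ 2 * c ^ 2))) =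
      2 * (d ^ 2 - K * s ^ 2 * c ^ 2) ^ 2 := by
  subst hΔ
  grind

/-- The factor `2` is cancelled by the inner derivative of `z ↦ z / 2`, so `z ↦ jacobiDup k (Y (z /
2))` solves the original system. -/
lemma hasDerivAt_jacobiDup {k : ℝ} {Y : ℂ → ℂ × ℂ × ℂ} {z : ℂ}
    (hY : HasDerivAt Y (jacobiField k (Y z)) z) (h1 : (Y z).1 ^ 2 + (Y z).2.1 ^ 2 = 1)
    (h2 : (Y z).2.2 ^ 2 + k ^ 2 * (Y z).1 ^ 2 = 1) (h : 1 - (k : ℂ) ^ 2 * (Y z).1 ^ 4 ≠ 0) :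
    HasDerivAt (fun z => jacobiDup k (Y z)) ((2 : ℂ) • jacobiField k (jacobiDup k (Y z))) z := by
  have hs : HasDerivAt (fun z => (Y z).1) ((Y z).2.1 * (Y z).2.2) z := hY.fst
  have hc : HasDerivAt (fun z => (Y z).2.1) (-((Y z).1 * (Y z).2.2)) z := hY.snd.fst
  have hd : HasDerivAt (fun z => (Y z).2.2) (-((k : ℂ) ^ 2 * ((Y z).1 * (Y z).2.1))) z :=
    hY.snd.snd
  have hΔ := ((hs.pow 4).const_mul ((k : ℂ) ^ 2)).const_sub 1
  have e1 := (((hs.const_mul 2).mul hc).mul hd).div hΔ h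
  have e2 := ((hc.pow 2).sub ((hs.pow 2).mul (hd.pow 2))).div hΔ h
  have e3 := ((hd.pow 2).sub (((hs.pow 2).const_mul ((k : ℂ) ^ 2)).mul (hc.pow 2))).div hΔ h
  refine (e1.prodMk (e2.prodMk e3)).congr_deriv ?_
  set s := (Y z).1 with hsdef
  set c := (Y z).2.1 with hcdef
  set d := (Y z).2.2 with hddef
  have hc2 : c ^ 2 = 1 - s ^ 2 := by linear_combination h1
  have hd2 : d ^ 2 = 1 - k ^ 2 * s ^ 2 := by linear_combination h2
  simp only [jacobiDup, jacobiField, Prod.smul_mk, Prod.mk.injEq, smul_eq_mul, ← hsdef, ← hcdef,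
    ← hddef]
  simp only [Pi.mul_apply, Pi.pow_apply, Pi.sub_apply, ← hsdef, ← hcdef, ← hddef]
  refine ⟨?_, ?_, ?_⟩
  · rw [div_mul_div_comm, ← pow_two, ← mul_div_assoc, ← jacobiDup_deriv_fst hc2 hd2]
    norm_num
  · rw [div_mul_div_comm, ← pow_two, ← neg_div, ← mul_div_assoc, ← jacobiDup_deriv_snd hd2]
    norm_num
  · rw [div_mul_div_comm, ← pow_two, ← mul_div_assoc, ← neg_div, ← mul_div_assoc,
      ← jacobiDup_deriv_trd hc2 hd2]
    norm_num

lemma hasDerivAt_jacobiDupE {k : ℝ} {Y : ℂ → ℂ × ℂ × ℂ} {E : ℂ → ℂ} {z : ℂ}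
    (hY : HasDerivAt Y (jacobiField k (Y z)) z) (hE : HasDerivAt E ((Y z).2.2 ^ 2) z)
    (h1 : (Y z).1 ^ 2 + (Y z).2.1 ^ 2 = 1)
    (h2 : (Y z).2.2 ^ 2 + k ^ 2 * (Y z).1 ^ 2 = 1) (h : 1 - (k : ℂ) ^ 2 * (Y z).1 ^ 4 ≠ 0) :
    HasDerivAt (fun z => jacobiDupE k (Y z) (E z)) (2 * (jacobiDup k (Y z)).2.2 ^ 2) z := by
  have hs : HasDerivAt (fun z => (Y z).1) ((Y z).2.1 * (Y z).2.2) z := hY.fst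
  have hD : HasDerivAt (fun z => (jacobiDup k (Y z)).1) _ z := (hasDerivAt_jacobiDup hY h1 h2 h).fst
  refine ((hE.const_mul 2).sub (((hs.pow 2).const_mul ((k : ℂ) ^ 2)).mul hD)).congr_deriv ?_
  set s := (Y z).1 with hsdef
  set c := (Y z).2.1 with hcdef
  set d := (Y z).2.2 with hddef
  have hc2 : c ^ 2 = 1 - s ^ 2 := by linear_combination h1
  have hd2 : d ^ 2 = 1 - k ^ 2 * s ^ 2 := by linear_combination h2
  simp only [jacobiDup, jacobiField, Prod.smul_mk, smul_eq_mul, ← hsdef, ← hcdef, ← hddef]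
  simp only [Pi.pow_apply, ← hsdef]
  set Δ := 1 - (k : ℂ) ^ 2 * s ^ 4 with hΔ
  have := jacobiDupE_deriv hc2 hd2 hΔ
  rw [div_pow, ← mul_div_assoc 2 (_ ^ 2), ← this]
  field_simp
  norm_num
  ring

/-- Both sides solve the same initial value problem. For `E` the difference of the two sides has
derivative zero once the formula for `dn` is known. -/
lemma IsJacobiGerm.eventuallyEq_dup {k : ℝ} {Y : ℂ → ℂ × ℂ × ℂ} {E : ℂ → ℂ}
    (h : IsJacobiGerm k Y E)
    (hq : ∀ᶠ z in 𝓝 0, (Y z).1 ^ 2 + (Y z).2.1 ^ 2 = 1 ∧ (Y z).2.2 ^ 2 + k ^ 2 * (Y z).1 ^ 2 = 1) :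
    (fun z => jacobiDup k (Y (z / 2))) =ᶠ[𝓝 0] Y ∧
      (fun z => jacobiDupE k (Y (z / 2)) (E (z / 2))) =ᶠ[𝓝 0] E := by
  have hYc : ContinuousAt Y 0 := h.hasDerivAt.self_of_nhds.continuousAt
  have hΔ : ∀ᶠ z in 𝓝 0, 1 - (k : ℂ) ^ 2 * (Y z).1 ^ 4 ≠ 0 := by
    have : ContinuousAt (fun z => 1 - (k : ℂ) ^ 2 * (Y z).1 ^ 4) 0 :=
      continuousAt_const.sub (continuousAt_const.mul (hYc.fst.pow 4))
    exact this.eventually_ne (by simp [h.zero])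
  have hhalf : Tendsto (fun z : ℂ => z / 2) (𝓝 0) (𝓝 0) := by
    simpa using (continuous_id.div_const (2 : ℂ)).tendsto 0
  have hh : ∀ z : ℂ, HasDerivAt (fun z : ℂ => z / 2) (1 / 2) z := fun z =>
    (hasDerivAt_id' z).div_const 2
  have hY2 : ∀ᶠ z in 𝓝 0, HasDerivAt (fun z => jacobiDup k (Y (z / 2)))
      (jacobiField k (jacobiDup k (Y (z / 2)))) z := by
    filter_upwards [hhalf.eventually (h.hasDerivAt.and (hq.and hΔ))] with z hz
    refine ((hasDerivAt_jacobiDup hz.1 hz.2.1.1 hz.2.1.2 hz.2.2).scomp z (hh z)).congr_deriv ?_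
    rw [smul_smul]
    norm_num
  have h1 := eventuallyEq_of_hasDerivAt_jacobiField hY2 h.hasDerivAt
    (by simp [jacobiDup, h.zero])
  refine ⟨h1, ?_⟩
  have hE2 : ∀ᶠ z in 𝓝 0, HasDerivAt (fun z => jacobiDupE k (Y (z / 2)) (E (z / 2)) - E z) 0 z := by
    filter_upwards [hhalf.eventually (h.hasDerivAt.and (h.hasDerivAt_E.and (hq.and hΔ))),
      h.hasDerivAt_E, h1] with z hz hE h1
    refine (((hasDerivAt_jacobiDupE hz.1 hz.2.1 hz.2.2.1.1 hz.2.2.1.2 hz.2.2.2).comp z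
      (hh z)).sub hE).congr_deriv ?_
    rw [h1]
    ring
  obtain ⟨r, hr, hball⟩ := Metric.eventually_nhds_iff_ball.1 hE2
  refine Metric.eventually_nhds_iff_ball.2 ⟨r, hr, fun z hz => ?_⟩
  have := (convex_ball (0 : ℂ) r).is_const_of_fderivWithin_eq_zero (𝕜 := ℂ)
    (f := fun z => jacobiDupE k (Y (z / 2)) (E (z / 2)) - E z)
    (fun x hx => (hball x hx).differentiableAt.differentiableWithinAt)
    (fun x hx => by
      rw [fderivWithin_of_isOpen Metric.isOpen_ball hx]
      ext
      simp [(hball x hx).deriv]) hz (Metric.mem_ball_self hr)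
  simp only [zero_div, h.zero_E, h.zero, jacobiDupE, jacobiDup] at this
  norm_num at this
  simpa [jacobiDupE, jacobiDup, sub_eq_zero] using this

/-! ## Meromorphic continuation -/

/-- The identity theorem: infinite order of `f - g` at one point of a connected set propagates to
every point. -/
lemma eventually_nhdsNE_of_meromorphicOrderAt_sub {f g : ℂ → ℂ} {U : Set ℂ} {x y : ℂ}
    (hU : IsPreconnected U) (hf : MeromorphicOn f U) (hg : MeromorphicOn g U) (hx : x ∈ U)
    (h : ∃ᶠ z in 𝓝[≠] x, f z = g z) (hy : y ∈ U) : f =ᶠ[𝓝[≠] y] g := by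
  have htop : meromorphicOrderAt (f - g) x = ⊤ := by
    by_contra hne
    have := (meromorphicOrderAt_ne_top_iff_eventually_ne_zero ((hf x hx).sub (hg x hx))).1 hne
    obtain ⟨z, h1, h2⟩ := (h.and_eventually this).exists
    exact h2 (by simp [h1])
  have : meromorphicOrderAt (f - g) y = ⊤ := by
    by_contra hne
    exact (hf.sub hg).meromorphicOrderAt_ne_top_of_isPreconnected hU hy hx hne htop
  filter_upwards [meromorphicOrderAt_eq_top_iff.1 this] with z hz
  simpa [sub_eq_zero] using hz

lemma MeromorphicNFOn.eqOn_of_frequently_eq {f g : ℂ → ℂ} {U : Set ℂ} {x : ℂ}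
    (hU : IsPreconnected U) (hf : MeromorphicNFOn f U) (hg : MeromorphicNFOn g U) (hx : x ∈ U)
    (h : ∃ᶠ z in 𝓝[≠] x, f z = g z) : EqOn f g U := fun _ hy =>
  ((MeromorphicNFAt.eventuallyEq_nhdsNE_iff_eventuallyEq_nhds (hf hy) (hg hy)).1
    (eventually_nhdsNE_of_meromorphicOrderAt_sub hU hf.meromorphicOn hg.meromorphicOn hx h
      hy)).self_of_nhds

/-- Functions with a common germ on an exhausting sequence of discs agree on overlaps by the
identity theorem. Normal forms turn agreement off a discrete set into equality everywhere. -/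
lemma exists_meromorphicNFOn_univ {f : ℕ → ℂ → ℂ} {r : ℝ} (hr : 0 < r)
    (hf : ∀ n, MeromorphicOn (f n) (Metric.ball 0 (2 ^ n * r)))
    (h : ∀ n, f n =ᶠ[𝓝 0] f 0) :
    ∃ F, MeromorphicNFOn F univ ∧ F =ᶠ[𝓝[≠] 0] f 0 := by
  set B : ℕ → Set ℂ := fun n => Metric.ball 0 (2 ^ n * r) with hB
  have hB0 : ∀ n, (0 : ℂ) ∈ B n := fun n => Metric.mem_ball_self (by positivity)
  have hmono : Monotone B := fun m n hmn => Metric.ball_subset_ball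
    (mul_le_mul_of_nonneg_right (pow_le_pow_right₀ one_le_two hmn) hr.le)
  have hcover : ∀ z : ℂ, ∃ n, z ∈ B n := fun z => by
    obtain ⟨n, hn⟩ := pow_unbounded_of_one_lt (‖z‖ / r) one_lt_two
    exact ⟨n, mem_ball_zero_iff.2 ((div_lt_iff₀ hr).1 hn)⟩
  set G : ℕ → ℂ → ℂ := fun n => toMeromorphicNFOn (f n) (B n) with hG
  have hGnf : ∀ n, MeromorphicNFOn (G n) (B n) := fun n => meromorphicNFOn_toMeromorphicNFOn _ _
  have hG0 : ∀ n, G n =ᶠ[𝓝[≠] 0] f 0 := fun n =>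
    ((hf n).toMeromorphicNFOn_eq_self_on_nhdsNE (hB0 n)).trans
      ((h n).filter_mono nhdsWithin_le_nhds)
  have hGG : ∀ m n, m ≤ n → EqOn (G m) (G n) (B m) := fun m n hmn =>
    MeromorphicNFOn.eqOn_of_frequently_eq (convex_ball _ _).isPreconnected (hGnf m)
      (fun z hz => hGnf n (hmono hmn hz)) (hB0 m)
      ((hG0 m).trans (hG0 n).symm).frequently
  classical
  -- The value is read off the first disc that contains `z`; every later disc gives the same one.
  set F : ℂ → ℂ := fun z => G (Nat.find (hcover z)) z with hF
  have hFG : ∀ n, EqOn F (G n) (B n) := fun n z hz =>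
    hGG _ n (Nat.find_min' (hcover z) hz) (Nat.find_spec (hcover z))
  refine ⟨F, fun z _ => ?_, ?_⟩
  · obtain ⟨n, hn⟩ := hcover z
    exact (meromorphicNFAt_congr ((hFG n).eventuallyEq_of_mem
      (Metric.isOpen_ball.mem_nhds hn))).2 (hGnf n hn)
  · exact (((hFG 0).eventuallyEq_of_mem
      (Metric.isOpen_ball.mem_nhds (hB0 0))).filter_mono nhdsWithin_le_nhds).trans (hG0 0)

/-- The iterated duplication of a germ. -/
def jacobiIter (k : ℝ) (Y : ℂ → ℂ × ℂ × ℂ) (E : ℂ → ℂ) : ℕ → ℂ → (ℂ × ℂ × ℂ) × ℂ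
  | 0 => fun z => (Y z, E z)
  | n + 1 => fun z => (jacobiDup k (jacobiIter k Y E n (z / 2)).1,
      jacobiDupE k (jacobiIter k Y E n (z / 2)).1 (jacobiIter k Y E n (z / 2)).2)

lemma jacobiIter_eventuallyEq {k : ℝ} {Y : ℂ → ℂ × ℂ × ℂ} {E : ℂ → ℂ}
    (h1 : (fun z => jacobiDup k (Y (z / 2))) =ᶠ[𝓝 0] Y)
    (h2 : (fun z => jacobiDupE k (Y (z / 2)) (E (z / 2))) =ᶠ[𝓝 0] E) (n : ℕ) :
    jacobiIter k Y E n =ᶠ[𝓝 0] fun z => (Y z, E z) := by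
  have hhalf : Tendsto (fun z : ℂ => z / 2) (𝓝 0) (𝓝 0) := by
    simpa using (continuous_id.div_const (2 : ℂ)).tendsto 0
  induction n with
  | zero => exact EventuallyEq.rfl
  | succ n ih =>
    filter_upwards [hhalf.eventually ih, h1, h2] with z hz h1 h2
    simp only [jacobiIter, hz, h1, h2]

/-- The `n`-th iterate is a rational expression in the germ evaluated at `z / 2 ^ n`, so the radius
of meromorphy doubles at each step. -/
lemma meromorphicOn_jacobiIter {k r : ℝ} {Y : ℂ → ℂ × ℂ × ℂ} {E : ℂ → ℂ}
    (hs : MeromorphicOn (fun z => (Y z).1) (Metric.ball 0 r))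
    (hc : MeromorphicOn (fun z => (Y z).2.1) (Metric.ball 0 r))
    (hd : MeromorphicOn (fun z => (Y z).2.2) (Metric.ball 0 r))
    (hE : MeromorphicOn E (Metric.ball 0 r)) (n : ℕ) :
    ∀ z ∈ Metric.ball (0 : ℂ) (2 ^ n * r),
      MeromorphicAt (fun z => (jacobiIter k Y E n z).1.1) z ∧
      MeromorphicAt (fun z => (jacobiIter k Y E n z).1.2.1) z ∧
      MeromorphicAt (fun z => (jacobiIter k Y E n z).1.2.2) z ∧
      MeromorphicAt (fun z => (jacobiIter k Y E n z).2) z := by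
  induction n with
  | zero =>
    intro z hz
    rw [pow_zero, one_mul] at hz
    exact ⟨hs z hz, hc z hz, hd z hz, hE z hz⟩
  | succ n ih =>
    intro z hz
    have hz2 : z / 2 ∈ Metric.ball (0 : ℂ) (2 ^ n * r) := by
      rw [mem_ball_zero_iff] at hz ⊢
      rw [norm_div, Complex.norm_ofNat]
      rw [pow_succ] at hz
      linarith
    have hh : AnalyticAt ℂ (fun z : ℂ => z / 2) z := by fun_prop
    obtain ⟨h1, h2, h3, h4⟩ := ih (z / 2) hz2
    have g1 := h1.comp_analyticAt (g := fun z : ℂ => z / 2) hh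
    have g2 := h2.comp_analyticAt (g := fun z : ℂ => z / 2) hh
    have g3 := h3.comp_analyticAt (g := fun z : ℂ => z / 2) hh
    have g4 := h4.comp_analyticAt (g := fun z : ℂ => z / 2) hh
    have hΔ := (MeromorphicAt.const (1 : ℂ) z).sub
      ((MeromorphicAt.const ((k : ℂ) ^ 2) z).mul (g1.pow 4))
    have e1 := (((MeromorphicAt.const (2 : ℂ) z).mul g1).mul g2 |>.mul g3).div hΔ
    refine ⟨e1, ((g2.pow 2).sub ((g1.pow 2).mul (g3.pow 2))).div hΔ,
      ((g3.pow 2).sub (((MeromorphicAt.const ((k : ℂ) ^ 2) z).mul (g1.pow 2)).mul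
        (g2.pow 2))).div hΔ,
      ((MeromorphicAt.const (2 : ℂ) z).mul g4).sub
        (((MeromorphicAt.const ((k : ℂ) ^ 2) z).mul (g1.pow 2)).mul e1)⟩

/-- `s`, `c`, `d`, `E` are the functions `sn`, `cn`, `dn` and a primitive of `dn²`: meromorphic
functions on `ℂ` that satisfy the differential system near `0`. -/
structure IsJacobiSystem (k : ℝ) (s c d E : ℂ → ℂ) : Prop where
  nf_s : MeromorphicNFOn s univ
  nf_c : MeromorphicNFOn c univ
  nf_d : MeromorphicNFOn d univ
  nf_E : MeromorphicNFOn E univ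
  germ : IsJacobiGerm k (fun z => (s z, c z, d z)) E
  sq : ∀ᶠ z in 𝓝 0, s z ^ 2 + c z ^ 2 = 1 ∧ d z ^ 2 + k ^ 2 * s z ^ 2 = 1

theorem exists_isJacobiSystem {k : ℝ} (hk0 : 0 < k) (hk1 : k < 1) :
    ∃ s c d E, IsJacobiSystem k s c d E := by
  obtain ⟨Y, E, hg, hq⟩ := exists_isJacobiGerm hk0 hk1
  obtain ⟨h1, h2⟩ := hg.eventuallyEq_dup hq
  obtain ⟨r, hr, hball⟩ := Metric.eventually_nhds_iff_ball.1 (hg.hasDerivAt.and hg.hasDerivAt_E)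
  have han : ∀ {f : ℂ → ℂ}, (∀ z ∈ Metric.ball (0 : ℂ) r, DifferentiableAt ℂ f z) →
      ∀ z ∈ Metric.ball (0 : ℂ) r, AnalyticAt ℂ f z := fun hf z hz =>
    DifferentiableOn.analyticAt (fun w hw => (hf w hw).differentiableWithinAt)
      (Metric.isOpen_ball.mem_nhds hz)
  have as := han (f := fun z => (Y z).1) fun z hz => (hball z hz).1.differentiableAt.fst
  have ac := han (f := fun z => (Y z).2.1) fun z hz => (hball z hz).1.differentiableAt.snd.fst
  have ad := han (f := fun z => (Y z).2.2) fun z hz => (hball z hz).1.differentiableAt.snd.snd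
  have aE := han (f := E) fun z hz => (hball z hz).2.differentiableAt
  have hm := meromorphicOn_jacobiIter (k := k) (fun z hz => (as z hz).meromorphicAt)
    (fun z hz => (ac z hz).meromorphicAt) (fun z hz => (ad z hz).meromorphicAt)
    (fun z hz => (aE z hz).meromorphicAt)
  have hi := jacobiIter_eventuallyEq h1 h2
  -- Here `φ` selects one of the four coordinates; each is glued separately, and analyticity of the
  -- germ upgrades agreement near `0` to agreement at `0`.
  have glue : ∀ φ : (ℂ × ℂ × ℂ) × ℂ → ℂ, (∀ n, ∀ z ∈ Metric.ball (0 : ℂ) (2 ^ n * r),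
      MeromorphicAt (fun z => φ (jacobiIter k Y E n z)) z) →
      AnalyticAt ℂ (fun z => φ (Y z, E z)) 0 →
      ∃ F, MeromorphicNFOn F univ ∧ F =ᶠ[𝓝 0] fun z => φ (Y z, E z) := fun φ hφ ha => by
    obtain ⟨F, hF, hF0⟩ := exists_meromorphicNFOn_univ hr hφ
      (fun n => (hi n).fun_comp φ)
    exact ⟨F, hF, (MeromorphicNFAt.eventuallyEq_nhdsNE_iff_eventuallyEq_nhds (hF (mem_univ 0))
      ha.meromorphicNFAt).1 hF0⟩
  have h0 := Metric.mem_ball_self (x := (0 : ℂ)) hr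
  obtain ⟨s, ns, es⟩ := glue (fun p => p.1.1) (fun n z hz => (hm n z hz).1) (as 0 h0)
  obtain ⟨c, nc, ec⟩ := glue (fun p => p.1.2.1) (fun n z hz => (hm n z hz).2.1) (ac 0 h0)
  obtain ⟨d, nd, ed⟩ := glue (fun p => p.1.2.2) (fun n z hz => (hm n z hz).2.2.1) (ad 0 h0)
  obtain ⟨F, nF, eF⟩ := glue (fun p => p.2) (fun n z hz => (hm n z hz).2.2.2) (aE 0 h0)
  have eY : (fun z => (s z, c z, d z)) =ᶠ[𝓝 0] Y := by
    filter_upwards [es, ec, ed] with z h1 h2 h3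
    simp only [h1, h2, h3]
  refine ⟨s, c, d, F, ns, nc, nd, nF, ⟨?_, ?_, ?_, ?_⟩, ?_⟩
  · filter_upwards [hg.hasDerivAt, eY.eventually_nhds] with z h1 h2
    rw [h2.self_of_nhds]
    exact h1.congr_of_eventuallyEq h2
  · filter_upwards [hg.hasDerivAt_E, eF.eventually_nhds, ed] with z h1 h2 h3
    rw [h3]
    exact h1.congr_of_eventuallyEq h2
  · exact eY.self_of_nhds.trans hg.zero
  · rw [eF.self_of_nhds]
    exact hg.zero_E
  · filter_upwards [hq, es, ec, ed] with z h1 h2 h3 h4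
    rw [h2, h3, h4]
    exact h1

/-- A primitive on a punctured neighbourhood makes the integral over every small circle vanish. -/
lemma isResidueAt_zero_of_hasDerivAt {f E : ℂ → ℂ} {p : ℂ}
    (h : ∀ᶠ z in 𝓝[≠] p, HasDerivAt E (f z) z) : IsResidueAt f p 0 := by
  obtain ⟨ρ, hρ, hball⟩ := Metric.eventually_nhds_iff_ball.1 (eventually_nhdsWithin_iff.1 h)
  filter_upwards [Ioo_mem_nhdsGT hρ] with r hr
  rw [circleIntegral.integral_eq_zero_of_hasDerivWithinAt hr.1.le fun z hz =>
    (hball z ?_ ?_).hasDerivWithinAt, mul_zero]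
  · exact Metric.mem_ball.2 ((Metric.mem_sphere.1 hz).trans_lt hr.2)
  · rintro rfl
    simp [hr.1.ne] at hz

lemma exists_hasDerivWithinAt_Icc {g : ℝ → ℂ} (hg : ContinuousOn g (Icc 0 1)) :
    ∃ α : ℝ → ℂ, α 0 = 0 ∧ ∀ t ∈ Icc (0 : ℝ) 1, HasDerivWithinAt α (g t) (Icc 0 1) t := by
  -- Extending `g` constantly beyond `[0, 1]` makes it continuous on `ℝ`, so the endpoints need no
  -- separate treatment.
  set G : ℝ → ℂ := IccExtend zero_le_one (fun t : Icc (0 : ℝ) 1 => g t) with hG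
  have hGc : Continuous G := (continuousOn_iff_continuous_domRestrict.1 hg).Icc_extend'
  refine ⟨fun t => ∫ τ in (0 : ℝ)..t, G τ, by simp, fun t ht => ?_⟩
  have hGg : G t = g t := IccExtend_of_mem zero_le_one (fun t : Icc (0 : ℝ) 1 => g t) ht
  rw [← hGg]
  exact (intervalIntegral.integral_hasDerivAt_right (hGc.intervalIntegrable _ _)
    (hGc.stronglyMeasurableAtFilter _ _) hGc.continuousAt).hasDerivWithinAt

/-! ### Relations between the global functions -/

namespace IsJacobiSystem

/-- Each relation equates two meromorphic functions on `ℂ` and holds near `0`, hence off a discrete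
set. -/
lemma eventually_nhdsNE {k : ℝ} {s c d E : ℂ → ℂ} (h : IsJacobiSystem k s c d E) (p : ℂ) :
    ∀ᶠ z in 𝓝[≠] p, s z ^ 2 + c z ^ 2 = 1 ∧ d z ^ 2 + k ^ 2 * s z ^ 2 = 1 ∧
      deriv s z = c z * d z ∧ deriv c z = -(s z * d z) ∧ deriv d z = -(k ^ 2 * (s z * c z)) ∧
      deriv E z = d z ^ 2 := by
  have ms := h.nf_s.meromorphicOn
  have mc := h.nf_c.meromorphicOn
  have md := h.nf_d.meromorphicOn
  have mE := h.nf_E.meromorphicOn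
  have key : ∀ {f g : ℂ → ℂ}, MeromorphicOn f univ → MeromorphicOn g univ →
      (∀ᶠ z in 𝓝 0, f z = g z) → f =ᶠ[𝓝[≠] p] g := fun hf hg he =>
    eventually_nhdsNE_of_meromorphicOrderAt_sub isPreconnected_univ hf hg (mem_univ 0)
      (he.filter_mono nhdsWithin_le_nhds).frequently (mem_univ p)
  have mk : MeromorphicOn (fun _ : ℂ => (k : ℂ) ^ 2) univ := MeromorphicOn.const _
  have h1 := key ((ms.pow 2).add (mc.pow 2)) (MeromorphicOn.const 1) (h.sq.mono fun z hz => hz.1)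
  have h2 := key ((md.pow 2).add (mk.mul (ms.pow 2))) (MeromorphicOn.const 1)
    (h.sq.mono fun z hz => hz.2)
  have h3 := key ms.deriv (mc.mul md) (h.germ.hasDerivAt.mono fun z hz =>
    (show HasDerivAt s (c z * d z) z from hz.fst).deriv)
  have h4 := key mc.deriv (ms.mul md).neg (h.germ.hasDerivAt.mono fun z hz =>
    (show HasDerivAt c (-(s z * d z)) z from hz.snd.fst).deriv)
  have h5 := key md.deriv (mk.mul (ms.mul mc)).neg (h.germ.hasDerivAt.mono fun z hz =>
    (show HasDerivAt d (-((k : ℂ) ^ 2 * (s z * c z))) z from hz.snd.snd).deriv)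
  have h6 := key mE.deriv (md.pow 2) (h.germ.hasDerivAt_E.mono fun z hz => hz.deriv)
  filter_upwards [h1, h2, h3, h4, h5, h6] with z h1 h2 h3 h4 h5 h6
  exact ⟨h1, h2, h3, h4, h5, h6⟩

end IsJacobiSystem

/-- Squaring doubles the order, so a pole of `f` would be a pole of `f²`. Applied to `cn² = 1 - sn²`
and `dn² = 1 - k² sn²`. -/
lemma MeromorphicNFAt.analyticAt_of_sq {f g : ℂ → ℂ} {p : ℂ} (hf : MeromorphicNFAt f p)
    (hg : AnalyticAt ℂ g p) (h : (fun z => f z ^ 2) =ᶠ[𝓝[≠] p] g) : AnalyticAt ℂ f p := by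
  rw [← hf.meromorphicOrderAt_nonneg_iff_analyticAt]
  have h1 : 0 ≤ meromorphicOrderAt (f ^ 2) p := by
    rw [show f ^ 2 = fun z => f z ^ 2 from rfl, meromorphicOrderAt_congr h]
    exact hg.meromorphicOrderAt_nonneg
  rw [meromorphicOrderAt_pow hf.meromorphicAt] at h1
  induction hn : meromorphicOrderAt f p using WithTop.recTopCoe with
  | top => exact le_top
  | coe n =>
    rw [hn] at h1
    have h2 : ((0 : ℤ) : WithTop ℤ) ≤ ((2 * n : ℤ) : WithTop ℤ) := by
      rw [WithTop.coe_mul]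
      exact h1
    have := WithTop.coe_le_coe.1 h2
    norm_cast
    omega

/-- Differentiation lowers a negative order by one, so a pole of `f` would be a pole of `f'`.
Applied to `E' = dn²`. -/
lemma MeromorphicNFAt.analyticAt_of_deriv {f g : ℂ → ℂ} {p : ℂ} (hf : MeromorphicNFAt f p)
    (hg : AnalyticAt ℂ g p) (h : deriv f =ᶠ[𝓝[≠] p] g) : AnalyticAt ℂ f p := by
  rw [← hf.meromorphicOrderAt_nonneg_iff_analyticAt]
  have h1 : 0 ≤ meromorphicOrderAt (deriv f) p := by
    rw [meromorphicOrderAt_congr h]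
    exact hg.meromorphicOrderAt_nonneg
  by_contra! hneg
  obtain ⟨n, hn⟩ := WithTop.ne_top_iff_exists.1 hneg.ne_top
  rw [← hn] at hneg
  have hn0 : n < 0 := by exact_mod_cast hneg
  rw [meromorphicOrderAt_deriv_eq_sub_one (n := n) (by exact_mod_cast hn0.ne) hn.symm] at h1
  norm_cast at h1
  omega

lemma eq_of_eventuallyEq_nhdsNE {f g : ℂ → ℂ} {p : ℂ} (hf : ContinuousAt f p)
    (hg : ContinuousAt g p) (h : f =ᶠ[𝓝[≠] p] g) : f p = g p :=
  tendsto_nhds_unique ((hf.tendsto.mono_left nhdsWithin_le_nhds).congr' h)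
    (hg.tendsto.mono_left nhdsWithin_le_nhds)

namespace IsJacobiSystem

lemma mem_iff {k : ℝ} {s c d E : ℂ → ℂ} (h : IsJacobiSystem k s c d E) {u : ℂ} :
    0 ≤ meromorphicOrderAt s u ↔ AnalyticAt ℂ s u :=
  (h.nf_s (mem_univ u)).meromorphicOrderAt_nonneg_iff_analyticAt

lemma analyticAt_c {k : ℝ} {s c d E : ℂ → ℂ} (h : IsJacobiSystem k s c d E) {u : ℂ}
    (hs : AnalyticAt ℂ s u) : AnalyticAt ℂ c u := by
  refine (h.nf_c (mem_univ u)).analyticAt_of_sq (g := fun z => 1 - s z ^ 2) (by fun_prop) ?_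
  filter_upwards [h.eventually_nhdsNE u] with z hz
  linear_combination hz.1

lemma analyticAt_d {k : ℝ} {s c d E : ℂ → ℂ} (h : IsJacobiSystem k s c d E) {u : ℂ}
    (hs : AnalyticAt ℂ s u) : AnalyticAt ℂ d u := by
  refine (h.nf_d (mem_univ u)).analyticAt_of_sq (g := fun z => 1 - (k : ℂ) ^ 2 * s z ^ 2)
    (by fun_prop) ?_
  filter_upwards [h.eventually_nhdsNE u] with z hz
  linear_combination hz.2.1

lemma analyticAt_E {k : ℝ} {s c d E : ℂ → ℂ} (h : IsJacobiSystem k s c d E) {u : ℂ}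
    (hs : AnalyticAt ℂ s u) : AnalyticAt ℂ E u := by
  have := h.analyticAt_d hs
  refine (h.nf_E (mem_univ u)).analyticAt_of_deriv (g := fun z => d z ^ 2) (by fun_prop) ?_
  filter_upwards [h.eventually_nhdsNE u] with z hz
  exact hz.2.2.2.2.2

/-- The relations hold in a punctured neighbourhood and pass to its centre by continuity. -/
lemma identities {k : ℝ} {s c d E : ℂ → ℂ} (h : IsJacobiSystem k s c d E) {u : ℂ}
    (hs : AnalyticAt ℂ s u) : s u ^ 2 + c u ^ 2 = 1 ∧ d u ^ 2 + k ^ 2 * s u ^ 2 = 1 ∧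
      HasDerivAt s (c u * d u) u ∧ HasDerivAt c (-(s u * d u)) u ∧
      HasDerivAt d (-(k ^ 2 * (s u * c u))) u ∧ HasDerivAt E (d u ^ 2) u := by
  have hc := h.analyticAt_c hs
  have hd := h.analyticAt_d hs
  have hE := h.analyticAt_E hs
  have hev := h.eventually_nhdsNE u
  have cs := hs.continuousAt
  have cc := hc.continuousAt
  have cd := hd.continuousAt
  have e1 := eq_of_eventuallyEq_nhdsNE (f := fun z => s z ^ 2 + c z ^ 2) (g := fun _ => 1)
    (by fun_prop) (by fun_prop) (hev.mono fun z hz => hz.1)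
  have e2 := eq_of_eventuallyEq_nhdsNE (f := fun z => d z ^ 2 + (k : ℂ) ^ 2 * s z ^ 2)
    (g := fun _ => 1) (by fun_prop) (by fun_prop) (hev.mono fun z hz => hz.2.1)
  have e3 := eq_of_eventuallyEq_nhdsNE (f := deriv s) (g := fun z => c z * d z)
    hs.deriv.continuousAt (by fun_prop) (hev.mono fun z hz => hz.2.2.1)
  have e4 := eq_of_eventuallyEq_nhdsNE (f := deriv c) (g := fun z => -(s z * d z))
    hc.deriv.continuousAt (by fun_prop) (hev.mono fun z hz => hz.2.2.2.1)
  have e5 := eq_of_eventuallyEq_nhdsNE (f := deriv d) (g := fun z => -((k : ℂ) ^ 2 * (s z * c z)))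
    hd.deriv.continuousAt (by fun_prop) (hev.mono fun z hz => hz.2.2.2.2.1)
  have e6 := eq_of_eventuallyEq_nhdsNE (f := deriv E) (g := fun z => d z ^ 2)
    hE.deriv.continuousAt (by fun_prop) (hev.mono fun z hz => hz.2.2.2.2.2)
  exact ⟨e1, e2, e3 ▸ hs.differentiableAt.hasDerivAt, e4 ▸ hc.differentiableAt.hasDerivAt,
    e5 ▸ hd.differentiableAt.hasDerivAt, e6 ▸ hE.differentiableAt.hasDerivAt⟩

lemma hasDerivAt_triple {k : ℝ} {s c d E : ℂ → ℂ} (h : IsJacobiSystem k s c d E) {u : ℂ}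
    (hs : AnalyticAt ℂ s u) :
    HasDerivAt (fun z => (s z, c z, d z)) (jacobiField k (s u, c u, d u)) u := by
  obtain ⟨-, -, h1, h2, h3, -⟩ := h.identities hs
  exact h1.prodMk (h2.prodMk h3)

lemma countable_compl {k : ℝ} {s c d E : ℂ → ℂ} (h : IsJacobiSystem k s c d E) :
    {u | AnalyticAt ℂ s u}ᶜ.Countable :=
  (meromorphicOn_univ.1 h.nf_s.meromorphicOn).countable_compl_analyticAt

lemma analyticAt_zero {k : ℝ} {s c d E : ℂ → ℂ} (h : IsJacobiSystem k s c d E) :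
    AnalyticAt ℂ s 0 := by
  obtain ⟨r, hr, hball⟩ := Metric.eventually_nhds_iff_ball.1 h.germ.hasDerivAt
  exact DifferentiableOn.analyticAt (s := Metric.ball 0 r)
    (fun w hw => ((hball w hw).differentiableAt.fst).differentiableWithinAt)
    (Metric.ball_mem_nhds 0 hr)

lemma zero {k : ℝ} {s c d E : ℂ → ℂ} (h : IsJacobiSystem k s c d E) :
    s 0 = 0 ∧ c 0 = 1 ∧ d 0 = 1 ∧ E 0 = 0 := by
  have := h.germ.zero
  simp only [Prod.mk.injEq] at this
  exact ⟨this.1, this.2.1, this.2.2, h.germ.zero_E⟩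

/-- Continuation along paths: a solution of the differential system along a path that starts in the
domain of `sn` with the values of `sn`, `cn`, `dn` stays in the domain and keeps these values. -/
theorem continuation {k : ℝ} {s c d E : ℂ → ℂ} (h : IsJacobiSystem k s c d E)
    {α g : ℝ → ℂ} {Y : ℝ → ℂ × ℂ × ℂ} (hg : ContinuousOn g (Icc 0 1))
    (hα : ∀ t ∈ Icc (0 : ℝ) 1, HasDerivWithinAt α (g t) (Icc 0 1) t)
    (hY : ∀ t ∈ Icc (0 : ℝ) 1, HasDerivWithinAt Y (g t • jacobiField k (Y t)) (Icc 0 1) t)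
    (h0 : AnalyticAt ℂ s (α 0)) (hY0 : Y 0 = (s (α 0), c (α 0), d (α 0))) :
    ∀ t ∈ Icc (0 : ℝ) 1, AnalyticAt ℂ s (α t) ∧ Y t = (s (α t), c (α t), d (α t)) := by
  have hαc : ContinuousOn α (Icc 0 1) := fun t ht => (hα t ht).continuousWithinAt
  have hYc : ContinuousOn Y (Icc 0 1) := fun t ht => (hY t ht).continuousWithinAt
  set S : Set ℝ := {t | AnalyticAt ℂ s (α t) ∧ Y t = (s (α t), c (α t), d (α t))} with hS
  suffices Icc 0 1 ⊆ S from this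
  refine IsClosed.Icc_subset_of_forall_mem_nhdsWithin ?_ ⟨h0, hY0⟩ ?_
  -- Closedness: at a limit parameter `t` the solution `Y` has a finite limit along the good
  -- parameters.
  · refine isClosed_of_closure_subset fun t ht => ?_
    have htI : t ∈ Icc (0 : ℝ) 1 :=
      isClosed_Icc.closure_subset (closure_mono inter_subset_right ht)
    have hne : (𝓝[S ∩ Icc 0 1] t).NeBot := mem_closure_iff_nhdsWithin_neBot.1 ht
    have tα : Tendsto α (𝓝[S ∩ Icc 0 1] t) (𝓝 (α t)) :=
      (hαc t htI).mono_left (nhdsWithin_mono t inter_subset_right)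
    have tY : Tendsto Y (𝓝[S ∩ Icc 0 1] t) (𝓝 (Y t)) :=
      (hYc t htI).mono_left (nhdsWithin_mono t inter_subset_right)
    have hmem : ∀ᶠ τ in 𝓝[S ∩ Icc 0 1] t, τ ∈ S :=
      mem_of_superset self_mem_nhdsWithin inter_subset_left
    have ts : Tendsto (fun τ => s (α τ)) (𝓝[S ∩ Icc 0 1] t) (𝓝 (Y t).1) :=
      (tY.fst_nhds).congr' (hmem.mono fun τ hτ => by rw [hτ.2])
    have han : AnalyticAt ℂ s (α t) := by
      by_contra hna
      -- At a pole `sn` would tend to infinity along `α`, contradicting the finite limit of its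
      -- values. The path approaches `α t` through other points because the good parameters map to
      -- points where `sn` is analytic.
      have hord : meromorphicOrderAt s (α t) < 0 := not_le.1 fun hle => hna (h.mem_iff.1 hle)
      have tα' : Tendsto α (𝓝[S ∩ Icc 0 1] t) (𝓝[≠] (α t)) :=
        tendsto_nhdsWithin_iff.2 ⟨tα, hmem.mono fun τ hτ he => hna (he ▸ hτ.1)⟩
      have := (tendsto_cobounded_of_meromorphicOrderAt_neg hord).comp tα'
      exact ts.not_tendsto (Metric.disjoint_nhds_cobounded _) this
    refine ⟨⟨han, tendsto_nhds_unique tY ?_⟩, htI⟩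
    refine Tendsto.congr' (hmem.mono fun τ hτ => hτ.2.symm) ?_
    exact (han.continuousAt.tendsto.comp tα).prodMk_nhds
      (((h.analyticAt_c han).continuousAt.tendsto.comp tα).prodMk_nhds
        ((h.analyticAt_d han).continuousAt.tendsto.comp tα))
  -- Openness to the right: on a short interval `sn`, `cn`, `dn` along `α` solve the same equation
  -- as `Y` with the same value at `t`.
  · rintro t ⟨⟨hta, htY⟩, htI⟩
    have hev : ∀ᶠ τ in 𝓝[Icc 0 1] t, AnalyticAt ℂ s (α τ) :=
      (hαc t (Ico_subset_Icc_self htI)).eventually hta.eventually_analyticAt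
    obtain ⟨ε, hε, hsub⟩ := Metric.mem_nhdsWithin_iff.1 hev
    set b := min 1 (t + ε / 2) with hb
    have htb : t < b := lt_min htI.2 (by linarith)
    have hIcc : ∀ τ ∈ Icc t b, τ ∈ Icc (0 : ℝ) 1 ∧ AnalyticAt ℂ s (α τ) := fun τ hτ => by
      have h1 : τ ∈ Icc (0 : ℝ) 1 := ⟨htI.1.trans hτ.1, hτ.2.trans (min_le_left _ _)⟩
      refine ⟨h1, hsub ⟨?_, h1⟩⟩
      rw [Metric.mem_ball, Real.dist_eq, abs_of_nonneg (sub_nonneg.2 hτ.1)]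
      have := hτ.2.trans (min_le_right _ _)
      linarith
    have hss : Icc t b ⊆ Icc 0 1 := fun τ hτ => (hIcc τ hτ).1
    have key := eqOn_of_hasDerivWithinAt_jacobiField (k := k) (g := g) (Y := Y)
      (Z := fun τ => (s (α τ), c (α τ), d (α τ))) (hg.mono hss)
      (fun τ hτ => (hY τ (hss hτ)).mono hss)
      (fun τ hτ => (h.hasDerivAt_triple (hIcc τ hτ).2).scomp_hasDerivWithinAt τ
        ((hα τ (hss hτ)).mono hss)) htY
    exact mem_of_superset (Icc_mem_nhdsGT htb) fun τ hτ => ⟨(hIcc τ hτ).2, key hτ⟩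

/-- A path on the curve `S² + C² = 1`, `W² + k² S² = 1` from `(0, 1, 1)` lifts to the domain
of `sn`. -/
theorem lifting {k : ℝ} (hk : (1 : ℂ) - k ^ 2 ≠ 0) {s c d E : ℂ → ℂ} (h : IsJacobiSystem k s c d E)
    {S C W S' C' W' : ℝ → ℂ}
    (hS : ∀ t ∈ Icc (0 : ℝ) 1, HasDerivWithinAt S (S' t) (Icc 0 1) t)
    (hC : ∀ t ∈ Icc (0 : ℝ) 1, HasDerivWithinAt C (C' t) (Icc 0 1) t)
    (hW : ∀ t ∈ Icc (0 : ℝ) 1, HasDerivWithinAt W (W' t) (Icc 0 1) t)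
    (cS : ContinuousOn S' (Icc 0 1)) (cC : ContinuousOn C' (Icc 0 1))
    (cW : ContinuousOn W' (Icc 0 1))
    (h1 : ∀ t ∈ Icc (0 : ℝ) 1, S t ^ 2 + C t ^ 2 = 1)
    (h2 : ∀ t ∈ Icc (0 : ℝ) 1, W t ^ 2 + k ^ 2 * S t ^ 2 = 1)
    (hS0 : S 0 = 0) (hC0 : C 0 = 1) (hW0 : W 0 = 1) :
    ∃ α g : ℝ → ℂ, ContinuousOn g (Icc 0 1) ∧ α 0 = 0 ∧
      (∀ t ∈ Icc (0 : ℝ) 1, HasDerivWithinAt α (g t) (Icc 0 1) t) ∧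
      (∀ t ∈ Icc (0 : ℝ) 1, S' t = C t * W t * g t ∧ C' t = -(S t * W t) * g t ∧
        W' t = -(k ^ 2 * (S t * C t)) * g t) ∧
      ∀ t ∈ Icc (0 : ℝ) 1, AnalyticAt ℂ s (α t) ∧ S t = s (α t) ∧ C t = c (α t) ∧
        W t = d (α t) := by
  have hSc : ContinuousOn S (Icc 0 1) := fun t ht => (hS t ht).continuousWithinAt
  have hCc : ContinuousOn C (Icc 0 1) := fun t ht => (hC t ht).continuousWithinAt
  have hWc : ContinuousOn W (Icc 0 1) := fun t ht => (hW t ht).continuousWithinAt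
  -- The velocity of the lift comes from a covector that takes the value `1` on the field `(C W, -S
  -- W, -k² S C)` along the curve; this is the identity `I` below. No coordinate of the path is
  -- divided by, so branch points with `C = 0` or `W = 0` are allowed.
  set g : ℝ → ℂ := fun t => C t * W t * S' t - S t * W t * C' t / (1 - k ^ 2) +
    k ^ 2 / (1 - k ^ 2) * (S t * C t * W' t) with hg
  have hgc : ContinuousOn g (Icc 0 1) := by fun_prop (disch := assumption)
  obtain ⟨α, hα0, hα'⟩ := exists_hasDerivWithinAt_Icc hgc
  have e : ∀ t ∈ Icc (0 : ℝ) 1, S' t = C t * W t * g t ∧ C' t = -(S t * W t) * g t ∧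
      W' t = -(k ^ 2 * (S t * C t)) * g t := fun t ht => by
    have hu : UniqueDiffWithinAt ℝ (Icc (0 : ℝ) 1) t := uniqueDiffOn_Icc zero_lt_one t ht
    have d1 : S t * S' t + C t * C' t = 0 := by
      have h3 := (((hS t ht).pow 2).add ((hC t ht).pow 2)).congr (f₁ := fun _ => 1)
        (fun τ hτ => (h1 τ hτ).symm) (h1 t ht).symm
      have := hu.eq_deriv _ h3 (hasDerivWithinAt_const t _ 1)
      norm_num at this
      linear_combination this / 2
    have d2 : W t * W' t + k ^ 2 * (S t * S' t) = 0 := by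
      have h3 := (((hW t ht).pow 2).add (((hS t ht).pow 2).const_mul ((k : ℂ) ^ 2))).congr
        (f₁ := fun _ => 1) (fun τ hτ => (h2 τ hτ).symm) (h2 t ht).symm
      have := hu.eq_deriv _ h3 (hasDerivWithinAt_const t _ 1)
      norm_num at this
      linear_combination this / 2
    have q1 := h1 t ht
    have q2 := h2 t ht
    simp only [hg]
    generalize S t = S at *
    generalize C t = C at *
    generalize W t = W at *
    generalize S' t = S' at *
    generalize C' t = C' at *
    generalize W' t = W' at *
    set m : ℂ := 1 - (k : ℂ) ^ 2 with hm
    have I : C ^ 2 * W ^ 2 + S ^ 2 * W ^ 2 / m - k ^ 4 * S ^ 2 * C ^ 2 / m = 1 := by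
      have e1 : C ^ 2 = 1 - S ^ 2 := by linear_combination q1
      have e2 : W ^ 2 = 1 - k ^ 2 * S ^ 2 := by linear_combination q2
      rw [e1, e2]
      field_simp
      rw [hm]
      ring
    refine ⟨?_, ?_, ?_⟩
    · linear_combination (-S') * I + S * W ^ 2 / m * d1 - k ^ 2 * S * C ^ 2 / m * d2
    · linear_combination (-C') * I + (C * W ^ 2 - k ^ 4 / m * S ^ 2 * C) * d1 +
        k ^ 2 / m * S ^ 2 * C * d2
    · linear_combination (-W') * I + (C ^ 2 * W + S ^ 2 * W / m) * d2 - k ^ 2 * S ^ 2 * W / m * d1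
  have key := h.continuation (Y := fun t => (S t, C t, W t)) hgc hα' (fun t ht => by
    refine ((hS t ht).prodMk ((hC t ht).prodMk (hW t ht))).congr_deriv ?_
    obtain ⟨e1, e2, e3⟩ := e t ht
    simp only [jacobiField, Prod.smul_mk, smul_eq_mul, e1, e2, e3, Prod.mk.injEq]
    refine ⟨?_, ?_, ?_⟩ <;> ring) (by simpa [hα0] using h.analyticAt_zero)
    (by simp [hα0, hS0, hC0, hW0, h.zero])
  refine ⟨α, g, hgc, hα0, hα', e, fun t ht => ?_⟩
  have := key t ht
  simp only [Prod.mk.injEq] at this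
  exact this

end IsJacobiSystem

/-! ## Paths -/

/-- The arcs `p + (t + i r t (1 - t)) (q - p)` for distinct real `r` share only their endpoints. The
function `ψ` recovers `r` from an interior point, so a countable set meets only countably many arcs.
-/
lemma exists_contDiff_path_compl {A : Set ℂ} (hA : A.Countable) {p q : ℂ} (hp : p ∉ A)
    (hq : q ∉ A) : ∃ α : ℝ → ℂ, ContDiff ℝ 1 α ∧ α 0 = p ∧ α 1 = q ∧
      ∀ t ∈ Icc (0 : ℝ) 1, α t ∉ A := by
  rcases eq_or_ne p q with rfl | hpq
  · exact ⟨fun _ => p, contDiff_const, rfl, rfl, fun _ _ => hp⟩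
  have hpq' : q - p ≠ 0 := sub_ne_zero.2 hpq.symm
  set ψ : ℂ → ℝ := fun a => ((a - p) / (q - p)).im /
    (((a - p) / (q - p)).re * (1 - ((a - p) / (q - p)).re)) with hψ
  obtain ⟨r, hr⟩ : ∃ r, r ∉ ψ '' A := by
    by_contra! hall
    exact Cardinal.not_countable_real ((hA.image ψ).mono fun r _ => hall r)
  have hof : ContDiff ℝ 1 (fun t : ℝ => (t : ℂ)) := Complex.ofRealCLM.contDiff
  refine ⟨fun t => p + ((t : ℂ) + r * t * (1 - t) * Complex.I) * (q - p), by fun_prop, by simp,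
    by simp, fun t ht hmem => ?_⟩
  rcases eq_or_lt_of_le ht.1 with h0 | h0
  · rw [← h0] at hmem
    exact hp (by simpa using hmem)
  rcases eq_or_lt_of_le ht.2 with h1 | h1
  · rw [h1] at hmem
    exact hq (by simpa using hmem)
  refine hr ⟨_, hmem, ?_⟩
  have e : (p + ((t : ℂ) + r * t * (1 - t) * Complex.I) * (q - p) - p) / (q - p) =
      (t : ℂ) + ((r * t * (1 - t) : ℝ) : ℂ) * Complex.I := by
    field_simp
    push_cast
    ring
  have hre : ((t : ℂ) + ((r * t * (1 - t) : ℝ) : ℂ) * Complex.I).re = t := by simp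
  have him : ((t : ℂ) + ((r * t * (1 - t) : ℝ) : ℂ) * Complex.I).im = r * t * (1 - t) := by simp
  simp only [hψ]
  rw [e, hre, him]
  have : 1 - t ≠ 0 := by linarith
  field_simp

lemma ContDiffOn.hasDerivWithinAt_Icc {α : ℝ → ℂ} (hα : ContDiffOn ℝ 1 α (Icc 0 1)) :
    (∀ t ∈ Icc (0 : ℝ) 1, HasDerivWithinAt α (derivWithin α (Icc 0 1) t) (Icc 0 1) t) ∧
      ContinuousOn (derivWithin α (Icc 0 1)) (Icc 0 1) :=
  ⟨fun t ht => (hα.differentiableOn one_ne_zero t ht).hasDerivWithinAt,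
    hα.continuousOn_derivWithin (uniqueDiffOn_Icc zero_lt_one) le_rfl⟩

lemma contDiffOn_Icc_of_hasDerivWithinAt {α g : ℝ → ℂ} (hg : ContinuousOn g (Icc 0 1))
    (hα : ∀ t ∈ Icc (0 : ℝ) 1, HasDerivWithinAt α (g t) (Icc 0 1) t) :
    ContDiffOn ℝ 1 α (Icc 0 1) := by
  have hu := uniqueDiffOn_Icc (zero_lt_one' ℝ)
  refine (contDiffOn_one_iff_derivWithin hu).2
    ⟨fun t ht => (hα t ht).differentiableWithinAt, hg.congr fun t ht => ?_⟩
  exact (hα t ht).derivWithin (hu t ht)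

lemma eq_of_hasDerivWithinAt_zero {Φ : ℝ → ℂ}
    (hΦ : ∀ t ∈ Icc (0 : ℝ) 1, HasDerivWithinAt Φ 0 (Icc 0 1) t) : Φ 1 = Φ 0 :=
  constant_of_derivWithin_zero (fun t ht => (hΦ t ht).differentiableWithinAt)
    (fun t ht => (hΦ t (Ico_subset_Icc_self ht)).derivWithin
      (uniqueDiffOn_Icc zero_lt_one t (Ico_subset_Icc_self ht))) 1 (right_mem_Icc.2 zero_le_one)

/-! ### Symmetries of `sn`, `cn`, `dn` -/

namespace IsJacobiSystem

/-- A transformation that intertwines the differential system and preserves one initial value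
preserves all values. -/
theorem symmetry {k : ℝ} {s c d E : ℂ → ℂ} (h : IsJacobiSystem k s c d E) {β : ℂ → ℂ}
    {T : ℂ × ℂ × ℂ → ℂ × ℂ × ℂ} {G : ℂ →L[ℝ] ℂ} {A : Set ℂ} (hA : A.Countable)
    (hβ : ∀ (α : ℝ → ℂ) (g : ℂ) (t : ℝ), HasDerivWithinAt α g (Icc 0 1) t →
      HasDerivWithinAt (fun τ => β (α τ)) (G g) (Icc 0 1) t)
    (hT : ∀ (α : ℝ → ℂ) (g : ℂ) (t : ℝ), HasDerivWithinAt α g (Icc 0 1) t →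
      AnalyticAt ℂ s (α t) → α t ∉ A →
      HasDerivWithinAt (fun τ => T (s (α τ), c (α τ), d (α τ)))
        (G g • jacobiField k (T (s (α t), c (α t), d (α t)))) (Icc 0 1) t)
    {u₀ u : ℂ} (hu₀ : AnalyticAt ℂ s u₀) (hA₀ : u₀ ∉ A) (hβ₀ : AnalyticAt ℂ s (β u₀))
    (hY₀ : T (s u₀, c u₀, d u₀) = (s (β u₀), c (β u₀), d (β u₀)))
    (hu : AnalyticAt ℂ s u) (hAu : u ∉ A) :
    AnalyticAt ℂ s (β u) ∧ T (s u, c u, d u) = (s (β u), c (β u), d (β u)) ∧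
      ((∀ z g, (T (s z, c z, d z)).2.2 ^ 2 * G g = G (d z ^ 2 * g)) →
        E (β u) - E (β u₀) = G (E u - E u₀)) := by
  -- Along a path from `u₀` to `u` that avoids the poles and `A`, the transformed triple solves the
  -- system over the transformed path, so `continuation` applies.
  obtain ⟨α, hα, h0, h1, hmem⟩ := exists_contDiff_path_compl (h.countable_compl.union hA)
    (p := u₀) (q := u) (by simp [hu₀, hA₀]) (by simp [hu, hAu])
  have hD : ∀ t ∈ Icc (0 : ℝ) 1, AnalyticAt ℂ s (α t) ∧ α t ∉ A := fun t ht => by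
    simpa using hmem t ht
  obtain ⟨hα', hαc⟩ := hα.contDiffOn.hasDerivWithinAt_Icc
  have key := h.continuation (α := fun τ => β (α τ))
    (g := fun t => G (derivWithin α (Icc 0 1) t))
    (Y := fun τ => T (s (α τ), c (α τ), d (α τ))) (by fun_prop) (fun t ht => hβ _ _ _ (hα' t ht))
    (fun t ht => hT _ _ _ (hα' t ht) (hD t ht).1 (hD t ht).2) (by simpa [h0] using hβ₀)
    (by simpa [h0] using hY₀)
  have h11 : (1 : ℝ) ∈ Icc (0 : ℝ) 1 := right_mem_Icc.2 zero_le_one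
  refine ⟨by simpa [h1] using (key 1 h11).1, by simpa [h1] using (key 1 h11).2, fun hE => ?_⟩
  -- The extra condition says that `T` transforms `dn²` compatibly with `G`; then `E ∘ β - G ∘ E` is
  -- constant along the path.
  have := eq_of_hasDerivWithinAt_zero (Φ := fun t => E (β (α t)) - G (E (α t))) fun t ht => by
    obtain ⟨-, -, -, -, -, e1⟩ := h.identities (key t ht).1
    obtain ⟨-, -, -, -, -, e2⟩ := h.identities (hD t ht).1
    have f1 := e1.scomp_hasDerivWithinAt t (hβ _ _ _ (hα' t ht))
    have f2 := G.hasFDerivAt.comp_hasDerivWithinAt t (e2.scomp_hasDerivWithinAt t (hα' t ht))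
    refine (f1.sub f2).congr_deriv ?_
    have := hE (α t) (derivWithin α (Icc 0 1) t)
    rw [(key t ht).2] at this
    simp only [smul_eq_mul]
    rw [mul_comm, this, mul_comm, sub_self]
  simp only [h0, h1] at this
  rw [map_sub]
  linear_combination this

lemma neg {k : ℝ} {s c d E : ℂ → ℂ} (h : IsJacobiSystem k s c d E) {u : ℂ}
    (hu : AnalyticAt ℂ s u) : AnalyticAt ℂ s (-u) ∧ s (-u) = -s u ∧ c (-u) = c u ∧
      d (-u) = d u ∧ E (-u) = -E u := by
  obtain ⟨z1, z2, z3, z4⟩ := h.zero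
  have := h.symmetry (β := fun z => -z) (T := fun Y => (-Y.1, Y.2.1, Y.2.2))
    (G := -ContinuousLinearMap.id ℝ ℂ) countable_empty (fun α g t hα => by simpa using hα.fun_neg)
    (fun α g t hα hz _ => by
      obtain ⟨-, -, e1, e2, e3, -⟩ := h.identities hz
      refine ((e1.scomp_hasDerivWithinAt t hα).neg.prodMk
        ((e2.scomp_hasDerivWithinAt t hα).prodMk (e3.scomp_hasDerivWithinAt t hα))).congr_deriv ?_
      simp [jacobiField])
    h.analyticAt_zero (by simp) (by simpa using h.analyticAt_zero) (by simp [z1, z2, z3]) hu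
    (by simp)
  obtain ⟨h1, h2, h3⟩ := this
  simp only [Prod.mk.injEq] at h2
  refine ⟨h1, h2.1.symm, h2.2.1.symm, h2.2.2.symm, ?_⟩
  simpa [z4] using h3 (by simp)

/-- The system has real coefficients and real initial values. Conjugation is only real-linear, which
is why `G` in `symmetry` is real-linear. -/
lemma conj {k : ℝ} {s c d E : ℂ → ℂ} (h : IsJacobiSystem k s c d E) {u : ℂ}
    (hu : AnalyticAt ℂ s u) : AnalyticAt ℂ s (star u) ∧ s (star u) = star (s u) ∧
      c (star u) = star (c u) ∧ d (star u) = star (d u) ∧ E (star u) = star (E u) := by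
  obtain ⟨z1, z2, z3, z4⟩ := h.zero
  have hG : ∀ {α : ℝ → ℂ} {g : ℂ} {t : ℝ}, HasDerivWithinAt α g (Icc 0 1) t →
      HasDerivWithinAt (fun τ => star (α τ)) (star g) (Icc 0 1) t := fun hα => hα.star
  have := h.symmetry (β := fun z => star z) (T := fun Y => (star Y.1, star Y.2.1, star Y.2.2))
    (G := (Complex.conjCLE : ℂ →L[ℝ] ℂ)) countable_empty
    (fun α g t hα => by simpa using hG hα)
    (fun α g t hα hz _ => by
      obtain ⟨-, -, e1, e2, e3, -⟩ := h.identities hz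
      refine ((hG (e1.scomp_hasDerivWithinAt t hα)).prodMk
        ((hG (e2.scomp_hasDerivWithinAt t hα)).prodMk
          (hG (e3.scomp_hasDerivWithinAt t hα)))).congr_deriv ?_
      simp [jacobiField])
    h.analyticAt_zero (by simp) (by simpa using h.analyticAt_zero) (by simp [z1, z2, z3]) hu
    (by simp)
  obtain ⟨h1, h2, h3⟩ := this
  simp only [Prod.mk.injEq] at h2
  refine ⟨h1, h2.1.symm, h2.2.1.symm, h2.2.2.symm, ?_⟩
  simpa [z4] using h3 (by simp)

/-- Reflection in a point where `sn = 1` and `cn = 0`. -/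
lemma reflect {k : ℝ} {s c d E : ℂ → ℂ} (h : IsJacobiSystem k s c d E) {K u : ℂ}
    (hK : AnalyticAt ℂ s K) (hcK : c K = 0) (hu : AnalyticAt ℂ s u) :
    AnalyticAt ℂ s (2 * K - u) ∧ s (2 * K - u) = s u ∧ c (2 * K - u) = -c u ∧
      d (2 * K - u) = d u ∧ E (2 * K - u) = 2 * E K - E u := by
  have h2K : 2 * K - K = K := by ring
  have := h.symmetry (β := fun z => 2 * K - z) (T := fun Y => (Y.1, -Y.2.1, Y.2.2))
    (G := -ContinuousLinearMap.id ℝ ℂ) countable_empty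
    (fun α g t hα => by simpa using hα.const_sub (2 * K))
    (fun α g t hα hz _ => by
      obtain ⟨-, -, e1, e2, e3, -⟩ := h.identities hz
      refine ((e1.scomp_hasDerivWithinAt t hα).prodMk
        ((e2.scomp_hasDerivWithinAt t hα).neg.prodMk
          (e3.scomp_hasDerivWithinAt t hα))).congr_deriv ?_
      simp [jacobiField])
    hK (by simp) (by rwa [h2K]) (by simp [h2K, hcK]) hu (by simp)
  obtain ⟨h1, h2, h3⟩ := this
  simp only [Prod.mk.injEq] at h2
  refine ⟨h1, h2.1.symm, h2.2.1.symm, h2.2.2.symm, ?_⟩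
  have := h3 (by simp)
  rw [h2K] at this
  simp only [neg_apply, ContinuousLinearMap.id_apply] at this
  linear_combination this

/-- A zero of `sn` has nonzero derivative, so it is isolated and `1/sn` cannot be analytic there.
The zeros are thus among the countably many singularities of `1/sn`; they must be avoided when
translating by `2H`. -/
lemma countable_zeros {k : ℝ} {s c d E : ℂ → ℂ} (h : IsJacobiSystem k s c d E) :
    {z | AnalyticAt ℂ s z ∧ s z = 0}.Countable := by
  have hc := (meromorphicOn_univ.1 h.nf_s.meromorphicOn).inv.countable_compl_analyticAt
  refine hc.mono ?_
  rintro z ⟨h1, h2⟩ han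
  replace han : AnalyticAt ℂ s⁻¹ z := han
  obtain ⟨e1, e2, e3, -⟩ := h.identities h1
  have hne : c z * d z ≠ 0 := fun h0 => by
    have : (c z * d z) ^ 2 = 1 := by
      rw [h2] at e1 e2
      linear_combination e1 * d z ^ 2 + e2
    simp [h0] at this
  have hev := e3.eventually_ne (c := 0) hne
  have := eq_of_eventuallyEq_nhdsNE (f := fun w => s w * s⁻¹ w) (g := fun _ => 1)
    (h1.continuousAt.mul han.continuousAt) continuousAt_const (hev.mono fun w hw => by
      simp [hw])
  simp [h2] at this

/-- Translation by `2H`, where `sn H = i/√k`. -/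
lemma translate_half {k : ℝ} (hk : 0 < k) {s c d E : ℂ → ℂ} (h : IsJacobiSystem k s c d E) {H u : ℂ}
    (hH : AnalyticAt ℂ s H) (hs : s H = Complex.I / √k) (hc : c H * √k = d H)
    (hu : AnalyticAt ℂ s u) (hu0 : s u ≠ 0) :
    AnalyticAt ℂ s (u + 2 * H) ∧ s (u + 2 * H) = 1 / (k * s u) ∧
      c (u + 2 * H) = -(Complex.I * d u / (k * s u)) ∧ d (u + 2 * H) = -(Complex.I * c u / s u) := by
  have hk' : (k : ℂ) ≠ 0 := by exact_mod_cast hk.ne'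
  have hsq : ((√k : ℝ) : ℂ) ^ 2 = k := by exact_mod_cast Real.sq_sqrt hk.le
  have hsk : ((√k : ℝ) : ℂ) ≠ 0 := by exact_mod_cast (Real.sqrt_pos.2 hk).ne'
  have hsH : s H ≠ 0 := by rw [hs]; exact div_ne_zero Complex.I_ne_zero hsk
  obtain ⟨n1, n2, n3, n4, -⟩ := h.neg hH
  -- The base point is `-H`: the translation takes it to `H`, and `sn(-H) = -i/√k` is consistent
  -- with `1 / (k sn(-H)) = sn H`.
  have hb : -H + 2 * H = H := by ring
  have := h.symmetry (β := fun z => z + 2 * H)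
    (T := fun Y => (1 / (k * Y.1), -(Complex.I * Y.2.2 / (k * Y.1)), -(Complex.I * Y.2.1 / Y.1)))
    (G := ContinuousLinearMap.id ℝ ℂ) h.countable_zeros
    (fun α g t hα => by simpa using hα.add_const (2 * H))
    (fun α g t hα hz hA => by
      obtain ⟨i1, i2, e1, e2, e3, -⟩ := h.identities hz
      have h0 : s (α t) ≠ 0 := fun h0 => hA ⟨hz, h0⟩
      have hks : (k : ℂ) * s (α t) ≠ 0 := mul_ne_zero hk' h0
      have f1 := (hasDerivAt_const (α t) (1 : ℂ)).div (e1.const_mul (k : ℂ)) hks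
      have f2 := ((e3.const_mul Complex.I).div (e1.const_mul (k : ℂ)) hks).neg
      have f3 := ((e2.const_mul Complex.I).div e1 h0).neg
      refine ((f1.scomp_hasDerivWithinAt t hα).prodMk
        ((f2.scomp_hasDerivWithinAt t hα).prodMk (f3.scomp_hasDerivWithinAt t hα))).congr_deriv ?_
      simp only [jacobiField, Prod.smul_mk, Prod.mk.injEq, smul_eq_mul,
        ContinuousLinearMap.id_apply]
      have hI := Complex.I_sq
      refine ⟨?_, ?_, ?_⟩
      · field_simp
        rw [hI]
        ring
      · field_simp
        linear_combination (g * c (α t)) * i2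
      · field_simp
        linear_combination (g * d (α t)) * i1)
    (u₀ := -H) n1 (by simp [n2, hsH]) (by rwa [hb]) (by
      rw [hb, n2, n3, n4, hs, ← hc, ← hsq]
      simp only [Prod.mk.injEq]
      refine ⟨?_, ?_, ?_⟩ <;> field_simp
      all_goals norm_num)
    hu (by simp [hu0])
  obtain ⟨h1, h2, -⟩ := this
  simp only [Prod.mk.injEq] at h2
  exact ⟨h1, h2.1.symm, h2.2.1.symm, h2.2.2.symm⟩

/-- Translation by `4H`, where `sn H = i/√k`. -/
lemma translate {k : ℝ} (hk : 0 < k) {s c d E : ℂ → ℂ} (h : IsJacobiSystem k s c d E) {H u : ℂ}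
    (hH : AnalyticAt ℂ s H) (hs : s H = Complex.I / √k) (hc : c H * √k = d H)
    (hu : AnalyticAt ℂ s u) :
    AnalyticAt ℂ s (u + 4 * H) ∧ s (u + 4 * H) = s u ∧ c (u + 4 * H) = -c u ∧
      d (u + 4 * H) = -d u := by
  have hk' : (k : ℂ) ≠ 0 := by exact_mod_cast hk.ne'
  have hsk : ((√k : ℝ) : ℂ) ≠ 0 := by exact_mod_cast (Real.sqrt_pos.2 hk).ne'
  have hsH : s H ≠ 0 := by rw [hs]; exact div_ne_zero Complex.I_ne_zero hsk
  -- The half translation is applied twice only at `H`, where `sn` is nonzero. `symmetry` with empty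
  -- exceptional set then covers the zeros of `sn` too.
  obtain ⟨a1, a2, a3, a4⟩ := h.translate_half hk hH hs hc hH hsH
  obtain ⟨b1, b2, b3, b4⟩ := h.translate_half hk hH hs hc a1 (by
    rw [a2]; exact one_div_ne_zero (mul_ne_zero hk' hsH))
  rw [a2] at b2
  rw [a2, a4] at b3
  rw [a2, a3] at b4
  have hb : H + 2 * H + 2 * H = H + 4 * H := by ring
  rw [hb] at b1 b2 b3 b4
  have hI := Complex.I_sq
  have := h.symmetry (β := fun z => z + 4 * H) (T := fun Y => (Y.1, -Y.2.1, -Y.2.2))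
    (G := ContinuousLinearMap.id ℝ ℂ) countable_empty
    (fun α g t hα => by simpa using hα.add_const (4 * H))
    (fun α g t hα hz _ => by
      obtain ⟨-, -, e1, e2, e3, -⟩ := h.identities hz
      refine ((e1.scomp_hasDerivWithinAt t hα).prodMk
        ((e2.scomp_hasDerivWithinAt t hα).neg.prodMk
          (e3.scomp_hasDerivWithinAt t hα).neg)).congr_deriv ?_
      simp [jacobiField])
    hH (by simp) b1 (by
      simp only [Prod.mk.injEq]
      rw [b2, b3, b4]
      refine ⟨?_, ?_, ?_⟩
      · field_simp
      · field_simp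
        rw [hI]
        ring
      · field_simp
        rw [hI]
        ring)
    hu (by simp)
  obtain ⟨h1, h2, -⟩ := this
  simp only [Prod.mk.injEq] at h2
  exact ⟨h1, h2.1.symm, h2.2.1.symm, h2.2.2.symm⟩

end IsJacobiSystem

/-! ## Values on the axes -/

lemma one_sub_sq_mul_pos {k x : ℝ} (hk0 : 0 < k) (hk1 : k < 1) (hx : x ^ 2 ≤ 1) :
    0 < 1 - k ^ 2 * x ^ 2 := by
  nlinarith [sq_nonneg x, mul_pos hk0 hk0]

namespace IsJacobiSystem

/-- The values on the real axis, parameterized by the amplitude. -/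
lemma real_axis {k : ℝ} (hk0 : 0 < k) (hk1 : k < 1) {s c d E : ℂ → ℂ}
    (h : IsJacobiSystem k s c d E) :
    ∃ F : ℝ → ℝ, Function.Surjective F ∧ ∀ x : ℝ, AnalyticAt ℂ s (F x) ∧
      s (F x) = Real.sin x ∧ c (F x) = Real.cos x ∧
      d (F x) = √(1 - k ^ 2 * Real.sin x ^ 2) := by
  have hpos : ∀ x : ℝ, 0 < 1 - k ^ 2 * Real.sin x ^ 2 := fun x =>
    one_sub_sq_mul_pos hk0 hk1 (Real.sin_sq_le_one x)
  have hsp : ∀ x : ℝ, 0 < √(1 - k ^ 2 * Real.sin x ^ 2) := fun x => Real.sqrt_pos.2 (hpos x)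
  have hcont : Continuous fun x : ℝ => (√(1 - k ^ 2 * Real.sin x ^ 2))⁻¹ :=
    Continuous.inv₀ (by fun_prop) fun x => (hsp x).ne'
  set F : ℝ → ℝ := fun x => ∫ θ in (0 : ℝ)..x, (√(1 - k ^ 2 * Real.sin θ ^ 2))⁻¹ with hF
  have hF' : ∀ x, HasDerivAt F (√(1 - k ^ 2 * Real.sin x ^ 2))⁻¹ x := fun x =>
    intervalIntegral.integral_hasDerivAt_right (hcont.intervalIntegrable _ _)
      (hcont.stronglyMeasurableAtFilter _ _) hcont.continuousAt
  have hF0 : F 0 = 0 := by simp [hF]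
  refine ⟨F, ?_, fun x => ?_⟩
  -- The integrand is at least `1`, so `F x - x` is monotone, `F` is unbounded in both directions,
  -- and surjectivity follows.
  · have hmono : Monotone fun x => F x - x := monotone_of_hasDerivAt_nonneg
      (fun x => (hF' x).sub (hasDerivAt_id' x)) fun x => by
        have : √(1 - k ^ 2 * Real.sin x ^ 2) ≤ 1 :=
          Real.sqrt_le_one.2 (by nlinarith [sq_nonneg (k * Real.sin x)])
        simpa using (one_le_inv₀ (hsp x)).2 this
    refine Continuous.surjective (continuous_iff_continuousAt.2 fun x => (hF' x).continuousAt) ?_ ?_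
    · refine tendsto_atTop_mono' _ ?_ tendsto_id
      filter_upwards [eventually_ge_atTop 0] with x hx
      have := hmono hx
      simp only [hF0, sub_zero] at this
      simpa using this
    · refine tendsto_atBot_mono' _ ?_ tendsto_id
      filter_upwards [eventually_le_atBot 0] with x hx
      have := hmono hx
      simp only [hF0, sub_zero] at this
      simpa using this
  · have hline : ∀ t : ℝ, HasDerivAt (fun t : ℝ => t * x) x t := fun t => by
      simpa using (hasDerivAt_id' t).mul_const x
    -- In the amplitude the solution is explicit: `(sin, cos, √(1 - k² sin²))`.
    have key := h.continuation (α := fun t => (F (t * x) : ℂ))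
      (g := fun t => (((√(1 - k ^ 2 * Real.sin (t * x) ^ 2))⁻¹ * x : ℝ) : ℂ))
      (Y := fun t => ((Real.sin (t * x) : ℂ), (Real.cos (t * x) : ℂ),
        (√(1 - k ^ 2 * Real.sin (t * x) ^ 2) : ℂ))) (by
        refine (Complex.continuous_ofReal.comp ?_).continuousOn
        exact (hcont.comp (continuous_id.mul continuous_const)).mul continuous_const)
      (fun t _ => (((hF' _).comp t (hline t)).ofReal_comp).hasDerivWithinAt)
      (fun t _ => by
        have e1 := (Real.hasDerivAt_sin (t * x)).comp t (hline t)
        have e2 := (Real.hasDerivAt_cos (t * x)).comp t (hline t)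
        have e3 := ((((Real.hasDerivAt_sin (t * x)).pow 2).const_mul (k ^ 2)).const_sub 1
          |>.sqrt (hpos _).ne').comp t (hline t)
        refine (e1.ofReal_comp.prodMk
          (e2.ofReal_comp.prodMk e3.ofReal_comp)).hasDerivWithinAt.congr_deriv ?_
        have hW := (hsp (t * x)).ne'
        simp only [jacobiField, Prod.smul_mk, Prod.mk.injEq, smul_eq_mul, Pi.pow_apply]
        generalize √(1 - k ^ 2 * Real.sin (t * x) ^ 2) = W at hW ⊢
        refine ⟨?_, ?_, ?_⟩
        · norm_cast
          field_simp
        · norm_cast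
          field_simp
        · norm_cast
          field_simp
          norm_num
          ring)
      (by simpa [hF0] using h.analyticAt_zero) (by simp [hF0, h.zero]) 1
      (right_mem_Icc.2 zero_le_one)
    simpa [eq_comm] using key

/-- The values on the segment of the imaginary axis that contains `0`. -/
lemma imaginary_axis {k : ℝ} {s c d E : ℂ → ℂ} (h : IsJacobiSystem k s c d E) (x : ℝ) :
    ∃ v : ℝ, AnalyticAt ℂ s (v * Complex.I) ∧ s (v * Complex.I) = x * Complex.I ∧
      c (v * Complex.I) = √(1 + x ^ 2) ∧ d (v * Complex.I) = √(1 + k ^ 2 * x ^ 2) := by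
  have hp1 : ∀ y : ℝ, 0 < 1 + y ^ 2 := fun y => by positivity
  have hp2 : ∀ y : ℝ, 0 < 1 + k ^ 2 * y ^ 2 := fun y => by positivity
  have hs1 : ∀ y : ℝ, 0 < √(1 + y ^ 2) := fun y => Real.sqrt_pos.2 (hp1 y)
  have hs2 : ∀ y : ℝ, 0 < √(1 + k ^ 2 * y ^ 2) := fun y => Real.sqrt_pos.2 (hp2 y)
  have hcont : Continuous fun y : ℝ => (√(1 + y ^ 2) * √(1 + k ^ 2 * y ^ 2))⁻¹ :=
    Continuous.inv₀ (by fun_prop) fun y => (mul_pos (hs1 y) (hs2 y)).ne'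
  set F : ℝ → ℝ := fun x => ∫ y in (0 : ℝ)..x, (√(1 + y ^ 2) * √(1 + k ^ 2 * y ^ 2))⁻¹ with hF
  have hF' : ∀ x, HasDerivAt F (√(1 + x ^ 2) * √(1 + k ^ 2 * x ^ 2))⁻¹ x := fun x =>
    intervalIntegral.integral_hasDerivAt_right (hcont.intervalIntegrable _ _)
      (hcont.stronglyMeasurableAtFilter _ _) hcont.continuousAt
  have hF0 : F 0 = 0 := by simp [hF]
  refine ⟨F x, ?_⟩
  have hline : ∀ t : ℝ, HasDerivAt (fun t : ℝ => t * x) x t := fun t => by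
    simpa using (hasDerivAt_id' t).mul_const x
  -- The parameter is the value of `sn` itself, which runs along the imaginary axis from `0` to `i
  -- x`.
  have key := h.continuation (α := fun t => (F (t * x) : ℂ) * Complex.I)
    (g := fun t => (((√(1 + (t * x) ^ 2) * √(1 + k ^ 2 * (t * x) ^ 2))⁻¹ * x : ℝ) : ℂ) * Complex.I)
    (Y := fun t => (((t * x : ℝ) : ℂ) * Complex.I, (√(1 + (t * x) ^ 2) : ℂ),
      (√(1 + k ^ 2 * (t * x) ^ 2) : ℂ))) (by
      refine ((Complex.continuous_ofReal.comp ?_).mul continuous_const).continuousOn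
      exact (hcont.comp (continuous_id.mul continuous_const)).mul continuous_const)
    (fun t _ => (((hF' _).comp t (hline t)).ofReal_comp.mul_const Complex.I).hasDerivWithinAt)
    (fun t _ => by
      have e1 := hline t
      have e2 := (((hasDerivAt_pow 2 (t * x)).const_add 1).sqrt (hp1 _).ne').comp t (hline t)
      have e3 := ((((hasDerivAt_pow 2 (t * x)).const_mul (k ^ 2)).const_add 1).sqrt
        (hp2 _).ne').comp t (hline t)
      refine ((e1.ofReal_comp.mul_const Complex.I).prodMk
        (e2.ofReal_comp.prodMk e3.ofReal_comp)).hasDerivWithinAt.congr_deriv ?_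
      have hC := (hs1 (t * x)).ne'
      have hW := (hs2 (t * x)).ne'
      have hI := Complex.I_mul_I
      simp only [jacobiField, Prod.smul_mk, Prod.mk.injEq, smul_eq_mul]
      generalize √(1 + (t * x) ^ 2) = C at hC ⊢
      generalize √(1 + k ^ 2 * (t * x) ^ 2) = W at hW ⊢
      have hC' : (C : ℂ) ≠ 0 := by exact_mod_cast hC
      have hW' : (W : ℂ) ≠ 0 := by exact_mod_cast hW
      push_cast
      refine ⟨?_, ?_, ?_⟩
      · field_simp
      · field_simp
        rw [Complex.I_sq]
        ring
      · field_simp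
        rw [Complex.I_sq]
        ring)
    (by simpa [hF0] using h.analyticAt_zero) (by simp [hF0, h.zero]) 1
    (right_mem_Icc.2 zero_le_one)
  simpa [eq_comm] using key

end IsJacobiSystem

/-! ## Existence and uniqueness of `sn`, `cn`, `dn` -/

lemma hasDerivAt_ellipticIntegral {k : ℝ} (hk0 : 0 < k) (hk1 : k < 1) {x : ℝ}
    (hx : x ∈ Ioo (-1 : ℝ) 1) :
    HasDerivAt (ellipticIntegral k) (1 / (√(1 - x ^ 2) * √(1 - k ^ 2 * x ^ 2))) x := by
  have hc : ContinuousOn (fun t : ℝ => 1 / (√(1 - t ^ 2) * √(1 - k ^ 2 * t ^ 2)))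
      (Ioo (-1 : ℝ) 1) := by
    refine ContinuousOn.div (by fun_prop) (by fun_prop) fun t ht => ?_
    have : t ^ 2 < 1 := by nlinarith [ht.1, ht.2]
    exact mul_ne_zero (Real.sqrt_pos.2 (by linarith)).ne'
      (Real.sqrt_pos.2 (one_sub_sq_mul_pos hk0 hk1 this.le)).ne'
  refine intervalIntegral.integral_hasDerivAt_right (ContinuousOn.intervalIntegrable
    (hc.mono ?_)) (hc.stronglyMeasurableAtFilter isOpen_Ioo x hx) (hc.continuousAt
      (isOpen_Ioo.mem_nhds hx))
  exact (ordConnected_Ioo).uIcc_subset ⟨by norm_num, by norm_num⟩ hx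

namespace IsJacobiSystem

/-- On the real interval the system is solved by `(φ, √(1 - φ²), √(1 - k² φ²))` over the elliptic
integral. This connects the constructed functions with the defining property of `sn`, `cn`, `dn`. -/
lemma ellipticIntegral_values {k : ℝ} (hk0 : 0 < k) (hk1 : k < 1) {s c d E : ℂ → ℂ}
    (h : IsJacobiSystem k s c d E) {φ : ℝ} (hφ : φ ∈ Ioo (-1 : ℝ) 1) :
    s (ellipticIntegral k φ) = φ ∧ c (ellipticIntegral k φ) = √(1 - φ ^ 2) ∧
      d (ellipticIntegral k φ) = √(1 - k ^ 2 * φ ^ 2) := by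
  have hE0 : ellipticIntegral k 0 = 0 := by simp [ellipticIntegral]
  have hmem : ∀ t ∈ Icc (0 : ℝ) 1, t * φ ∈ Ioo (-1 : ℝ) 1 := fun t ht => by
    constructor <;> nlinarith [ht.1, ht.2, hφ.1, hφ.2]
  have hlt : ∀ t ∈ Icc (0 : ℝ) 1, (t * φ) ^ 2 < 1 := fun t ht => by
    nlinarith [(hmem t ht).1, (hmem t ht).2]
  have hp1 : ∀ t ∈ Icc (0 : ℝ) 1, 0 < 1 - (t * φ) ^ 2 := fun t ht => by linarith [hlt t ht]
  have hp2 : ∀ t ∈ Icc (0 : ℝ) 1, 0 < 1 - k ^ 2 * (t * φ) ^ 2 := fun t ht =>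
    one_sub_sq_mul_pos hk0 hk1 (hlt t ht).le
  have hline : ∀ t : ℝ, HasDerivAt (fun t : ℝ => t * φ) φ t := fun t => by
    simpa using (hasDerivAt_id' t).mul_const φ
  have key := h.continuation (α := fun t => (ellipticIntegral k (t * φ) : ℂ))
    (g := fun t => ((1 / (√(1 - (t * φ) ^ 2) * √(1 - k ^ 2 * (t * φ) ^ 2)) * φ : ℝ) : ℂ))
    (Y := fun t => (((t * φ : ℝ) : ℂ), (√(1 - (t * φ) ^ 2) : ℂ),
      (√(1 - k ^ 2 * (t * φ) ^ 2) : ℂ))) (by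
      refine Complex.continuous_ofReal.comp_continuousOn (ContinuousOn.mul ?_ continuousOn_const)
      refine ContinuousOn.div (by fun_prop) (by fun_prop) fun t ht => ?_
      exact mul_ne_zero (Real.sqrt_pos.2 (hp1 t ht)).ne' (Real.sqrt_pos.2 (hp2 t ht)).ne')
    (fun t ht => (HasDerivAt.ofReal_comp (f := fun t => ellipticIntegral k (t * φ))
      (HasDerivAt.comp (h₂ := ellipticIntegral k) t
        (hasDerivAt_ellipticIntegral hk0 hk1 (hmem t ht)) (hline t))).hasDerivWithinAt)
    (fun t ht => by
      have e1 := hline t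
      have e2 := (((hasDerivAt_pow 2 (t * φ)).const_sub 1).sqrt (hp1 t ht).ne').comp t (hline t)
      have e3 := ((((hasDerivAt_pow 2 (t * φ)).const_mul (k ^ 2)).const_sub 1).sqrt
        (hp2 t ht).ne').comp t (hline t)
      refine (e1.ofReal_comp.prodMk
        (e2.ofReal_comp.prodMk e3.ofReal_comp)).hasDerivWithinAt.congr_deriv ?_
      have hC := (Real.sqrt_pos.2 (hp1 t ht)).ne'
      have hW := (Real.sqrt_pos.2 (hp2 t ht)).ne'
      simp only [jacobiField, Prod.smul_mk, Prod.mk.injEq, smul_eq_mul]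
      generalize √(1 - (t * φ) ^ 2) = C at hC ⊢
      generalize √(1 - k ^ 2 * (t * φ) ^ 2) = W at hW ⊢
      refine ⟨?_, ?_, ?_⟩
      · norm_cast
        field_simp
      · norm_cast
        field_simp
        norm_num
        ring
      · norm_cast
        field_simp
        norm_num
        ring)
    (by simpa [hE0] using h.analyticAt_zero) (by simp [hE0, h.zero]) 1
    (right_mem_Icc.2 zero_le_one)
  have := key.2
  simp only [one_mul, Prod.mk.injEq] at this
  exact ⟨this.1.symm, this.2.1.symm, this.2.2.symm⟩

end IsJacobiSystem

lemma IsMeromorphicExtension.unique {k : ℝ} (hk0 : 0 < k) (hk1 : k < 1) {g : ℝ → ℝ} {f f' : ℂ → ℂ}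
    (hf : IsMeromorphicExtension k g f) (hf' : IsMeromorphicExtension k g f') : f = f' := by
  obtain ⟨s, c, d, E, h⟩ := exists_isJacobiSystem hk0 hk1
  have hev : ∀ᶠ φ : ℝ in 𝓝[≠] 0, φ ∈ Ioo (-1 : ℝ) 1 :=
    nhdsWithin_le_nhds (Ioo_mem_nhds (by norm_num) (by norm_num))
  have hE0 : ellipticIntegral k 0 = 0 := by simp [ellipticIntegral]
  have ht : Tendsto (fun φ : ℝ => (ellipticIntegral k φ : ℂ)) (𝓝[≠] 0) (𝓝[≠] 0) := by
    refine tendsto_nhdsWithin_iff.2 ⟨?_, ?_⟩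
    · have := (hasDerivAt_ellipticIntegral hk0 hk1 (x := 0)
        ⟨by norm_num, by norm_num⟩).ofReal_comp.continuousAt.tendsto
      rw [hE0] at this
      exact this.mono_left nhdsWithin_le_nhds
    -- The elliptic integral vanishes only for `φ = 0` because `sn` inverts it, so the points where
    -- the values are prescribed accumulate at `0` without being `0`.
    · filter_upwards [hev, self_mem_nhdsWithin] with φ hφ hne h0
      have := (h.ellipticIntegral_values hk0 hk1 hφ).1
      rw [show (ellipticIntegral k φ : ℂ) = 0 from h0, h.zero.1] at this
      exact hne (by exact_mod_cast this.symm)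
  funext z
  refine MeromorphicNFOn.eqOn_of_frequently_eq isPreconnected_univ hf.1 hf'.1 (mem_univ 0)
    (ht.frequently (Eventually.frequently ?_)) (mem_univ z)
  filter_upwards [hev] with φ hφ
  rw [hf.2 φ hφ, hf'.2 φ hφ]

/-- Uniqueness identifies the functions picked by the choice operator with those of the constructed
system. -/
theorem jacobi_exists {k : ℝ} (hk0 : 0 < k) (hk1 : k < 1) :
    (∀ f, IsJacobiSn k f ↔ f = jacobiSn k) ∧ (∀ f, IsJacobiCn k f ↔ f = jacobiCn k) ∧
      (∀ f, IsJacobiDn k f ↔ f = jacobiDn k) ∧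
      ∃ E, IsJacobiSystem k (jacobiSn k) (jacobiCn k) (jacobiDn k) E := by
  obtain ⟨s, c, d, E, h⟩ := exists_isJacobiSystem hk0 hk1
  have hv := fun φ hφ => h.ellipticIntegral_values hk0 hk1 (φ := φ) hφ
  have key : ∀ {g : ℝ → ℝ} {f : ℂ → ℂ}, IsMeromorphicExtension k g f →
      (∀ f', IsMeromorphicExtension k g f' ↔
        f' = Classical.epsilon (IsMeromorphicExtension k g)) ∧
      Classical.epsilon (IsMeromorphicExtension k g) = f := fun {g f} hf => by
    have he := Classical.epsilon_spec (p := IsMeromorphicExtension k g) ⟨f, hf⟩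
    exact ⟨fun f' => ⟨fun hf' => hf'.unique hk0 hk1 he, fun hf' => hf' ▸ he⟩,
      he.unique hk0 hk1 hf⟩
  obtain ⟨a1, a2⟩ := key (f := s) ⟨h.nf_s, fun φ hφ => (hv φ hφ).1⟩
  obtain ⟨b1, b2⟩ := key (f := c) ⟨h.nf_c, fun φ hφ => (hv φ hφ).2.1⟩
  obtain ⟨c1, c2⟩ := key (f := d) ⟨h.nf_d, fun φ hφ => (hv φ hφ).2.2⟩
  refine ⟨a1, b1, c1, E, ?_⟩
  rw [show jacobiSn k = s from a2, show jacobiCn k = c from b2, show jacobiDn k = d from c2]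
  exact h

lemma IsJacobiSystem.mem_jacobiDomain {k : ℝ} {c d E : ℂ → ℂ}
    (h : IsJacobiSystem k (jacobiSn k) c d E) {u : ℂ} :
    u ∈ jacobiDomain k ↔ AnalyticAt ℂ (jacobiSn k) u := h.mem_iff

/-! ## Integrals along paths -/

/-- The fundamental theorem along each path gives independence. Paths exist because only countably
many points are removed. -/
lemma integralWellDefinedOn_of_primitive {f E : ℂ → ℂ} {U : Set ℂ} (hU : IsOpen U)
    (hUc : Uᶜ.Countable) (h0 : (0 : ℂ) ∈ U) (hf : ContinuousOn f U)
    (hE : ∀ u ∈ U, HasDerivAt E (f u) u) :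
    IntegralWellDefinedOn f U ∧ ∀ u ∈ U, integralFromZero f U u = E u - E 0 := by
  have hpath : ∀ u α, IsC1Path U 0 u α → pathIntegral f α = E u - E 0 := fun u α hα => by
    obtain ⟨h1, h2⟩ := hα.contDiffOn.hasDerivWithinAt_Icc
    have hαc : ContinuousOn α (Icc 0 1) := hα.contDiffOn.continuousOn
    have hd : ∀ t ∈ Icc (0 : ℝ) 1, HasDerivWithinAt (fun t => E (α t))
        (f (α t) * derivWithin α (Icc 0 1) t) (Icc 0 1) t := fun t ht => by
      have := (hE _ (hα.mapsTo ht)).scomp_hasDerivWithinAt t (h1 t ht)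
      rwa [smul_eq_mul, mul_comm] at this
    rw [pathIntegral, intervalIntegral.integral_eq_sub_of_hasDerivAt_of_le zero_le_one
      (f := fun t => E (α t)) (fun t ht => (hd t ht).continuousWithinAt)
      (fun t ht => (hd t (Ioo_subset_Icc_self ht)).hasDerivAt (Icc_mem_nhds ht.1 ht.2))
      (ContinuousOn.intervalIntegrable (by
        rw [uIcc_of_le zero_le_one]
        exact (hf.comp hαc hα.mapsTo).mul h2)), hα.source, hα.target]
  have hj : ∀ u ∈ U, ∃ α, IsC1Path U 0 u α := fun u hu => by
    obtain ⟨α, h1, h2, h3, h4⟩ := exists_contDiff_path_compl hUc (p := 0) (q := u) (by simpa)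
      (by simpa)
    exact ⟨α, h1.contDiffOn, fun t ht => by simpa using h4 t ht, h2, h3⟩
  have hval : ∀ u ∈ U, integralFromZero f U u = E u - E 0 := fun u hu => by
    rw [integralFromZero, dif_pos (hj u hu)]
    exact hpath u _ (hj u hu).choose_spec
  refine ⟨⟨hj, fun u α hα => ?_, fun u hu => ?_⟩, hval⟩
  · rw [hpath u α hα, hval u (hα.target ▸ hα.mapsTo (right_mem_Icc.2 zero_le_one))]
  · refine ((hE u hu).sub_const (E 0)).congr_of_eventuallyEq ?_
    filter_upwards [hU.mem_nhds hu] with v hv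
    exact hval v hv

/-! ## Minimal surfaces from isotropic holomorphic curves -/

/-- The real part as a continuous linear map. -/
def reVecCLM : (Fin 3 → ℂ) →L[ℝ] E3 :=
  ((EuclideanSpace.equiv (Fin 3) ℝ).symm : (Fin 3 → ℝ) →L[ℝ] E3) ∘L
    ContinuousLinearMap.pi fun i => Complex.reCLM ∘L ContinuousLinearMap.proj i

/-- Conjugate surfaces thereby become real parts of another isotropic curve. -/
lemma imVec_eq_reVec (v : Fin 3 → ℂ) : imVec v = reVec (-Complex.I • v) := by
  ext i
  simp [imVec, reVec]

lemma inner_reVec (v w : Fin 3 → ℂ) : inner ℝ (reVec v) (reVec w) =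
    (v 0).re * (w 0).re + (v 1).re * (w 1).re + (v 2).re * (w 2).re := by
  simp [reVec, PiLp.inner_apply, Fin.sum_univ_three, mul_comm]

lemma isotropic_re_im {v : Fin 3 → ℂ} (h : v 0 ^ 2 + v 1 ^ 2 + v 2 ^ 2 = 0) :
    (v 0).re ^ 2 + (v 1).re ^ 2 + (v 2).re ^ 2 = (v 0).im ^ 2 + (v 1).im ^ 2 + (v 2).im ^ 2 ∧
      (v 0).re * (v 0).im + (v 1).re * (v 1).im + (v 2).re * (v 2).im = 0 := by
  have h1 := congrArg Complex.re h
  have h2 := congrArg Complex.im h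
  simp only [pow_two, Complex.add_re, Complex.mul_re, Complex.add_im, Complex.mul_im,
    Complex.zero_re, Complex.zero_im] at h1 h2
  constructor <;> linarith

/-- Isotropy makes the real and imaginary parts equally long. -/
lemma eq_zero_of_isotropic_of_re {v : Fin 3 → ℂ} (h : v 0 ^ 2 + v 1 ^ 2 + v 2 ^ 2 = 0)
    (hre : ∀ i, (v i).re = 0) : v = 0 := by
  obtain ⟨h1, -⟩ := isotropic_re_im h
  rw [hre, hre, hre] at h1
  have h0 : (v 0).im = 0 := by nlinarith [sq_nonneg (v 0).im, sq_nonneg (v 1).im, sq_nonneg (v 2).im]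
  have h1' : (v 1).im = 0 := by
    nlinarith [sq_nonneg (v 0).im, sq_nonneg (v 1).im, sq_nonneg (v 2).im]
  have h2 : (v 2).im = 0 := by nlinarith [sq_nonneg (v 0).im, sq_nonneg (v 1).im, sq_nonneg (v 2).im]
  ext i
  apply Complex.ext (hre i)
  fin_cases i
  exacts [h0, h1', h2]

lemma isotropic_smul {v : Fin 3 → ℂ} (h : v 0 ^ 2 + v 1 ^ 2 + v 2 ^ 2 = 0) (a : ℂ) :
    (a • v) 0 ^ 2 + (a • v) 1 ^ 2 + (a • v) 2 ^ 2 = 0 := by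
  simp only [Pi.smul_apply, smul_eq_mul]
  linear_combination a ^ 2 * h

/-- A holomorphic curve in `ℂ³` on `U` with the isotropic derivative `F'`. -/
structure IsIsotropicOn (F F' : ℂ → Fin 3 → ℂ) (U : Set ℂ) : Prop where
  isOpen : IsOpen U
  hasDerivAt : ∀ u ∈ U, HasDerivAt F (F' u) u
  isotropic : ∀ u ∈ U, F' u 0 ^ 2 + F' u 1 ^ 2 + F' u 2 ^ 2 = 0

namespace IsIsotropicOn

lemma neg_I_smul {F F' : ℂ → Fin 3 → ℂ} {U : Set ℂ} (h : IsIsotropicOn F F' U) :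
    IsIsotropicOn (fun u => -Complex.I • F u) (fun u => -Complex.I • F' u) U :=
  ⟨h.isOpen, fun u hu => (h.hasDerivAt u hu).const_smul (-Complex.I),
    fun u hu => isotropic_smul (h.isotropic u hu) _⟩

lemma hasFDerivAt_reVec {F : ℂ → Fin 3 → ℂ} {w : Fin 3 → ℂ} {u : ℂ} (h : HasDerivAt F w u) :
    HasFDerivAt (fun z => reVec (F z))
      (reVecCLM ∘L ((ContinuousLinearMap.toSpanSingleton ℂ w).restrictScalars ℝ)) u :=
  reVecCLM.hasFDerivAt.comp u (h.hasFDerivAt.restrictScalars ℝ)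

lemma partialD_reVec {F : ℂ → Fin 3 → ℂ} {w : Fin 3 → ℂ} {u : ℂ} (h : HasDerivAt F w u) (a : ℂ) :
    partialD a (fun z => reVec (F z)) u = reVec (a • w) := by
  rw [partialD, (hasFDerivAt_reVec h).fderiv]
  rfl

/-- The differential is `a ↦ Re (a F')`. Since `a F'` is isotropic, its real part vanishes only if
`a F'` does. -/
lemma injective_fderiv_iff {F F' : ℂ → Fin 3 → ℂ} {U : Set ℂ} (h : IsIsotropicOn F F' U) {u : ℂ}
    (hu : u ∈ U) : Function.Injective (fderiv ℝ (fun z => reVec (F z)) u) ↔ F' u ≠ 0 := by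
  have hp := partialD_reVec (h.hasDerivAt u hu)
  rw [injective_iff_map_eq_zero]
  constructor
  · intro hinj h0
    have := hinj 1 (by
      have := hp 1
      rw [partialD] at this
      rw [this, h0]
      ext i
      simp [reVec])
    exact one_ne_zero this
  · intro hne a ha
    have h1 : reVec (a • F' u) = 0 := (hp a).symm.trans ha
    have h2 : a • F' u = 0 := eq_zero_of_isotropic_of_re (isotropic_smul (h.isotropic u hu) a)
      fun i => by simpa [reVec] using congrArg (fun q : E3 => q i) h1
    exact (smul_eq_zero.1 h2).resolve_right hne

lemma differentiableOn_deriv {F F' : ℂ → Fin 3 → ℂ} {U : Set ℂ} (h : IsIsotropicOn F F' U) :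
    ∀ u ∈ U, HasDerivAt F' (deriv F' u) u := fun u hu => by
  have hd : DifferentiableOn ℂ F U := fun v hv =>
    (h.hasDerivAt v hv).differentiableAt.differentiableWithinAt
  have h2 : DifferentiableAt ℂ (deriv F) u :=
    (hd.deriv h.isOpen).differentiableAt (h.isOpen.mem_nhds hu)
  have h3 : F' =ᶠ[𝓝 u] deriv F := by
    filter_upwards [h.isOpen.mem_nhds hu] with v hv
    exact (h.hasDerivAt v hv).deriv.symm
  exact (h2.congr_of_eventuallyEq h3).hasDerivAt

/-- Isotropy of `F'` is conformality of the real part. In isothermal parameters the mean curvature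
vector is proportional to the Laplacian, and `X₂₂ = Re (i² F'') = -X₁₁`. -/
theorem isMinimalSurfaceOn {F F' : ℂ → Fin 3 → ℂ} {U : Set ℂ} (h : IsIsotropicOn F F' U)
    (hne : ∀ᶠ u in codiscreteWithin U, F' u ≠ 0) :
    IsMinimalSurfaceOn (fun u => reVec (F u)) U := by
  have hd : DifferentiableOn ℂ F U := fun v hv =>
    (h.hasDerivAt v hv).differentiableAt.differentiableWithinAt
  have hp : ∀ a : ℂ, ∀ u ∈ U, partialD a (fun z => reVec (F z)) u = reVec (a • F' u) :=
    fun a u hu => partialD_reVec (h.hasDerivAt u hu) a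
  have hpp : ∀ a b : ℂ, ∀ u ∈ U, partialD b (partialD a (fun z => reVec (F z))) u =
      reVec (b • a • deriv F' u) := fun a b u hu => by
    have he : partialD a (fun z => reVec (F z)) =ᶠ[𝓝 u] fun z => reVec (a • F' z) := by
      filter_upwards [h.isOpen.mem_nhds hu] with v hv
      exact hp a v hv
    rw [partialD, he.fderiv_eq]
    exact partialD_reVec ((h.differentiableOn_deriv u hu).const_smul a) b
  have hi : ∀ u ∈ U, inner ℝ (reVec (F' u)) (reVec (F' u)) =
      inner ℝ (reVec (Complex.I • F' u)) (reVec (Complex.I • F' u)) ∧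
      inner ℝ (reVec (F' u)) (reVec (Complex.I • F' u)) = 0 := fun u hu => by
    obtain ⟨h1, h2⟩ := isotropic_re_im (h.isotropic u hu)
    simp only [inner_reVec, Pi.smul_apply, smul_eq_mul, Complex.I_mul_re]
    constructor <;> linarith
  refine ⟨h.isOpen, ?_, fun u hu => ?_, fun u hu => ?_, fun u hu => ?_, ?_, fun u hu n _ _ => ?_⟩
  · exact reVecCLM.contDiff.comp_contDiffOn ((hd.contDiffOn h.isOpen).restrict_scalars ℝ)
  · exact (hd.analyticAt (h.isOpen.mem_nhds hu)).harmonicAt.comp_CLM reVecCLM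
  · rw [hp _ u hu, hp _ u hu, one_smul, @norm_eq_sqrt_real_inner E3, @norm_eq_sqrt_real_inner E3,
      (hi u hu).1]
  · rw [hp _ u hu, hp _ u hu, one_smul, (hi u hu).2]
  · filter_upwards [hne, self_mem_codiscreteWithin U] with u h1 h2
    exact (h.injective_fderiv_iff h2).2 h1
  · simp only [hp _ u hu, hpp _ _ u hu, one_smul, (hi u hu).2, (hi u hu).1]
    have : reVec (Complex.I • Complex.I • deriv F' u) = -reVec (deriv F' u) := by
      rw [smul_smul, Complex.I_mul_I]
      ext i
      simp [reVec]
    rw [this]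
    simp

/-- With `w = v F'`, the tangent plane is spanned by the horizontal vector `c' = Re w` and the
vertical vector `Re (i w)`. The curve moves horizontally, so `c''` is horizontal; subtracting its
projection to `c'` leaves a normal vector. -/
theorem isPregeodesicAt {F F' : ℂ → Fin 3 → ℂ} {U : Set ℂ} (h : IsIsotropicOn F F' U)
    {α : ℝ → ℂ} {v : ℂ} (hα : ∀ s, HasDerivAt α v s) {t : ℝ} (ht : α t ∈ U) (hv : v ≠ 0)
    (hne : F' (α t) ≠ 0) (h0 : (v * F' (α t) 0).im = 0) (h1 : (v * F' (α t) 1).im = 0)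
    (h2 : ∀ s, α s ∈ U → (v * F' (α s) 2).re = 0) :
    IsPregeodesicAt (fun u => reVec (F u)) α t := by
  have hev : ∀ᶠ s in 𝓝 t, α s ∈ U := (hα t).continuousAt.eventually (h.isOpen.mem_nhds ht)
  have hc : ∀ s, α s ∈ U → HasDerivAt (fun s => reVec (F (α s))) (reVec (v • F' (α s))) s :=
    fun s hs => reVecCLM.hasFDerivAt.comp_hasDerivAt s ((h.hasDerivAt _ hs).scomp s (hα s))
  have hc1 : deriv (fun s => reVec (F (α s))) =ᶠ[𝓝 t] fun s => reVec (v • F' (α s)) := by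
    filter_upwards [hev] with s hs
    exact (hc s hs).deriv
  have hc2 : HasDerivAt (fun s => reVec (v • F' (α s))) (reVec (v • v • deriv F' (α t))) t :=
    reVecCLM.hasFDerivAt.comp_hasDerivAt t
      (((h.differentiableOn_deriv _ ht).scomp t (hα t)).const_smul v)
  set w : Fin 3 → ℂ := v • F' (α t) with hw
  set B : Fin 3 → ℂ := v • v • deriv F' (α t) with hB
  -- The third component of `c'` vanishes along the whole curve near `t`, hence so does that of
  -- `c''`.
  have hB2 : (B 2).re = 0 := by
    have e1 : HasDerivAt (fun s => (reVec (v • F' (α s))) 2) ((reVec B) 2) t :=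
      (EuclideanSpace.proj (𝕜 := ℝ) (2 : Fin 3)).hasFDerivAt.comp_hasDerivAt t hc2
    have e2 : (fun s => (reVec (v • F' (α s))) 2) =ᶠ[𝓝 t] fun _ => (0 : ℝ) := by
      filter_upwards [hev] with s hs
      exact h2 s hs
    exact (e1.congr_of_eventuallyEq e2.symm).unique (hasDerivAt_const t (0 : ℝ))
  have hwiso := isotropic_smul (h.isotropic _ ht) v
  have hwne : w ≠ 0 := smul_ne_zero hv hne
  have hw0 : (w 0).im = 0 := h0
  have hw1 : (w 1).im = 0 := h1
  have hw2 : (w 2).re = 0 := h2 t ht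
  have hpos : (w 0).re ^ 2 + (w 1).re ^ 2 ≠ 0 := fun hz => hwne <| by
    refine eq_zero_of_isotropic_of_re hwiso fun i => ?_
    fin_cases i
    · simpa using (by nlinarith [sq_nonneg (w 0).re, sq_nonneg (w 1).re] : (w 0).re = 0)
    · simpa using (by nlinarith [sq_nonneg (w 0).re, sq_nonneg (w 1).re] : (w 1).re = 0)
    · exact hw2
  have hd1 : deriv (fun s => reVec (F (α s))) t = reVec w := (hc t ht).deriv
  have hd2 : deriv (deriv fun s => reVec (F (α s))) t = reVec B := by
    rw [hc1.deriv_eq]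
    exact hc2.deriv
  refine ⟨(h.injective_fderiv_iff ht).2 hne, ?_, ?_⟩
  · rw [hd1]
    intro hz
    refine hpos ?_
    have e0 : (w 0).re = 0 := congrArg (fun q : E3 => q 0) hz
    have e1 : (w 1).re = 0 := congrArg (fun q : E3 => q 1) hz
    rw [e0, e1]
    norm_num
  · set μ := ((B 0).re * (w 0).re + (B 1).re * (w 1).re) / ((w 0).re ^ 2 + (w 1).re ^ 2) with hμ
    have hμ' : μ * ((w 0).re ^ 2 + (w 1).re ^ 2) = (B 0).re * (w 0).re + (B 1).re * (w 1).re :=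
      div_mul_cancel₀ _ hpos
    refine ⟨μ, fun a => ?_⟩
    rw [hd1, hd2, partialD_reVec (h.hasDerivAt _ ht)]
    -- Every tangent vector is `Re ((a / v) w)`, whose horizontal part is `Re (a / v)` times `c'`.
    have ea : a • F' (α t) = (a / v) • w := by
      rw [hw, smul_smul, div_mul_cancel₀ _ hv]
    rw [ea, inner_sub_left, inner_smul_left, inner_reVec, inner_reVec]
    simp only [Pi.smul_apply, smul_eq_mul, Complex.mul_re, hw0, hw1, hw2, hB2, conj_trivial]
    linear_combination (-(a / v).re) * hμ'

end IsIsotropicOn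

/-! ## Auxiliary facts on paths and zeros -/

/-- A logarithm of `P` along the path: with `z` the integral of the logarithmic derivative, `exp
(-z) P` is constant. -/
lemma exists_exp_eq_of_hasDerivWithinAt {P ρ : ℝ → ℂ} (hρ : ContinuousOn ρ (Icc 0 1))
    (hP : ∀ t ∈ Icc (0 : ℝ) 1, HasDerivWithinAt P (ρ t * P t) (Icc 0 1) t) (h0 : P 0 = 1) :
    ∃ z : ℝ → ℂ, z 0 = 0 ∧ (∀ t ∈ Icc (0 : ℝ) 1, HasDerivWithinAt z (ρ t) (Icc 0 1) t) ∧
      ∀ t ∈ Icc (0 : ℝ) 1, Complex.exp (z t) = P t := by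
  obtain ⟨z, hz0, hz⟩ := exists_hasDerivWithinAt_Icc hρ
  refine ⟨z, hz0, hz, fun t ht => ?_⟩
  have hd : ∀ t ∈ Icc (0 : ℝ) 1,
      HasDerivWithinAt (fun t => Complex.exp (-z t) * P t) 0 (Icc 0 1) t := fun t ht => by
    refine ((hz t ht).fun_neg.cexp.mul (hP t ht)).congr_deriv ?_
    ring
  have := constant_of_derivWithin_zero (fun t ht => (hd t ht).differentiableWithinAt)
    (fun t ht => (hd t (Ico_subset_Icc_self ht)).derivWithin
      (uniqueDiffOn_Icc zero_lt_one t (Ico_subset_Icc_self ht))) t ht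
  rw [hz0, h0, neg_zero, Complex.exp_zero, mul_one, Complex.exp_neg] at this
  field_simp at this
  exact this.symm

lemma integral_mul_derivWithin {w z z' Φ : ℝ → ℂ}
    (hw : ContinuousOn w (Icc 0 1)) (hz' : ContinuousOn z' (Icc 0 1))
    (hz : ∀ t ∈ Icc (0 : ℝ) 1, HasDerivWithinAt z (z' t) (Icc 0 1) t)
    (hΦ : ∀ t ∈ Icc (0 : ℝ) 1, HasDerivWithinAt Φ (w t * z' t) (Icc 0 1) t) :
    ∫ t in (0 : ℝ)..1, w t * derivWithin z (Icc 0 1) t = Φ 1 - Φ 0 := by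
  have hu := uniqueDiffOn_Icc (zero_lt_one' ℝ)
  rw [← intervalIntegral.integral_eq_sub_of_hasDerivAt_of_le zero_le_one
      (f := Φ) (fun t ht => (hΦ t ht).continuousWithinAt)
      (fun t ht => (hΦ t (Ioo_subset_Icc_self ht)).hasDerivAt (Icc_mem_nhds ht.1 ht.2))
      (ContinuousOn.intervalIntegrable (by
        rw [uIcc_of_le zero_le_one]
        exact hw.mul hz'))]
  refine intervalIntegral.integral_congr fun t ht => ?_
  rw [uIcc_of_le zero_le_one] at ht
  simp only [(hz t ht).derivWithin (hu t ht)]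

/-- Simple zeros are isolated. This supplies the discreteness of the branch points. -/
lemma eventually_codiscreteWithin_ne_zero {f f' : ℂ → ℂ} {U : Set ℂ}
    (hf : ∀ u ∈ U, HasDerivAt f (f' u) u) (h : ∀ u ∈ U, f u = 0 → f' u ≠ 0) :
    ∀ᶠ u in codiscreteWithin U, f u ≠ 0 := by
  refine mem_codiscreteWithin.2 fun x hx => ?_
  rw [disjoint_principal_right]
  have : ∀ᶠ z in 𝓝[≠] x, f z ≠ 0 := by
    by_cases h0 : f x = 0
    · exact (hf x hx).eventually_ne (h x hx h0)
    · exact nhdsWithin_le_nhds ((hf x hx).continuousAt.eventually_ne h0)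
  filter_upwards [this] with z hz hmem
  exact hmem.2 hz

lemma eq_of_sq_eq_of_re_pos {w : ℂ} {a : ℝ} (ha : 0 < a) (h : w ^ 2 = (a : ℂ) ^ 2)
    (hw : 0 < w.re) : w = a := by
  rcases sq_eq_sq_iff_eq_or_eq_neg.1 h with h | h
  · exact h
  · rw [h, Complex.neg_re, Complex.ofReal_re] at hw
    linarith

/-! ## The ellipse -/

lemma ellipseModulus_mem {a b : ℝ} (hb : 0 < b) (hba : b < a) :
    (0 < ellipseModulus a b ∧ ellipseModulus a b < 1) ∧
      a ^ 2 * ellipseModulus a b ^ 2 = a ^ 2 - b ^ 2 := by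
  have ha : 0 < a := hb.trans hba
  have hpos : 0 < a ^ 2 - b ^ 2 := by nlinarith
  refine ⟨⟨div_pos (Real.sqrt_pos.2 hpos) ha, (div_lt_one ha).2 ?_⟩, ?_⟩
  · rw [Real.sqrt_lt' ha]
    nlinarith
  · rw [ellipseModulus, div_pow, Real.sq_sqrt hpos.le]
    field_simp

section

variable {a b : ℝ} {E : ℂ → ℂ}

namespace IsJacobiSystem

lemma domain_eq {k : ℝ} {c d E : ℂ → ℂ} (h : IsJacobiSystem k (jacobiSn k) c d E) :
    jacobiDomain k = {u | AnalyticAt ℂ (jacobiSn k) u} := Set.ext fun _ => h.mem_jacobiDomain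

lemma isOpen_jacobiDomain {k : ℝ} {c d E : ℂ → ℂ} (h : IsJacobiSystem k (jacobiSn k) c d E) :
    IsOpen (jacobiDomain k) := by
  rw [h.domain_eq]
  exact isOpen_analyticAt ℂ _

lemma countable_compl_jacobiDomain {k : ℝ} {c d E : ℂ → ℂ}
    (h : IsJacobiSystem k (jacobiSn k) c d E) : (jacobiDomain k)ᶜ.Countable := by
  rw [h.domain_eq]
  exact h.countable_compl

lemma eventually_mem_jacobiDomain {k : ℝ} {c d E : ℂ → ℂ}
    (h : IsJacobiSystem k (jacobiSn k) c d E) (p : ℂ) : ∀ᶠ z in 𝓝[≠] p, z ∈ jacobiDomain k := by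
  filter_upwards [(h.nf_s (mem_univ p)).meromorphicAt.eventually_analyticAt] with z hz
  exact h.mem_jacobiDomain.2 hz

lemma hasDerivWithinAt_comp {k : ℝ} {s c d E : ℂ → ℂ} (h : IsJacobiSystem k s c d E) {α g : ℝ → ℂ}
    (hα : ∀ t ∈ Icc (0 : ℝ) 1, HasDerivWithinAt α (g t) (Icc 0 1) t)
    (hs : ∀ t ∈ Icc (0 : ℝ) 1, AnalyticAt ℂ s (α t)) :
    (∀ t ∈ Icc (0 : ℝ) 1, HasDerivWithinAt (fun t => s (α t)) (g t * (c (α t) * d (α t)))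
      (Icc 0 1) t) ∧
    (∀ t ∈ Icc (0 : ℝ) 1, HasDerivWithinAt (fun t => c (α t)) (g t * -(s (α t) * d (α t)))
      (Icc 0 1) t) ∧
    (∀ t ∈ Icc (0 : ℝ) 1, HasDerivWithinAt (fun t => d (α t))
      (g t * -(k ^ 2 * (s (α t) * c (α t)))) (Icc 0 1) t) ∧
    (∀ t ∈ Icc (0 : ℝ) 1, HasDerivWithinAt (fun t => E (α t)) (g t * d (α t) ^ 2) (Icc 0 1) t) ∧
    ContinuousOn (fun t => s (α t)) (Icc 0 1) ∧ ContinuousOn (fun t => c (α t)) (Icc 0 1) ∧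
    ContinuousOn (fun t => d (α t)) (Icc 0 1) := by
  have e1 : ∀ t ∈ Icc (0 : ℝ) 1, HasDerivWithinAt (fun t => s (α t))
      (g t * (c (α t) * d (α t))) (Icc 0 1) t := fun t ht =>
    (h.identities (hs t ht)).2.2.1.scomp_hasDerivWithinAt t (hα t ht)
  have e2 : ∀ t ∈ Icc (0 : ℝ) 1, HasDerivWithinAt (fun t => c (α t))
      (g t * -(s (α t) * d (α t))) (Icc 0 1) t := fun t ht =>
    (h.identities (hs t ht)).2.2.2.1.scomp_hasDerivWithinAt t (hα t ht)
  have e3 : ∀ t ∈ Icc (0 : ℝ) 1, HasDerivWithinAt (fun t => d (α t))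
      (g t * -(k ^ 2 * (s (α t) * c (α t)))) (Icc 0 1) t := fun t ht =>
    (h.identities (hs t ht)).2.2.2.2.1.scomp_hasDerivWithinAt t (hα t ht)
  have e4 : ∀ t ∈ Icc (0 : ℝ) 1, HasDerivWithinAt (fun t => E (α t))
      (g t * d (α t) ^ 2) (Icc 0 1) t := fun t ht =>
    (h.identities (hs t ht)).2.2.2.2.2.scomp_hasDerivWithinAt t (hα t ht)
  exact ⟨e1, e2, e3, e4, fun t ht => (e1 t ht).continuousWithinAt,
    fun t ht => (e2 t ht).continuousWithinAt, fun t ht => (e3 t ht).continuousWithinAt⟩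

lemma exists_path {k : ℝ} {s c d E : ℂ → ℂ} (h : IsJacobiSystem k s c d E) {u : ℂ}
    (hu : AnalyticAt ℂ s u) : ∃ α g : ℝ → ℂ, α 0 = 0 ∧ α 1 = u ∧ ContinuousOn g (Icc 0 1) ∧
      (∀ t ∈ Icc (0 : ℝ) 1, HasDerivWithinAt α (g t) (Icc 0 1) t) ∧
      ∀ t ∈ Icc (0 : ℝ) 1, AnalyticAt ℂ s (α t) := by
  obtain ⟨α, h1, h2, h3, h4⟩ := exists_contDiff_path_compl h.countable_compl (p := 0) (q := u)
    (by simpa using h.analyticAt_zero) (by simpa)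
  obtain ⟨h5, h6⟩ := h1.contDiffOn.hasDerivWithinAt_Icc
  exact ⟨α, _, h2, h3, h6, h5, fun t ht => by simpa using h4 t ht⟩

end IsJacobiSystem

/-- The hypotheses on the data of the ellipse. -/
structure IsEllipseData (a b : ℝ) (E : ℂ → ℂ) : Prop where
  pos_b : 0 < b
  lt : b < a
  system : IsJacobiSystem (ellipseModulus a b) (jacobiSn (ellipseModulus a b))
    (jacobiCn (ellipseModulus a b)) (jacobiDn (ellipseModulus a b)) E

namespace IsEllipseData

lemma pos_a (h : IsEllipseData a b E) : 0 < a := h.pos_b.trans h.lt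

lemma sq_modulus (h : IsEllipseData a b E) :
    (a : ℂ) ^ 2 * (ellipseModulus a b : ℂ) ^ 2 = (a : ℂ) ^ 2 - (b : ℂ) ^ 2 := by
  exact_mod_cast (ellipseModulus_mem h.pos_b h.lt).2

lemma integral (h : IsEllipseData a b E) :
    IntegralWellDefinedOn (fun σ => jacobiDn (ellipseModulus a b) σ ^ 2)
      (jacobiDomain (ellipseModulus a b)) ∧
    ∀ u ∈ jacobiDomain (ellipseModulus a b), integralFromZero
      (fun σ => jacobiDn (ellipseModulus a b) σ ^ 2) (jacobiDomain (ellipseModulus a b)) u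
      = E u := by
  have hs := h.system
  have := integralWellDefinedOn_of_primitive hs.isOpen_jacobiDomain
    hs.countable_compl_jacobiDomain (hs.mem_jacobiDomain.2 hs.analyticAt_zero)
    (f := fun σ => jacobiDn (ellipseModulus a b) σ ^ 2) (E := E)
    (fun u hu => ((hs.analyticAt_d
      (hs.mem_jacobiDomain.1 hu)).continuousAt.pow 2).continuousWithinAt)
    (fun u hu => (hs.identities (hs.mem_jacobiDomain.1 hu)).2.2.2.2.2)
  refine ⟨this.1, fun u hu => ?_⟩
  rw [this.2 u hu, hs.zero.2.2.2, sub_zero]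

lemma meromorphic (h : IsEllipseData a b E) :
    Meromorphic (fun σ => jacobiDn (ellipseModulus a b) σ ^ 2) := fun u =>
  (h.system.nf_d (mem_univ u)).meromorphicAt.pow 2

lemma residue (h : IsEllipseData a b E) (p : ℂ) :
    IsResidueAt (fun σ => jacobiDn (ellipseModulus a b) σ ^ 2) p 0 := by
  refine isResidueAt_zero_of_hasDerivAt (E := E) ?_
  filter_upwards [h.system.eventually_mem_jacobiDomain p] with z hz
  exact (h.system.identities (h.system.mem_jacobiDomain.1 hz)).2.2.2.2.2

lemma curve_eq (h : IsEllipseData a b E) {u : ℂ} (hu : u ∈ jacobiDomain (ellipseModulus a b)) :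
    ellipseCurve a b u = ![b * jacobiCn (ellipseModulus a b) u,
      a * jacobiSn (ellipseModulus a b) u, Complex.I * a * E u] := by
  rw [ellipseCurve, ← h.integral.2 u hu]

/-- The derivative is `dn · (-b sn, a cn, i a dn)`, and `a² dn² = b² sn² + a² cn²` by `a² e² = a² -
b²`. -/
lemma isIsotropicOn (h : IsEllipseData a b E) :
    IsIsotropicOn (ellipseCurve a b) (fun u => ![-(b * (jacobiSn (ellipseModulus a b) u *
      jacobiDn (ellipseModulus a b) u)), a * (jacobiCn (ellipseModulus a b) u *
      jacobiDn (ellipseModulus a b) u), Complex.I * a * jacobiDn (ellipseModulus a b) u ^ 2])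
      (jacobiDomain (ellipseModulus a b)) := by
  have hs := h.system
  refine ⟨hs.isOpen_jacobiDomain, fun u hu => ?_, fun u hu => ?_⟩
  · obtain ⟨-, -, e1, e2, -, -⟩ := hs.identities (hs.mem_jacobiDomain.1 hu)
    refine hasDerivAt_pi.2 fun i => ?_
    fin_cases i
    · exact (e2.const_mul (b : ℂ)).congr_deriv (by simp)
    · exact e1.const_mul (a : ℂ)
    · exact (h.integral.1.hasDerivAt u hu).const_mul (Complex.I * a)
  · obtain ⟨i1, i2, -⟩ := hs.identities (hs.mem_jacobiDomain.1 hu)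
    have hm := h.sq_modulus
    have hI := Complex.I_sq
    simp only [Matrix.cons_val]
    set e := ellipseModulus a b
    linear_combination (a : ℂ) ^ 2 * jacobiDn e u ^ 4 * hI - jacobiDn e u ^ 2 * (a : ℂ) ^ 2 * i2 +
      (a : ℂ) ^ 2 * jacobiDn e u ^ 2 * i1 + jacobiDn e u ^ 2 * jacobiSn e u ^ 2 * hm

lemma deriv_ne_zero_iff (h : IsEllipseData a b E) (u : ℂ) :
    (![-(b * (jacobiSn (ellipseModulus a b) u *
      jacobiDn (ellipseModulus a b) u)), a * (jacobiCn (ellipseModulus a b) u *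
      jacobiDn (ellipseModulus a b) u), Complex.I * a * jacobiDn (ellipseModulus a b) u ^ 2] :
      Fin 3 → ℂ) ≠ 0 ↔ jacobiDn (ellipseModulus a b) u ≠ 0 := by
  have ha : (a : ℂ) ≠ 0 := by exact_mod_cast h.pos_a.ne'
  rw [not_iff_not]
  constructor
  · intro h0
    have := congrFun h0 2
    simpa [ha] using this
  · intro h0
    ext i
    fin_cases i <;> simp [h0]

/-- At a zero of `dn` one has `e² sn² = 1` and `e² cn² = e² - 1 ≠ 0`, so `dn' = -e² sn cn ≠ 0`. -/
lemma eventually_ne_zero (h : IsEllipseData a b E) :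
    ∀ᶠ u in codiscreteWithin (jacobiDomain (ellipseModulus a b)),
      jacobiDn (ellipseModulus a b) u ≠ 0 := by
  have hs := h.system
  refine eventually_codiscreteWithin_ne_zero
    (fun u hu => (hs.identities (hs.mem_jacobiDomain.1 hu)).2.2.2.2.1) fun u hu h0 => ?_
  obtain ⟨i1, i2, -⟩ := hs.identities (hs.mem_jacobiDomain.1 hu)
  obtain ⟨⟨e0, e1⟩, -⟩ := ellipseModulus_mem h.pos_b h.lt
  have hm : (ellipseModulus a b : ℂ) ^ 2 - 1 ≠ 0 := by
    have : ellipseModulus a b ^ 2 - 1 ≠ 0 := by nlinarith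
    exact_mod_cast this
  intro hz
  rw [h0] at i2
  refine hm ?_
  set e := ellipseModulus a b
  linear_combination -(e : ℂ) ^ 2 * i1 + i2 - (e : ℂ) ^ 2 * jacobiCn e u ^ 2 * i2 -
    (e : ℂ) ^ 2 * jacobiSn e u * jacobiCn e u * hz

end IsEllipseData

end

lemma deriv_const_mul_cos (b : ℝ) (z : ℂ) :
    deriv (fun z : ℂ => b * Complex.cos z) z = -(b * Complex.sin z) := by
  simp

lemma deriv_const_mul_sin (a : ℝ) (z : ℂ) :
    deriv (fun z : ℂ => a * Complex.sin z) z = a * Complex.cos z := by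
  simp

lemma hasDerivWithinAt_csin {z : ℝ → ℂ} {z' : ℂ} {s : Set ℝ} {t : ℝ}
    (h : HasDerivWithinAt z z' s t) :
    HasDerivWithinAt (fun t => Complex.sin (z t)) (Complex.cos (z t) * z') s t :=
  ((Complex.hasDerivAt_sin (z t)).scomp_hasDerivWithinAt t h).congr_deriv (mul_comm _ _)

lemma hasDerivWithinAt_ccos {z : ℝ → ℂ} {z' : ℂ} {s : Set ℝ} {t : ℝ}
    (h : HasDerivWithinAt z z' s t) :
    HasDerivWithinAt (fun t => Complex.cos (z t)) (-Complex.sin (z t) * z') s t :=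
  ((Complex.hasDerivAt_cos (z t)).scomp_hasDerivWithinAt t h).congr_deriv (mul_comm _ _)

namespace IsEllipseData

variable {a b : ℝ} {E : ℂ → ℂ}

/-- Along a path `α` to `u`, the function `cn + i sn` has logarithmic derivative `i dn α'`, so it
equals `exp (i z)` for a `C¹` path `z` with `sin z = sn`, `cos z = cn`. The root is `w = a dn`, and
`w dz = a dn² du`. -/
lemma exists_bjorlingPath (h : IsEllipseData a b E) {u : ℂ}
    (hu : u ∈ jacobiDomain (ellipseModulus a b)) :
    ∃ z w, IsBjorlingPath (fun z => b * Complex.cos z) (fun z => a * Complex.sin z) 0 z w ∧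
      0 < (w 0).re ∧ Complex.sin (z 1) = jacobiSn (ellipseModulus a b) u ∧
      bjorlingValue (fun z => b * Complex.cos z) (fun z => a * Complex.sin z) z w =
        ellipseCurve a b u := by
  have hs := h.system
  rw [h.curve_eq hu]
  have hm := h.sq_modulus
  have hE := hs.zero
  obtain ⟨α, g, α0, α1, cg, hα, hD⟩ := hs.exists_path (hs.mem_jacobiDomain.1 hu)
  obtain ⟨e1, e2, e3, e4, c1, c2, c3⟩ := hs.hasDerivWithinAt_comp hα hD
  set e := ellipseModulus a b
  have c4 : ContinuousOn (fun t => jacobiDn e (α t) * g t) (Icc 0 1) := c3.mul cg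
  obtain ⟨z, z0, hz, hexp⟩ := exists_exp_eq_of_hasDerivWithinAt
    (P := fun t => jacobiCn e (α t) + Complex.I * jacobiSn e (α t))
    (ρ := fun t => Complex.I * (jacobiDn e (α t) * g t)) (by fun_prop)
    (fun t ht => ((e2 t ht).add ((e1 t ht).const_mul Complex.I)).congr_deriv (by
      linear_combination -(jacobiDn e (α t) * g t * jacobiSn e (α t)) * Complex.I_sq))
    (by simp [α0, hE.1, hE.2.1])
  have hz' : ∀ t ∈ Icc (0 : ℝ) 1, HasDerivWithinAt (fun t => -Complex.I * z t)
      (jacobiDn e (α t) * g t) (Icc 0 1) t := fun t ht =>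
    ((hz t ht).const_mul (-Complex.I)).congr_deriv (by
      linear_combination -(jacobiDn e (α t) * g t) * Complex.I_sq)
  have hcs : ∀ t ∈ Icc (0 : ℝ) 1, Complex.cos (-Complex.I * z t) = jacobiCn e (α t) ∧
      Complex.sin (-Complex.I * z t) = jacobiSn e (α t) := fun t ht => by
    have i1 := (hs.identities (hD t ht)).1
    have h1 : Complex.exp (-Complex.I * z t * Complex.I) =
        jacobiCn e (α t) + Complex.I * jacobiSn e (α t) := by
      rw [← hexp t ht]
      congr 1
      linear_combination -z t * Complex.I_sq
    have h2 : Complex.exp (-(-Complex.I * z t) * Complex.I) =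
        jacobiCn e (α t) - Complex.I * jacobiSn e (α t) := by
      rw [neg_mul, Complex.exp_neg, h1]
      refine inv_eq_of_mul_eq_one_right ?_
      linear_combination i1 - jacobiSn e (α t) ^ 2 * Complex.I_sq
    rw [Complex.cos, Complex.sin, h1, h2]
    refine ⟨by ring, ?_⟩
    linear_combination -jacobiSn e (α t) * Complex.I_sq
  have h11 : (1 : ℝ) ∈ Icc (0 : ℝ) 1 := right_mem_Icc.2 zero_le_one
  refine ⟨fun t => -Complex.I * z t, fun t => a * jacobiDn e (α t), ⟨?_, ?_, ?_, ?_⟩, ?_, ?_, ?_⟩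
  · exact contDiffOn_Icc_of_hasDerivWithinAt (c4) hz'
  · exact contDiffOn_Icc_of_hasDerivWithinAt (by fun_prop)
      fun t ht => (e3 t ht).const_mul (a : ℂ)
  · simp [z0]
  · intro t ht
    obtain ⟨i1, i2, -⟩ := hs.identities (hD t ht)
    rw [deriv_const_mul_cos, deriv_const_mul_sin, (hcs t ht).1, (hcs t ht).2]
    linear_combination (a : ℂ) ^ 2 * i2 - jacobiSn e (α t) ^ 2 * hm - (a : ℂ) ^ 2 * i1
  · simpa [α0, hE.2.2.1] using h.pos_a
  · rw [(hcs 1 h11).2, α1]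
  · rw [bjorlingValue, (hcs 1 h11).1, (hcs 1 h11).2, integral_mul_derivWithin
      (Φ := fun t => a * E (α t)) (by fun_prop) (c4) hz' fun t ht =>
        ((e4 t ht).const_mul (a : ℂ)).congr_deriv (by ring)]
    simp only [α1, α0, hE.2.2.2, mul_zero, sub_zero, mul_assoc]

/-- The triple `(sin z, cos z, w/a)` is a path on the Jacobi curve. The positive real part fixes `w
0 = a`, so it starts at `(0, 1, 1)` and `lifting` applies. -/
lemma exists_parameter (h : IsEllipseData a b E) {z w : ℝ → ℂ}
    (hzw : IsBjorlingPath (fun z => b * Complex.cos z) (fun z => a * Complex.sin z) 0 z w)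
    (hw : 0 < (w 0).re) :
    ∃ u ∈ jacobiDomain (ellipseModulus a b),
      Complex.sin (z 1) = jacobiSn (ellipseModulus a b) u ∧
      bjorlingValue (fun z => b * Complex.cos z) (fun z => a * Complex.sin z) z w =
        ellipseCurve a b u := by
  have hs := h.system
  have hm := h.sq_modulus
  have hE := hs.zero
  have ha : (a : ℂ) ≠ 0 := by exact_mod_cast h.pos_a.ne'
  have hb : (b : ℂ) ≠ 0 := by exact_mod_cast h.pos_b.ne'
  obtain ⟨hz, cz⟩ := hzw.contDiffOn_z.hasDerivWithinAt_Icc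
  obtain ⟨hw', cw⟩ := hzw.contDiffOn_w.hasDerivWithinAt_Icc
  have h00 : (0 : ℝ) ∈ Icc (0 : ℝ) 1 := left_mem_Icc.2 zero_le_one
  have h11 : (1 : ℝ) ∈ Icc (0 : ℝ) 1 := right_mem_Icc.2 zero_le_one
  have hsq : ∀ t ∈ Icc (0 : ℝ) 1,
      w t ^ 2 = b ^ 2 * Complex.sin (z t) ^ 2 + a ^ 2 * Complex.cos (z t) ^ 2 := fun t ht => by
    rw [hzw.sq_eq t ht, deriv_const_mul_cos, deriv_const_mul_sin]
    ring
  have hw0 : w 0 = a := by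
    refine eq_of_sq_eq_of_re_pos h.pos_a ?_ hw
    rw [hsq 0 h00, hzw.source]
    simp
  have kz : ContinuousOn z (Icc 0 1) := hzw.contDiffOn_z.continuousOn
  have kw : ContinuousOn w (Icc 0 1) := hzw.contDiffOn_w.continuousOn
  set e := ellipseModulus a b with he
  have he1 : (1 : ℂ) - e ^ 2 ≠ 0 := fun h0 => hb (pow_eq_zero_iff two_ne_zero |>.1 (by
    linear_combination hm + (a : ℂ) ^ 2 * h0))
  set z' := derivWithin z (Icc 0 1)
  set w' := derivWithin w (Icc 0 1)
  obtain ⟨α, g, cg, α0, hα, hl, hY⟩ := hs.lifting he1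
    (S := fun t => Complex.sin (z t)) (C := fun t => Complex.cos (z t)) (W := fun t => w t / a)
    (S' := fun t => Complex.cos (z t) * z' t) (C' := fun t => -Complex.sin (z t) * z' t)
    (W' := fun t => w' t / a) (fun t ht => hasDerivWithinAt_csin (hz t ht))
    (fun t ht => hasDerivWithinAt_ccos (hz t ht))
    (fun t ht => (hw' t ht).div_const _) (by fun_prop) (by fun_prop) (by fun_prop)
    (fun t ht => Complex.sin_sq_add_cos_sq _)
    (fun t ht => by
      have := hsq t ht
      have h1 := Complex.sin_sq_add_cos_sq (z t)
      field_simp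
      linear_combination this + Complex.sin (z t) ^ 2 * hm + (a : ℂ) ^ 2 * h1)
    (by simp [hzw.source]) (by simp [hzw.source]) (by simp [hw0, ha])
  -- The derivatives of `sin z` and `cos z` are combined with weights `cos z` and `-sin z`, so that
  -- a zero of either one does no harm.
  have hz'g : ∀ t ∈ Icc (0 : ℝ) 1, z' t = w t / a * g t := fun t ht => by
    obtain ⟨l1, l2, -⟩ := hl t ht
    have h1 := Complex.sin_sq_add_cos_sq (z t)
    linear_combination Complex.cos (z t) * l1 - Complex.sin (z t) * l2 +
      (w t / a * g t - z' t) * h1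
  obtain ⟨-, -, -, e4, -⟩ := hs.hasDerivWithinAt_comp hα fun t ht => (hY t ht).1
  have hu := hs.mem_jacobiDomain.2 (hY 1 h11).1
  refine ⟨α 1, hu, (hY 1 h11).2.1, ?_⟩
  rw [h.curve_eq hu, bjorlingValue, integral_mul_derivWithin
      (Φ := fun t => a * E (α t)) kw cz hz fun t ht =>
        ((e4 t ht).const_mul (a : ℂ)).congr_deriv (by
          rw [hz'g t ht, ← (hY t ht).2.2.2]
          field_simp)]
  have y1 : Complex.sin (z 1) = jacobiSn e (α 1) := (hY 1 h11).2.1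
  have y2 : Complex.cos (z 1) = jacobiCn e (α 1) := (hY 1 h11).2.2.1
  simp only [y1, y2, α0, hE.2.2.2, mul_zero, sub_zero, mul_assoc]
  rfl

lemma image_ellipticalCatenoid (h : IsEllipseData a b E) :
    ellipticalCatenoid a b '' jacobiDomain (ellipseModulus a b) =
      bjorlingSurface (fun z => b * Complex.cos z) (fun z => a * Complex.sin z) 0 := by
  ext q
  constructor
  · rintro ⟨u, hu, rfl⟩
    obtain ⟨z, w, h1, h2, -, h4⟩ := h.exists_bjorlingPath hu
    exact ⟨z, w, h1, h2, by rw [h4, ellipticalCatenoid]⟩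
  · rintro ⟨z, w, h1, h2, rfl⟩
    obtain ⟨u, hu, -, h4⟩ := h.exists_parameter h1 h2
    exact ⟨u, hu, by rw [h4, ellipticalCatenoid]⟩

lemma image_ellipticalHelicoid (h : IsEllipseData a b E) :
    ellipticalHelicoid a b '' jacobiDomain (ellipseModulus a b) =
      conjugateBjorlingSurface (fun z => b * Complex.cos z) (fun z => a * Complex.sin z) 0 := by
  ext q
  constructor
  · rintro ⟨u, hu, rfl⟩
    obtain ⟨z, w, h1, h2, -, h4⟩ := h.exists_bjorlingPath hu
    exact ⟨z, w, h1, h2, by rw [h4, ellipticalHelicoid]⟩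
  · rintro ⟨z, w, h1, h2, rfl⟩
    obtain ⟨u, hu, -, h4⟩ := h.exists_parameter h1 h2
    exact ⟨u, hu, by rw [h4, ellipticalHelicoid]⟩

end IsEllipseData

lemma exists_cos_sin_eq {x y : ℝ} (h : x ^ 2 + y ^ 2 = 1) :
    ∃ θ : ℝ, Real.cos θ = x ∧ Real.sin θ = y := by
  have hn : ‖(⟨x, y⟩ : ℂ)‖ = 1 := by
    rw [Complex.norm_def, Complex.normSq_mk, Real.sqrt_eq_one]
    linarith
  refine ⟨Complex.arg ⟨x, y⟩, ?_, ?_⟩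
  · rw [Complex.cos_arg (norm_ne_zero_iff.1 (by rw [hn]; exact one_ne_zero)), hn, div_one]
  · rw [Complex.sin_arg, hn, div_one]

lemma im_eq_zero_of_star_eq {z : ℂ} (h : z = star z) : z.im = 0 :=
  Complex.conj_eq_iff_im.1 h.symm

namespace IsEllipseData

variable {a b : ℝ} {E : ℂ → ℂ}

lemma ellipticalCatenoid_eq (h : IsEllipseData a b E) {u : ℂ}
    (hu : u ∈ jacobiDomain (ellipseModulus a b)) (i : Fin 3) :
    ellipticalCatenoid a b u i = (![b * jacobiCn (ellipseModulus a b) u,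
      a * jacobiSn (ellipseModulus a b) u, Complex.I * a * E u] i).re := by
  rw [← h.curve_eq hu]
  rfl

lemma isMinimalSurfaceOn_ellipticalCatenoid (h : IsEllipseData a b E) :
    IsMinimalSurfaceOn (ellipticalCatenoid a b) (jacobiDomain (ellipseModulus a b)) :=
  h.isIsotropicOn.isMinimalSurfaceOn
    (h.eventually_ne_zero.mono fun u hu => (h.deriv_ne_zero_iff u).2 hu)

lemma isMinimalSurfaceOn_ellipticalHelicoid (h : IsEllipseData a b E) :
    IsMinimalSurfaceOn (ellipticalHelicoid a b) (jacobiDomain (ellipseModulus a b)) := by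
  rw [show ellipticalHelicoid a b = fun u => reVec (-Complex.I • ellipseCurve a b u) from
    funext fun u => imVec_eq_reVec _]
  exact h.isIsotropicOn.neg_I_smul.isMinimalSurfaceOn (h.eventually_ne_zero.mono fun u hu =>
    smul_ne_zero (neg_ne_zero.2 Complex.I_ne_zero) ((h.deriv_ne_zero_iff u).2 hu))

lemma injective_fderiv_iff (h : IsEllipseData a b E) {u : ℂ}
    (hu : u ∈ jacobiDomain (ellipseModulus a b)) :
    Function.Injective (fderiv ℝ (ellipticalCatenoid a b) u) ↔
      jacobiDn (ellipseModulus a b) u ≠ 0 :=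
  (h.isIsotropicOn.injective_fderiv_iff hu).trans (h.deriv_ne_zero_iff u)

lemma real_axis (h : IsEllipseData a b E) :
    ∃ F : ℝ → ℝ, Function.Surjective F ∧ ∀ x : ℝ,
      (F x : ℂ) ∈ jacobiDomain (ellipseModulus a b) ∧
      jacobiSn (ellipseModulus a b) (F x) = Real.sin x ∧
      jacobiCn (ellipseModulus a b) (F x) = Real.cos x ∧
      (∃ r : ℝ, r ≠ 0 ∧ jacobiDn (ellipseModulus a b) (F x) = r) ∧ (E (F x)).im = 0 := by
  obtain ⟨⟨e0, e1⟩, -⟩ := ellipseModulus_mem h.pos_b h.lt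
  obtain ⟨F, hF, hx⟩ := h.system.real_axis e0 e1
  refine ⟨F, hF, fun x => ⟨h.system.mem_jacobiDomain.2 (hx x).1, (hx x).2.1, (hx x).2.2.1,
    ⟨_, ?_, (hx x).2.2.2⟩, ?_⟩⟩
  · exact (Real.sqrt_pos.2 (one_sub_sq_mul_pos e0 e1 (Real.sin_sq_le_one x))).ne'
  -- On the real axis `E` is real, so the third coordinate `Re (i a E)` vanishes.
  · have := (h.system.conj (hx x).1).2.2.2.2
    rw [Complex.star_def, Complex.conj_ofReal] at this
    exact im_eq_zero_of_star_eq this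

lemma ofReal_mem (h : IsEllipseData a b E) (t : ℝ) :
    (t : ℂ) ∈ jacobiDomain (ellipseModulus a b) := by
  obtain ⟨F, hF, hx⟩ := h.real_axis
  obtain ⟨x, rfl⟩ := hF t
  exact (hx x).1

lemma range_real_axis (h : IsEllipseData a b E) :
    range (fun t : ℝ => ellipticalCatenoid a b t) =
      {q : E3 | q 0 ^ 2 / b ^ 2 + q 1 ^ 2 / a ^ 2 = 1 ∧ q 2 = 0} := by
  obtain ⟨F, hF, hx⟩ := h.real_axis
  have ha := h.pos_a.ne'
  have hb := h.pos_b.ne'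
  have hval : ∀ x : ℝ, ellipticalCatenoid a b (F x) 0 = b * Real.cos x ∧
      ellipticalCatenoid a b (F x) 1 = a * Real.sin x ∧
      ellipticalCatenoid a b (F x) 2 = 0 := fun x => by
    obtain ⟨h1, h2, h3, -, h5⟩ := hx x
    have key := h.ellipticalCatenoid_eq h1
    rw [h2, h3] at key
    refine ⟨(key 0).trans ?_, (key 1).trans ?_, (key 2).trans ?_⟩
    · exact Complex.re_ofReal_mul _ _
    · exact Complex.re_ofReal_mul _ _
    · simp [h5]
  ext q
  constructor
  · rintro ⟨t, rfl⟩
    obtain ⟨x, rfl⟩ := hF t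
    obtain ⟨h0, h1, h2⟩ := hval x
    refine ⟨?_, h2⟩
    simp only [h0, h1]
    have := Real.sin_sq_add_cos_sq x
    field_simp
    linarith
  · rintro ⟨h1, h2⟩
    obtain ⟨x, hc, hs⟩ := exists_cos_sin_eq (x := q 0 / b) (y := q 1 / a) (by
      rw [div_pow, div_pow, h1])
    refine ⟨F x, ?_⟩
    obtain ⟨k0, k1, k2⟩ := hval x
    ext i
    fin_cases i
    · refine k0.trans ?_
      rw [hc]
      exact mul_div_cancel₀ _ hb
    · refine k1.trans ?_
      rw [hs]
      exact mul_div_cancel₀ _ ha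
    · exact k2.trans h2.symm

lemma isPregeodesicAt (h : IsEllipseData a b E) (t : ℝ) :
    IsPregeodesicAt (ellipticalCatenoid a b) (fun s => (s : ℂ)) t := by
  obtain ⟨F, hF, hx⟩ := h.real_axis
  have hreal : ∀ t : ℝ, ∃ p q r : ℝ, r ≠ 0 ∧ jacobiSn (ellipseModulus a b) t = p ∧
      jacobiCn (ellipseModulus a b) t = q ∧ jacobiDn (ellipseModulus a b) t = r := fun t => by
    obtain ⟨x, rfl⟩ := hF t
    obtain ⟨-, h2, h3, ⟨r, hr, h4⟩, -⟩ := hx x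
    exact ⟨_, _, r, hr, h2, h3, h4⟩
  obtain ⟨p, q, r, hr, hp, hq, hr'⟩ := hreal t
  refine h.isIsotropicOn.isPregeodesicAt (v := 1) (fun s => Complex.ofRealCLM.hasDerivAt)
    (h.ofReal_mem t) one_ne_zero ((h.deriv_ne_zero_iff t).2 ?_) ?_ ?_ fun s _ => ?_
  · rw [hr']
    exact_mod_cast hr
  · simp [hp, hr']
  · simp [hq, hr']
  · obtain ⟨p, q, r, -, -, -, hr'⟩ := hreal s
    simp [hr', pow_two]

end IsEllipseData

/-! ## The hyperbola -/

lemma hyperbolaModulus_mem {a b : ℝ} (ha : 0 < a) (hb : 0 < b) :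
    (0 < hyperbolaModulus a b ∧ hyperbolaModulus a b < 1) ∧
      hyperbolaModulus a b ^ 2 * (a ^ 2 + b ^ 2) = a ^ 2 := by
  have hpos : 0 < a ^ 2 + b ^ 2 := by positivity
  have hsq := Real.sqrt_pos.2 hpos
  refine ⟨⟨div_pos ha hsq, (div_lt_one hsq).2 (Real.lt_sqrt_of_sq_lt (by nlinarith))⟩, ?_⟩
  rw [hyperbolaModulus, div_pow, Real.sq_sqrt hpos.le]
  field_simp

lemma deriv_const_mul_cosh (b : ℝ) (z : ℂ) :
    deriv (fun z : ℂ => b * Complex.cosh z) z = b * Complex.sinh z := by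
  simp

lemma deriv_const_mul_sinh (a : ℝ) (z : ℂ) :
    deriv (fun z : ℂ => a * Complex.sinh z) z = a * Complex.cosh z := by
  simp

lemma hasDerivWithinAt_csinh {z : ℝ → ℂ} {z' : ℂ} {s : Set ℝ} {t : ℝ}
    (h : HasDerivWithinAt z z' s t) :
    HasDerivWithinAt (fun t => Complex.sinh (z t)) (Complex.cosh (z t) * z') s t :=
  ((Complex.hasDerivAt_sinh (z t)).scomp_hasDerivWithinAt t h).congr_deriv (mul_comm _ _)

lemma hasDerivWithinAt_ccosh {z : ℝ → ℂ} {z' : ℂ} {s : Set ℝ} {t : ℝ}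
    (h : HasDerivWithinAt z z' s t) :
    HasDerivWithinAt (fun t => Complex.cosh (z t)) (Complex.sinh (z t) * z') s t :=
  ((Complex.hasDerivAt_cosh (z t)).scomp_hasDerivWithinAt t h).congr_deriv (mul_comm _ _)

/-- The hypotheses on the data of the hyperbola. -/
structure IsHyperbolaData (a b k : ℝ) (E : ℂ → ℂ) : Prop where
  pos_a : 0 < a
  pos_b : 0 < b
  modulus : k = hyperbolaModulus a b
  system : IsJacobiSystem k (jacobiSn k) (jacobiCn k) (jacobiDn k) E

namespace IsHyperbolaData

variable {a b k : ℝ} {E : ℂ → ℂ}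

lemma pos_k (h : IsHyperbolaData a b k E) : 0 < k :=
  h.modulus ▸ (hyperbolaModulus_mem h.pos_a h.pos_b).1.1

lemma ofReal_ne_zero (h : IsHyperbolaData a b k E) : (k : ℂ) ≠ 0 := by
  exact_mod_cast h.pos_k.ne'

lemma lt_one (h : IsHyperbolaData a b k E) : k < 1 :=
  h.modulus ▸ (hyperbolaModulus_mem h.pos_a h.pos_b).1.2

lemma one_sub_sq_ne_zero (h : IsHyperbolaData a b k E) : (1 : ℂ) - k ^ 2 ≠ 0 := by
  have : 1 - k ^ 2 ≠ 0 := by nlinarith [h.pos_k, h.lt_one]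
  exact_mod_cast this

lemma sq_modulus (h : IsHyperbolaData a b k E) :
    (k : ℂ) ^ 2 * ((a : ℂ) ^ 2 + (b : ℂ) ^ 2) = (a : ℂ) ^ 2 := by
  have := (hyperbolaModulus_mem h.pos_a h.pos_b).2
  rw [← h.modulus] at this
  exact_mod_cast this

lemma mem_domain (h : IsHyperbolaData a b k E) {u : ℂ} :
    u ∈ hyperbolaDomain a b ↔ AnalyticAt ℂ (jacobiSn k) (u / k) := by
  rw [← h.system.mem_jacobiDomain, hyperbolaDomain, ← h.modulus]
  rfl

lemma isOpen_domain (h : IsHyperbolaData a b k E) : IsOpen (hyperbolaDomain a b) := by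
  rw [show hyperbolaDomain a b = (fun u : ℂ => u / k) ⁻¹' {v | AnalyticAt ℂ (jacobiSn k) v} from
    Set.ext fun u => h.mem_domain]
  exact (isOpen_analyticAt ℂ _).preimage (by fun_prop)

lemma countable_compl_domain (h : IsHyperbolaData a b k E) : (hyperbolaDomain a b)ᶜ.Countable := by
  rw [show (hyperbolaDomain a b)ᶜ = (fun u : ℂ => u / k) ⁻¹' {v | AnalyticAt ℂ (jacobiSn k) v}ᶜ from
    Set.ext fun u => not_congr h.mem_domain]
  exact h.system.countable_compl.preimage fun x y hxy =>
    (div_left_inj' h.ofReal_ne_zero).1 hxy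

lemma hasDerivAt_comp_div {k : ℝ} {f : ℂ → ℂ} {f' u : ℂ}
    (hf : HasDerivAt f f' (u / k)) : HasDerivAt (fun u => f (u / k)) (f' / k) u :=
  (hf.comp u ((hasDerivAt_id u).div_const (k : ℂ))).congr_deriv (by
    rw [mul_one_div])

/-- `k² cn² = dn² - (1 - k²)` expresses the primitive through `E` and a linear term. -/
lemma hasDerivAt_primitive (h : IsHyperbolaData a b k E) {u : ℂ}
    (hu : AnalyticAt ℂ (jacobiSn k) (u / k)) :
    HasDerivAt (fun u => (E (u / k) - (1 - k ^ 2) * (u / k)) / k) (jacobiCn k (u / k) ^ 2) u := by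
  obtain ⟨i1, i2, -, -, -, e4⟩ := h.system.identities hu
  have hk := h.ofReal_ne_zero
  refine (((hasDerivAt_comp_div e4).sub
    (((hasDerivAt_id u).div_const (k : ℂ)).const_mul (1 - (k : ℂ) ^ 2))).div_const
      (k : ℂ)).congr_deriv ?_
  field_simp
  linear_combination i2 - (k : ℂ) ^ 2 * i1

lemma integral (h : IsHyperbolaData a b k E) :
    IntegralWellDefinedOn (fun σ => jacobiCn k (σ / k) ^ 2) (hyperbolaDomain a b) ∧
    ∀ u ∈ hyperbolaDomain a b, integralFromZero (fun σ => jacobiCn k (σ / k) ^ 2)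
      (hyperbolaDomain a b) u = (E (u / k) - (1 - k ^ 2) * (u / k)) / k := by
  have hs := h.system
  have := integralWellDefinedOn_of_primitive h.isOpen_domain h.countable_compl_domain
    (h.mem_domain.2 (by simpa using hs.analyticAt_zero))
    (f := fun σ => jacobiCn k (σ / k) ^ 2)
    (E := fun u => (E (u / k) - (1 - k ^ 2) * (u / k)) / k)
    (fun u hu => by
      have := (hs.analyticAt_c (h.mem_domain.1 hu)).continuousAt
      exact ((this.comp (f := fun u : ℂ => u / k) (by fun_prop)).pow 2).continuousWithinAt)
    (fun u hu => h.hasDerivAt_primitive (h.mem_domain.1 hu))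
  refine ⟨this.1, fun u hu => ?_⟩
  rw [this.2 u hu]
  simp [hs.zero.2.2.2]

lemma meromorphic (h : IsHyperbolaData a b k E) :
    Meromorphic (fun σ => jacobiCn k (σ / k) ^ 2) := fun u => by
  have h1 : MeromorphicAt (jacobiCn k) (u / k) := (h.system.nf_c (mem_univ _)).meromorphicAt
  exact (h1.comp_analyticAt (g := fun u : ℂ => u / k) (by fun_prop)).pow 2

lemma residue (h : IsHyperbolaData a b k E) (p : ℂ) :
    IsResidueAt (fun σ => jacobiCn k (σ / k) ^ 2) p 0 := by
  refine isResidueAt_zero_of_hasDerivAt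
    (E := fun u => (E (u / k) - (1 - k ^ 2) * (u / k)) / k) ?_
  have ht : Tendsto (fun u : ℂ => u / k) (𝓝[≠] p) (𝓝[≠] (p / k)) :=
    (continuous_id.div_const (k : ℂ)).continuousWithinAt.tendsto_nhdsWithin
      fun u hu hup => hu ((div_left_inj' h.ofReal_ne_zero).1 hup)
  filter_upwards [ht.eventually (h.system.eventually_mem_jacobiDomain (p / k))] with z hz
  exact h.hasDerivAt_primitive (h.system.mem_jacobiDomain.1 hz)

lemma curve_eq (h : IsHyperbolaData a b k E) {u : ℂ} (hu : u ∈ hyperbolaDomain a b) :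
    hyperbolaCurve a b u = ![b * jacobiDn k (u / k), Complex.I * a * k * jacobiSn k (u / k),
      a * ((E (u / k) - (1 - k ^ 2) * (u / k)) / k)] := by
  rw [hyperbolaCurve, ← h.modulus, ← h.integral.2 u hu]

/-- The derivative is `cn · (-b k sn, i a dn, a cn)`; isotropy reduces to `k² (a² + b²) = a²`. -/
lemma isIsotropicOn (h : IsHyperbolaData a b k E) :
    IsIsotropicOn (hyperbolaCurve a b) (fun u => ![-(b * k * (jacobiSn k (u / k) *
      jacobiCn k (u / k))), Complex.I * a * (jacobiCn k (u / k) * jacobiDn k (u / k)),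
      a * jacobiCn k (u / k) ^ 2]) (hyperbolaDomain a b) := by
  have hs := h.system
  have hk := h.ofReal_ne_zero
  refine ⟨h.isOpen_domain, fun u hu => ?_, fun u hu => ?_⟩
  · obtain ⟨-, -, e1, -, e3, -⟩ := hs.identities (h.mem_domain.1 hu)
    have e4 := h.integral.1.hasDerivAt u hu
    unfold hyperbolaCurve
    rw [← h.modulus]
    refine hasDerivAt_pi.2 fun i => ?_
    fin_cases i
    · refine ((hasDerivAt_comp_div e3).const_mul (b : ℂ)).congr_deriv ?_
      simp only [Fin.zero_eta, Matrix.cons_val]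
      field_simp
    · refine ((hasDerivAt_comp_div e1).const_mul (Complex.I * a * k)).congr_deriv ?_
      simp only [Fin.mk_one, Matrix.cons_val]
      field_simp
    · exact e4.const_mul (a : ℂ)
  · obtain ⟨i1, i2, -⟩ := hs.identities (h.mem_domain.1 hu)
    have hm := h.sq_modulus
    have hI := Complex.I_sq
    simp only [Matrix.cons_val]
    set s := jacobiSn k (u / k)
    set c := jacobiCn k (u / k)
    set d := jacobiDn k (u / k)
    linear_combination (a : ℂ) ^ 2 * c ^ 2 * d ^ 2 * hI - c ^ 2 * (a : ℂ) ^ 2 * i2 +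
      (a : ℂ) ^ 2 * c ^ 2 * i1 + c ^ 2 * s ^ 2 * hm

lemma deriv_ne_zero_iff (h : IsHyperbolaData a b k E) (u : ℂ) :
    (![-(b * k * (jacobiSn k (u / k) * jacobiCn k (u / k))),
      Complex.I * a * (jacobiCn k (u / k) * jacobiDn k (u / k)),
      a * jacobiCn k (u / k) ^ 2] : Fin 3 → ℂ) ≠ 0 ↔ jacobiCn k (u / k) ≠ 0 := by
  have ha : (a : ℂ) ≠ 0 := by exact_mod_cast h.pos_a.ne'
  rw [not_iff_not]
  constructor
  · intro h0
    have := congrFun h0 2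
    simpa [ha] using this
  · intro h0
    ext i
    fin_cases i <;> simp [h0]

/-- At a zero of `cn` one has `sn² = 1` and `dn² = 1 - k² ≠ 0`, so the derivative of `cn` does not
vanish. -/
lemma eventually_ne_zero (h : IsHyperbolaData a b k E) :
    ∀ᶠ u in codiscreteWithin (hyperbolaDomain a b), jacobiCn k (u / k) ≠ 0 := by
  have hs := h.system
  refine eventually_codiscreteWithin_ne_zero (fun u hu =>
    hasDerivAt_comp_div (hs.identities (h.mem_domain.1 hu)).2.2.2.1) fun u hu h0 => ?_
  obtain ⟨i1, i2, -⟩ := hs.identities (h.mem_domain.1 hu)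
  refine div_ne_zero (neg_ne_zero.2 fun hz => h.one_sub_sq_ne_zero ?_) h.ofReal_ne_zero
  rw [h0] at i1
  set s := jacobiSn k (u / k)
  set d := jacobiDn k (u / k)
  linear_combination (k : ℂ) ^ 2 * i1 - i2 - d ^ 2 * i1 + s * d * hz

lemma isMinimalSurfaceOn_hyperbolaSurface (h : IsHyperbolaData a b k E) :
    IsMinimalSurfaceOn (hyperbolaSurface a b) (hyperbolaDomain a b) :=
  h.isIsotropicOn.isMinimalSurfaceOn
    (h.eventually_ne_zero.mono fun u hu => (h.deriv_ne_zero_iff u).2 hu)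

lemma isMinimalSurfaceOn_hyperbolaConjugate (h : IsHyperbolaData a b k E) :
    IsMinimalSurfaceOn (hyperbolaConjugate a b) (hyperbolaDomain a b) := by
  rw [show hyperbolaConjugate a b = fun u => reVec (-Complex.I • hyperbolaCurve a b u) from
    funext fun u => imVec_eq_reVec _]
  exact h.isIsotropicOn.neg_I_smul.isMinimalSurfaceOn (h.eventually_ne_zero.mono fun u hu =>
    smul_ne_zero (neg_ne_zero.2 Complex.I_ne_zero) ((h.deriv_ne_zero_iff u).2 hu))

lemma injective_fderiv_iff (h : IsHyperbolaData a b k E) {u : ℂ}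
    (hu : u ∈ hyperbolaDomain a b) :
    Function.Injective (fderiv ℝ (hyperbolaSurface a b) u) ↔ jacobiCn k (u / k) ≠ 0 :=
  (h.isIsotropicOn.injective_fderiv_iff hu).trans (h.deriv_ne_zero_iff u)

/-- Here `exp z = dn + i k sn`, with logarithmic derivative `i k cn α'`, and the root is `w = -a
cn`. The sign makes `i w dz = a k cn² dα`, which is why this parameterization carries the negative
root. -/
lemma exists_bjorlingPath (h : IsHyperbolaData a b k E) {u : ℂ} (hu : u ∈ hyperbolaDomain a b) :
    ∃ z w, IsBjorlingPath (fun z => b * Complex.cosh z) (fun z => a * Complex.sinh z) 0 z w ∧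
      (w 0).re < 0 ∧ Complex.sinh (z 1) = Complex.I * k * jacobiSn k (u / k) ∧
      bjorlingValue (fun z => b * Complex.cosh z) (fun z => a * Complex.sinh z) z w =
        hyperbolaCurve a b u := by
  have hs := h.system
  rw [h.curve_eq hu]
  have hm := h.sq_modulus
  have hE := hs.zero
  have hI := Complex.I_sq
  have hk := h.ofReal_ne_zero
  obtain ⟨α, g, α0, α1, cg, hα, hD⟩ := hs.exists_path (h.mem_domain.1 hu)
  obtain ⟨e1, e2, e3, e4, c1, c2, c3⟩ := hs.hasDerivWithinAt_comp hα hD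
  have c4 : ContinuousOn (fun t => Complex.I * k * (jacobiCn k (α t) * g t)) (Icc 0 1) := by
    fun_prop
  obtain ⟨z, z0, hz, hexp⟩ := exists_exp_eq_of_hasDerivWithinAt
    (P := fun t => jacobiDn k (α t) + Complex.I * k * jacobiSn k (α t)) c4
    (fun t ht => ((e3 t ht).add ((e1 t ht).const_mul (Complex.I * k))).congr_deriv (by
      linear_combination -(k ^ 2 * jacobiCn k (α t) * g t * jacobiSn k (α t)) * hI))
    (by simp [α0, hE.1, hE.2.2.1])
  have hcs : ∀ t ∈ Icc (0 : ℝ) 1, Complex.cosh (z t) = jacobiDn k (α t) ∧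
      Complex.sinh (z t) = Complex.I * k * jacobiSn k (α t) := fun t ht => by
    have i2 := (hs.identities (hD t ht)).2.1
    have h2 : Complex.exp (-z t) = jacobiDn k (α t) - Complex.I * k * jacobiSn k (α t) := by
      rw [Complex.exp_neg, hexp t ht]
      refine inv_eq_of_mul_eq_one_right ?_
      linear_combination i2 - k ^ 2 * jacobiSn k (α t) ^ 2 * hI
    rw [Complex.cosh, Complex.sinh, hexp t ht, h2]
    constructor <;> ring
  have h11 : (1 : ℝ) ∈ Icc (0 : ℝ) 1 := right_mem_Icc.2 zero_le_one
  refine ⟨z, fun t => -a * jacobiCn k (α t), ⟨?_, ?_, z0, ?_⟩, ?_, ?_, ?_⟩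
  · exact contDiffOn_Icc_of_hasDerivWithinAt c4 hz
  · exact contDiffOn_Icc_of_hasDerivWithinAt (by fun_prop)
      fun t ht => (e2 t ht).const_mul (-a : ℂ)
  · intro t ht
    obtain ⟨i1, i2, -⟩ := hs.identities (hD t ht)
    rw [deriv_const_mul_cosh, deriv_const_mul_sinh, (hcs t ht).1, (hcs t ht).2]
    linear_combination (a : ℂ) ^ 2 * i1 - (a : ℂ) ^ 2 * i2 + jacobiSn k (α t) ^ 2 * hm -
      b ^ 2 * k ^ 2 * jacobiSn k (α t) ^ 2 * hI
  · simpa [α0, hE.2.1] using h.pos_a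
  · rw [(hcs 1 h11).2, α1]
  · rw [bjorlingValue, (hcs 1 h11).1, (hcs 1 h11).2, integral_mul_derivWithin
      (Φ := fun t => -Complex.I * a * ((E (α t) - (1 - k ^ 2) * α t) / k)) (by fun_prop) c4 hz
        fun t ht => ?_]
    · simp only [α1, α0, hE.2.2.2, mul_zero, sub_zero, zero_div]
      refine Matrix.vec3_eq rfl (by ring) ?_
      linear_combination -(a * ((E (u / k) - (1 - k ^ 2) * (u / k)) / k)) * hI
    · obtain ⟨i1, i2, -⟩ := hs.identities (hD t ht)
      refine ((((e4 t ht).sub ((hα t ht).const_mul (1 - (k : ℂ) ^ 2))).div_const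
        (k : ℂ)).const_mul (-Complex.I * a)).congr_deriv ?_
      field_simp
      linear_combination -(a * g t) * i2 + a * g t * (k : ℂ) ^ 2 * i1

/-- Compared with the ellipse the roles are exchanged: the root `-w/a` plays `cn` and `cosh z` plays
`dn`. The lift `α` lives in the variable `u / k`, so the parameter is `k α(1)`. -/
lemma exists_parameter (h : IsHyperbolaData a b k E) {z w : ℝ → ℂ}
    (hzw : IsBjorlingPath (fun z => b * Complex.cosh z) (fun z => a * Complex.sinh z) 0 z w)
    (hw : (w 0).re < 0) :
    ∃ u ∈ hyperbolaDomain a b,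
      Complex.sinh (z 1) = Complex.I * k * jacobiSn k (u / k) ∧
      bjorlingValue (fun z => b * Complex.cosh z) (fun z => a * Complex.sinh z) z w =
        hyperbolaCurve a b u := by
  have hs := h.system
  have hm := h.sq_modulus
  have hE := hs.zero
  have hI := Complex.I_sq
  have hk := h.ofReal_ne_zero
  have ha : (a : ℂ) ≠ 0 := by exact_mod_cast h.pos_a.ne'
  obtain ⟨hz, cz⟩ := hzw.contDiffOn_z.hasDerivWithinAt_Icc
  obtain ⟨hw', cw⟩ := hzw.contDiffOn_w.hasDerivWithinAt_Icc
  have h00 : (0 : ℝ) ∈ Icc (0 : ℝ) 1 := left_mem_Icc.2 zero_le_one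
  have h11 : (1 : ℝ) ∈ Icc (0 : ℝ) 1 := right_mem_Icc.2 zero_le_one
  have hsq : ∀ t ∈ Icc (0 : ℝ) 1,
      w t ^ 2 = b ^ 2 * Complex.sinh (z t) ^ 2 + a ^ 2 * Complex.cosh (z t) ^ 2 := fun t ht => by
    rw [hzw.sq_eq t ht, deriv_const_mul_cosh, deriv_const_mul_sinh]
    ring
  have hw0 : -w 0 = a := by
    refine eq_of_sq_eq_of_re_pos h.pos_a ?_ (by simpa using hw)
    rw [neg_sq, hsq 0 h00, hzw.source]
    simp
  have kz : ContinuousOn z (Icc 0 1) := hzw.contDiffOn_z.continuousOn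
  have kw : ContinuousOn w (Icc 0 1) := hzw.contDiffOn_w.continuousOn
  have hch : ∀ t, Complex.cosh (z t) ^ 2 - Complex.sinh (z t) ^ 2 = 1 := fun t =>
    Complex.cosh_sq_sub_sinh_sq _
  set z' := derivWithin z (Icc 0 1)
  set w' := derivWithin w (Icc 0 1)
  obtain ⟨α, g, cg, α0, hα, hl, hY⟩ := hs.lifting h.one_sub_sq_ne_zero
    (S := fun t => -Complex.I / k * Complex.sinh (z t)) (C := fun t => -w t / a)
    (W := fun t => Complex.cosh (z t))
    (S' := fun t => -Complex.I / k * (Complex.cosh (z t) * z' t)) (C' := fun t => -w' t / a)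
    (W' := fun t => Complex.sinh (z t) * z' t)
    (fun t ht => (hasDerivWithinAt_csinh (hz t ht)).const_mul _)
    (fun t ht => (hw' t ht).fun_neg.div_const _)
    (fun t ht => hasDerivWithinAt_ccosh (hz t ht)) (by fun_prop) (by fun_prop) (by fun_prop)
    (fun t ht => by
      have := hsq t ht
      have h1 := hch t
      field_simp
      linear_combination (k : ℂ) ^ 2 * this + Complex.sinh (z t) ^ 2 * hm +
        (a : ℂ) ^ 2 * (k : ℂ) ^ 2 * h1 + Complex.sinh (z t) ^ 2 * (a : ℂ) ^ 2 * hI)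
    (fun t ht => by
      have h1 := hch t
      field_simp
      linear_combination h1 + Complex.sinh (z t) ^ 2 * hI)
    (by simp [hzw.source]) (by simp [hw0, ha]) (by simp [hzw.source])
  -- The derivatives of `sinh z` and `cosh z` are combined through `cosh² - sinh² = 1`, again
  -- without dividing by either.
  have hz'g : ∀ t ∈ Icc (0 : ℝ) 1, z' t = Complex.I * k * (-w t / a) * g t := fun t ht => by
    obtain ⟨l1, -, l3⟩ := hl t ht
    have h1 := hch t
    have q1 : Complex.I * k * (-Complex.I / k) = 1 := by
      field_simp
      linear_combination -hI
    have q2 : k * (-Complex.I / k) = -Complex.I := by field_simp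
    generalize -Complex.I / (k : ℂ) = q at l1 l3 q1 q2
    generalize -w t / (a : ℂ) = c at l1 l3 ⊢
    linear_combination Complex.cosh (z t) * Complex.I * k * l1 - Complex.sinh (z t) * l3 -
      Complex.cosh (z t) ^ 2 * z' t * q1 + k * Complex.sinh (z t) ^ 2 * c * g t * q2 -
      (z' t - Complex.I * k * c * g t) * h1
  obtain ⟨-, -, -, e4, -⟩ := hs.hasDerivWithinAt_comp hα fun t ht => (hY t ht).1
  have hkα : k * α 1 / k = α 1 := mul_div_cancel_left₀ _ hk
  have hu : k * α 1 ∈ hyperbolaDomain a b := h.mem_domain.2 (hkα.symm ▸ (hY 1 h11).1)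
  have y1 : -Complex.I / k * Complex.sinh (z 1) = jacobiSn k (α 1) := (hY 1 h11).2.1
  have y2 : Complex.cosh (z 1) = jacobiDn k (α 1) := (hY 1 h11).2.2.2
  have y3 : Complex.sinh (z 1) = Complex.I * k * jacobiSn k (α 1) := by
    rw [← y1]
    field_simp
    linear_combination Complex.sinh (z 1) * hI
  refine ⟨k * α 1, hu, by rw [hkα, y3], ?_⟩
  rw [h.curve_eq hu, hkα, bjorlingValue, integral_mul_derivWithin
      (Φ := fun t => -Complex.I * a * ((E (α t) - (1 - k ^ 2) * α t) / k)) kw cz hz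
        fun t ht => ?_]
  · simp only [y2, y3, α0, hE.2.2.2, mul_zero, sub_zero, zero_div]
    refine Matrix.vec3_eq rfl (by ring) ?_
    linear_combination -(a * ((E (α 1) - (1 - k ^ 2) * α 1) / k)) * hI
  · obtain ⟨i1, i2, -⟩ := hs.identities (hY t ht).1
    have hc : -w t / a = jacobiCn k (α t) := (hY t ht).2.2.1
    have hwt : w t = -a * jacobiCn k (α t) := by
      rw [← hc]
      field_simp
    refine ((((e4 t ht).sub ((hα t ht).const_mul (1 - (k : ℂ) ^ 2))).div_const
      (k : ℂ)).const_mul (-Complex.I * a)).congr_deriv ?_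
    rw [hz'g t ht, hc, hwt, show g t * jacobiDn k (α t) ^ 2 - (1 - (k : ℂ) ^ 2) * g t =
      g t * (k ^ 2 * jacobiCn k (α t) ^ 2) by linear_combination g t * (i2 - k ^ 2 * i1)]
    field_simp

end IsHyperbolaData

lemma IsBjorlingPath.neg {x y : ℂ → ℂ} {p : ℂ} {z w : ℝ → ℂ} (h : IsBjorlingPath x y p z w) :
    IsBjorlingPath x y p z (fun t => -w t) :=
  ⟨h.contDiffOn_z, h.contDiffOn_w.neg, h.source, fun t ht => by rw [neg_sq, h.sq_eq t ht]⟩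

/-- Passing to the opposite root reflects the value in the plane of the first two coordinates. -/
lemma bjorlingValue_neg (x y : ℂ → ℂ) (z w : ℝ → ℂ) :
    bjorlingValue x y z (fun t => -w t) = ![bjorlingValue x y z w 0, bjorlingValue x y z w 1,
      -bjorlingValue x y z w 2] := by
  simp [bjorlingValue]

/-- If the values of `F` on `D` are the values of Björling's formula for the opposite root, and a
symmetry of `D` compensates for the sign of the third coordinate, then `F` parameterizes the
surface. -/
lemma image_eq_of_symmetry {x y : ℂ → ℂ} {q : ℂ} {F : ℂ → Fin 3 → ℂ} {D : Set ℂ}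
    {p : (Fin 3 → ℂ) → E3} {σ : ℂ → ℂ}
    (h1 : ∀ u ∈ D, ∃ z w, IsBjorlingPath x y q z w ∧ (w 0).re < 0 ∧ bjorlingValue x y z w = F u)
    (h2 : ∀ z w, IsBjorlingPath x y q z w → (w 0).re < 0 →
      ∃ u ∈ D, bjorlingValue x y z w = F u)
    (hσ : ∀ u ∈ D, σ u ∈ D) (hσσ : ∀ u, σ (σ u) = u)
    (hp : ∀ u ∈ D, p ![F (σ u) 0, F (σ u) 1, -F (σ u) 2] = p (F u)) :
    (fun u => p (F u)) '' D =
      {r | ∃ z w, IsBjorlingPath x y q z w ∧ 0 < (w 0).re ∧ r = p (bjorlingValue x y z w)} := by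
  ext r
  constructor
  · rintro ⟨u, hu, rfl⟩
    obtain ⟨z, w, hzw, hw, hv⟩ := h1 (σ u) (hσ u hu)
    refine ⟨z, _, hzw.neg, by simpa using hw, ?_⟩
    rw [bjorlingValue_neg, hv, hp u hu]
  · rintro ⟨z, w, hzw, hw, rfl⟩
    obtain ⟨u, hu, hv⟩ := h2 z _ hzw.neg (by simpa using hw)
    refine ⟨σ u, hσ u hu, ?_⟩
    have := bjorlingValue_neg x y z (fun t => -w t)
    simp only [neg_neg] at this
    rw [this, hv]
    simp only
    rw [← hp (σ u) (hσ u hu), hσσ]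

namespace IsHyperbolaData

variable {a b k : ℝ} {E : ℂ → ℂ}

/-- Under `u ↦ -ū` followed by the sign change of the third coordinate, the vector `F(u)` goes to
its complex conjugate, which has the same real part. -/
lemma image_hyperbolaSurface (h : IsHyperbolaData a b k E) :
    hyperbolaSurface a b '' hyperbolaDomain a b =
      bjorlingSurface (fun z => b * Complex.cosh z) (fun z => a * Complex.sinh z) 0 := by
  have hdiv : ∀ u : ℂ, -star u / k = -star (u / k) := fun u => by
    rw [Complex.star_def, map_div₀, Complex.conj_ofReal, neg_div]
  have hσ : ∀ u ∈ hyperbolaDomain a b, -star u ∈ hyperbolaDomain a b := fun u hu => by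
    rw [h.mem_domain, hdiv]
    exact (h.system.neg (h.system.conj (h.mem_domain.1 hu)).1).1
  refine image_eq_of_symmetry (σ := fun u => -star u) (p := reVec)
    (fun u hu => ?_) (fun z w h1 h2 => ?_) hσ (fun u => by simp) fun u hu => ?_
  · obtain ⟨z, w, h1, h2, -, h3⟩ := h.exists_bjorlingPath hu
    exact ⟨z, w, h1, h2, h3⟩
  · obtain ⟨u, hu, -, h3⟩ := h.exists_parameter h1 h2
    exact ⟨u, hu, h3⟩
  · obtain ⟨c0, c1, -, c3, c4⟩ := h.system.conj (h.mem_domain.1 hu)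
    obtain ⟨-, n1, -, n3, n4⟩ := h.system.neg c0
    rw [h.curve_eq hu, h.curve_eq (hσ u hu)]
    simp only [hdiv, n1, n3, n4, c1, c3, c4]
    simp only [Complex.star_def]
    generalize jacobiSn k (u / k) = S
    generalize jacobiDn k (u / k) = W
    have e2 : -(a * ((-(starRingEnd ℂ) (E (u / k)) - (1 - k ^ 2) *
        -(starRingEnd ℂ) (u / k)) / k)) =
        (starRingEnd ℂ) (a * ((E (u / k) - (1 - k ^ 2) * (u / k)) / k)) := by
      simp only [map_mul, map_div₀, map_sub, map_one, map_pow, Complex.conj_ofReal]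
      ring
    simp only [Matrix.cons_val]
    rw [e2]
    generalize (a : ℂ) * ((E (u / k) - (1 - k ^ 2) * (u / k)) / k) = X
    ext i
    fin_cases i <;> simp [reVec]

/-- Reflection in `kK`, with `K` the real quarter period, fixes `sn` and `dn` and sends `E` to `2
E(K) - E`. After the sign change the third coordinate has moved by a real constant, invisible to the
imaginary part. -/
lemma image_hyperbolaConjugate (h : IsHyperbolaData a b k E) :
    hyperbolaConjugate a b '' hyperbolaDomain a b =
      conjugateBjorlingSurface (fun z => b * Complex.cosh z) (fun z => a * Complex.sinh z) 0 := by
  have hk := h.ofReal_ne_zero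
  obtain ⟨G, -, hG⟩ := h.system.real_axis h.pos_k h.lt_one
  obtain ⟨hK, -, hcK, -⟩ := hG (Real.pi / 2)
  rw [Real.cos_pi_div_two, Complex.ofReal_zero] at hcK
  generalize G (Real.pi / 2) = K at hK hcK
  have hEK : ∃ r : ℝ, E K = r := by
    have := (h.system.conj hK).2.2.2.2
    rw [Complex.star_def, Complex.conj_ofReal] at this
    exact ⟨_, ((Complex.conj_eq_iff_re).1 this.symm).symm⟩
  obtain ⟨r, hr⟩ := hEK
  have hdiv : ∀ u : ℂ, (2 * k * K - u) / k = 2 * K - u / k := fun u => by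
    field_simp
  have hσ : ∀ u ∈ hyperbolaDomain a b, 2 * k * K - u ∈ hyperbolaDomain a b := fun u hu => by
    rw [h.mem_domain, hdiv]
    exact (h.system.reflect hK hcK (h.mem_domain.1 hu)).1
  refine image_eq_of_symmetry (σ := fun u => 2 * k * K - u) (p := imVec)
    (fun u hu => ?_) (fun z w h1 h2 => ?_) hσ (fun u => by ring) fun u hu => ?_
  · obtain ⟨z, w, h1, h2, -, h3⟩ := h.exists_bjorlingPath hu
    exact ⟨z, w, h1, h2, h3⟩
  · obtain ⟨u, hu, -, h3⟩ := h.exists_parameter h1 h2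
    exact ⟨u, hu, h3⟩
  · obtain ⟨-, n1, -, n3, n4⟩ := h.system.reflect hK hcK (h.mem_domain.1 hu)
    rw [h.curve_eq hu, h.curve_eq (hσ u hu)]
    simp only [hdiv, n1, n3, n4, hr]
    have e2 : -(a * ((2 * r - E (u / k) - (1 - k ^ 2) * (2 * K - u / k)) / k)) =
        a * ((E (u / k) - (1 - k ^ 2) * (u / k)) / k) -
          ((2 * a * (r - (1 - k ^ 2) * K) / k : ℝ) : ℂ) := by
      push_cast
      ring
    simp only [Matrix.cons_val]
    rw [e2]
    ext i
    fin_cases i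
    · simp [imVec]
    · simp [imVec]
    · simp only [imVec, Fin.reduceFinMk, Matrix.cons_val, Complex.sub_im, Complex.ofReal_im,
        sub_zero]

/-- On the imaginary axis conjugation is `v ↦ -v`, so the odd functions `sn`, `E` are imaginary and
the even ones `cn`, `dn` real. Moreover `cn² = 1 + x² > 0`. -/
lemma imaginary_axis_values (h : IsHyperbolaData a b k E) {v : ℂ} (hv : star v = -v)
    (hD : AnalyticAt ℂ (jacobiSn k) v) :
    ∃ x q r y : ℝ, jacobiSn k v = x * Complex.I ∧ jacobiCn k v = q ∧ jacobiDn k v = r ∧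
      E v = y * Complex.I ∧ q ≠ 0 ∧ r ^ 2 - k ^ 2 * x ^ 2 = 1 := by
  obtain ⟨-, c1, c2, c3, c4⟩ := h.system.conj hD
  obtain ⟨-, n1, n2, n3, n4⟩ := h.system.neg hD
  obtain ⟨i1, i2, -⟩ := h.system.identities hD
  rw [hv] at c1 c2 c3 c4
  rw [n1] at c1
  rw [n2] at c2
  rw [n3] at c3
  rw [n4] at c4
  have him : ∀ {z : ℂ}, -z = star z → z = z.im * Complex.I := fun {z} hz => by
    have := congrArg Complex.re hz
    rw [Complex.neg_re, Complex.star_def, Complex.conj_re] at this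
    apply Complex.ext
    · simp
      linarith
    · simp
  have hre : ∀ {z : ℂ}, z = star z → z = z.re := fun {z} hz =>
    (Complex.conj_eq_iff_re.1 hz.symm).symm
  refine ⟨_, _, _, _, him c1, hre c2, hre c3, him c4, ?_, ?_⟩
  · intro h0
    rw [him c1, hre c2, h0, mul_pow, Complex.I_sq, Complex.ofReal_zero] at i1
    have : -(jacobiSn k v).im ^ 2 = 1 := by
      have i1' : ((-(jacobiSn k v).im ^ 2 : ℝ) : ℂ) = 1 := by
        push_cast
        linear_combination i1
      exact_mod_cast i1'
    nlinarith [sq_nonneg (jacobiSn k v).im]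
  · rw [him c1, hre c3, mul_pow, Complex.I_sq] at i2
    have i2' : (((jacobiDn k v).re ^ 2 - k ^ 2 * (jacobiSn k v).im ^ 2 : ℝ) : ℂ) = 1 := by
      push_cast
      linear_combination i2
    exact_mod_cast i2'

lemma star_imaginary (t k : ℝ) : star ((t * Complex.I : ℂ) / k) = -(t * Complex.I / k) := by
  rw [Complex.star_def, map_div₀, map_mul, Complex.conj_ofReal, Complex.conj_ofReal, Complex.conj_I]
  ring

lemma hyperbolaSurface_imaginary_axis (h : IsHyperbolaData a b k E) {t x r : ℝ}
    (hD : (t * Complex.I : ℂ) ∈ hyperbolaDomain a b)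
    (hx : jacobiSn k (t * Complex.I / k) = x * Complex.I)
    (hr : jacobiDn k (t * Complex.I / k) = r) :
    hyperbolaSurface a b (t * Complex.I) = !₂[b * r, -(a * k * x), 0] := by
  obtain ⟨-, -, -, y, -, -, -, hy, -⟩ :=
    h.imaginary_axis_values (star_imaginary t k) (h.mem_domain.1 hD)
  rw [hyperbolaSurface, h.curve_eq hD, hx, hr, hy]
  have e1 : Complex.I * a * k * (x * Complex.I) = ((-(a * k * x) : ℝ) : ℂ) := by
    push_cast
    linear_combination a * k * x * Complex.I_sq
  have e2 : a * ((y * Complex.I - (1 - k ^ 2) * (t * Complex.I / k)) / k) =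
      ((a * (y - (1 - k ^ 2) * (t / k)) / k : ℝ) : ℂ) * Complex.I := by
    push_cast
    ring
  rw [e1, e2]
  ext i
  fin_cases i
  · simp [reVec]
  · exact Complex.ofReal_re _
  · simp only [reVec, Fin.reduceFinMk, Matrix.cons_val]
    rw [Complex.re_ofReal_mul, Complex.I_re, mul_zero]

/-- The coordinates are `b dn` and `-a k x`, where `sn = i x`. The values from `imaginary_axis`,
where `dn > 0`, cover one branch of the hyperbola; a translation that keeps `sn` and negates `dn`
covers the other. -/
lemma image_imaginary_axis (h : IsHyperbolaData a b k E) :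
    (fun t : ℝ => hyperbolaSurface a b (t * Complex.I)) ''
        {t : ℝ | (t * Complex.I : ℂ) ∈ hyperbolaDomain a b} =
      {q : E3 | q 0 ^ 2 / b ^ 2 - q 1 ^ 2 / a ^ 2 = 1 ∧ q 2 = 0} := by
  have hs := h.system
  have ha := h.pos_a.ne'
  have hb := h.pos_b.ne'
  have hk := h.pos_k
  have hk0 := hk.ne'
  have hkc := h.ofReal_ne_zero
  ext q
  constructor
  · rintro ⟨t, ht, rfl⟩
    obtain ⟨x, c, r, y, h1, -, h3, -, -, h6⟩ :=
      h.imaginary_axis_values (star_imaginary t k) (h.mem_domain.1 ht)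
    simp only [h.hyperbolaSurface_imaginary_axis ht h1 h3]
    refine ⟨?_, rfl⟩
    change (b * r) ^ 2 / b ^ 2 - (-(a * k * x)) ^ 2 / a ^ 2 = 1
    field_simp
    linarith
  · rintro ⟨h1, h2⟩
    set x := -q 1 / (a * k) with hx
    have hqx : -(a * k * x) = q 1 := by
      rw [hx]
      field_simp
    have hd : (q 0 / b) ^ 2 = 1 + k ^ 2 * x ^ 2 := by
      rw [← hqx] at h1
      field_simp at h1 ⊢
      nlinarith
    have hdiv : ∀ v : ℝ, ((k * v : ℝ) * Complex.I : ℂ) / k = v * Complex.I := fun v => by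
      push_cast
      field_simp
    have key : ∀ v : ℝ, AnalyticAt ℂ (jacobiSn k) (v * Complex.I) →
        jacobiSn k (v * Complex.I) = x * Complex.I →
        jacobiDn k (v * Complex.I) = (q 0 / b : ℝ) →
        q ∈ (fun t : ℝ => hyperbolaSurface a b (t * Complex.I)) ''
          {t : ℝ | (t * Complex.I : ℂ) ∈ hyperbolaDomain a b} := fun v hv hsv hdv => by
      rw [← hdiv] at hv hsv hdv
      refine ⟨k * v, h.mem_domain.2 hv, ?_⟩
      simp only [h.hyperbolaSurface_imaginary_axis (h.mem_domain.2 hv) hsv hdv]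
      rw [hqx, mul_div_cancel₀ _ hb, ← h2]
      ext i
      fin_cases i <;> rfl
    obtain ⟨v, v1, v2, v3, v4⟩ := hs.imaginary_axis x
    rw [← hd, Real.sqrt_sq_eq_abs] at v4
    rcases le_total 0 (q 0 / b) with hq | hq
    · rw [abs_of_nonneg hq] at v4
      exact key v v1 v2 v4
    · rw [abs_of_nonpos hq] at v4
      -- This is the point `H = i η` with `sn H = i/√k` required by `translate`. Since `H` lies on
      -- the imaginary axis, adding `4H` stays on that axis.
      obtain ⟨η, w1, w2, w3, w4⟩ := hs.imaginary_axis (1 / √k)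
      have hsq : √k ^ 2 = k := Real.sq_sqrt hk.le
      have hsk : √k ≠ 0 := (Real.sqrt_pos.2 hk).ne'
      obtain ⟨t1, t2, -, t4⟩ := hs.translate hk w1 (w2.trans (by
          push_cast
          ring)) (by
        rw [w3, w4, ← Complex.ofReal_mul, ← Real.sqrt_mul (by positivity)]
        congr 2
        rw [div_pow, hsq]
        field_simp
        ring) v1
      have e : (v * Complex.I + 4 * (η * Complex.I) : ℂ) = ((v + 4 * η : ℝ) : ℂ) * Complex.I := by
        push_cast
        ring
      rw [e] at t1 t2 t4
      refine key _ t1 (t2.trans v2) (t4.trans ?_)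
      rw [v4]
      push_cast
      ring

lemma isPregeodesicAt (h : IsHyperbolaData a b k E) {t : ℝ}
    (ht : (t * Complex.I : ℂ) ∈ hyperbolaDomain a b) :
    IsPregeodesicAt (hyperbolaSurface a b) (fun s => (s * Complex.I : ℂ)) t := by
  have hval := fun {s : ℝ} (hs : (s * Complex.I : ℂ) ∈ hyperbolaDomain a b) =>
    h.imaginary_axis_values (star_imaginary s k) (h.mem_domain.1 hs)
  obtain ⟨x, q, r, -, h1, h2, h3, -, hq, -⟩ := hval ht
  have hα : ∀ s : ℝ, HasDerivAt (fun s : ℝ => (s * Complex.I : ℂ)) Complex.I s := fun s =>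
    (Complex.ofRealCLM.hasDerivAt.mul_const Complex.I).congr_deriv (by simp)
  refine h.isIsotropicOn.isPregeodesicAt hα ht Complex.I_ne_zero ((h.deriv_ne_zero_iff _).2 ?_) ?_ ?_ fun s hs => ?_
  · rw [h2]
    exact_mod_cast hq
  · simp only [h1, h2, Matrix.cons_val]
    rw [show Complex.I * -(b * k * (x * Complex.I * q)) = ((b * k * x * q : ℝ) : ℂ) by
      push_cast
      linear_combination -(b * k * x * q) * Complex.I_sq]
    exact Complex.ofReal_im _
  · simp only [h2, h3, Matrix.cons_val]
    rw [show Complex.I * (Complex.I * a * (q * r)) = ((-(a * q * r) : ℝ) : ℂ) by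
      push_cast
      linear_combination a * q * r * Complex.I_sq]
    exact Complex.ofReal_im _
  · obtain ⟨-, q, -, -, -, h2, -⟩ := hval hs
    simp [h2, pow_two]

end IsHyperbolaData

end

/-! ### Assembly of the theorem -/

theorem mainTheorem1 :
    -- Jacobi's functions exist, are unique, and `cn`, `dn` are holomorphic where `sn` is
    (∀ k : ℝ, 0 < k → k < 1 →
      (∀ f, IsJacobiSn k f ↔ f = jacobiSn k) ∧
      (∀ f, IsJacobiCn k f ↔ f = jacobiCn k) ∧
      (∀ f, IsJacobiDn k f ↔ f = jacobiDn k) ∧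
      ∀ u ∈ jacobiDomain k,
        AnalyticAt ℂ (jacobiSn k) u ∧ AnalyticAt ℂ (jacobiCn k) u ∧ AnalyticAt ℂ (jacobiDn k) u) ∧
    -- the ellipse
    (∀ a b : ℝ, 0 < b → b < a →
      let e := ellipseModulus a b
      let D := jacobiDomain e
      let x : ℂ → ℂ := fun z => b * Complex.cos z
      let y : ℂ → ℂ := fun z => a * Complex.sin z
      -- the modulus is admissible, the integrand is meromorphic with zero residues and its
      -- integral is single-valued
      (0 < e ∧ e < 1) ∧
      Meromorphic (fun σ => jacobiDn e σ ^ 2) ∧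
      (∀ p : ℂ, IsResidueAt (fun σ => jacobiDn e σ ^ 2) p 0) ∧
      IntegralWellDefinedOn (fun σ => jacobiDn e σ ^ 2) D ∧
      -- the substitution `sin z = sn(u, e)` turns Björling's formula into `Ψ`
      (∀ u ∈ D, ∃ z w, IsBjorlingPath x y 0 z w ∧ 0 < (w 0).re ∧
        Complex.sin (z 1) = jacobiSn e u ∧ bjorlingValue x y z w = ellipseCurve a b u) ∧
      (∀ z w, IsBjorlingPath x y 0 z w → 0 < (w 0).re →
        ∃ u ∈ D, Complex.sin (z 1) = jacobiSn e u ∧ bjorlingValue x y z w = ellipseCurve a b u) ∧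
      -- `Ψ` parameterizes the whole surface, and its imaginary counterpart the conjugate surface
      ellipticalCatenoid a b '' D = bjorlingSurface x y 0 ∧
      ellipticalHelicoid a b '' D = conjugateBjorlingSurface x y 0 ∧
      IsMinimalSurfaceOn (ellipticalCatenoid a b) D ∧
      IsMinimalSurfaceOn (ellipticalHelicoid a b) D ∧
      (∀ u ∈ D, Function.Injective (fderiv ℝ (ellipticalCatenoid a b) u) ↔ jacobiDn e u ≠ 0) ∧
      -- the ellipse is the image of the real axis and is a geodesic
      (∀ t : ℝ, (t : ℂ) ∈ D) ∧
      range (fun t : ℝ => ellipticalCatenoid a b t) =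
        {q : E3 | q 0 ^ 2 / b ^ 2 + q 1 ^ 2 / a ^ 2 = 1 ∧ q 2 = 0} ∧
      ∀ t : ℝ, IsPregeodesicAt (ellipticalCatenoid a b) (fun s => (s : ℂ)) t) ∧
    -- the hyperbola
    (∀ a b : ℝ, 0 < a → 0 < b →
      let k := hyperbolaModulus a b
      let D := hyperbolaDomain a b
      let x : ℂ → ℂ := fun z => b * Complex.cosh z
      let y : ℂ → ℂ := fun z => a * Complex.sinh z
      (0 < k ∧ k < 1) ∧
      Meromorphic (fun σ => jacobiCn k (σ / k) ^ 2) ∧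
      (∀ p : ℂ, IsResidueAt (fun σ => jacobiCn k (σ / k) ^ 2) p 0) ∧
      IntegralWellDefinedOn (fun σ => jacobiCn k (σ / k) ^ 2) D ∧
      -- with the substitution `sinh z = i k sn(u/k, k)` the formula is the one with the negative
      -- root at the base point
      (∀ u ∈ D, ∃ z w, IsBjorlingPath x y 0 z w ∧ (w 0).re < 0 ∧
        Complex.sinh (z 1) = Complex.I * k * jacobiSn k (u / k) ∧
        bjorlingValue x y z w = hyperbolaCurve a b u) ∧
      (∀ z w, IsBjorlingPath x y 0 z w → (w 0).re < 0 →
        ∃ u ∈ D, Complex.sinh (z 1) = Complex.I * k * jacobiSn k (u / k) ∧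
        bjorlingValue x y z w = hyperbolaCurve a b u) ∧
      hyperbolaSurface a b '' D = bjorlingSurface x y 0 ∧
      hyperbolaConjugate a b '' D = conjugateBjorlingSurface x y 0 ∧
      IsMinimalSurfaceOn (hyperbolaSurface a b) D ∧
      IsMinimalSurfaceOn (hyperbolaConjugate a b) D ∧
      (∀ u ∈ D, Function.Injective (fderiv ℝ (hyperbolaSurface a b) u) ↔
        jacobiCn k (u / k) ≠ 0) ∧
      -- the hyperbola is the image of the imaginary axis and is a geodesic
      (fun t : ℝ => hyperbolaSurface a b (t * Complex.I)) '' {t : ℝ | (t * Complex.I : ℂ) ∈ D} =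
        {q : E3 | q 0 ^ 2 / b ^ 2 - q 1 ^ 2 / a ^ 2 = 1 ∧ q 2 = 0} ∧
      ∀ t : ℝ, (t * Complex.I : ℂ) ∈ D →
        IsPregeodesicAt (hyperbolaSurface a b) (fun s => (s * Complex.I : ℂ)) t) := by
  refine ⟨fun k hk0 hk1 => ?_, fun a b hb hba => ?_, fun a b ha hb => ?_⟩
  · obtain ⟨h1, h2, h3, E, hE⟩ := jacobi_exists hk0 hk1
    exact ⟨h1, h2, h3, fun u hu => ⟨hE.mem_jacobiDomain.1 hu,
      hE.analyticAt_c (hE.mem_jacobiDomain.1 hu), hE.analyticAt_d (hE.mem_jacobiDomain.1 hu)⟩⟩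
  · obtain ⟨hmod, -⟩ := ellipseModulus_mem hb hba
    obtain ⟨-, -, -, E, hE⟩ := jacobi_exists hmod.1 hmod.2
    have h : IsEllipseData a b E := ⟨hb, hba, hE⟩
    exact ⟨hmod, h.meromorphic, h.residue, h.integral.1, fun u hu => h.exists_bjorlingPath hu,
      fun z w hzw hw => h.exists_parameter hzw hw, h.image_ellipticalCatenoid,
      h.image_ellipticalHelicoid, h.isMinimalSurfaceOn_ellipticalCatenoid,
      h.isMinimalSurfaceOn_ellipticalHelicoid, fun u hu => h.injective_fderiv_iff hu,
      h.ofReal_mem, h.range_real_axis, h.isPregeodesicAt⟩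
  · obtain ⟨hmod, -⟩ := hyperbolaModulus_mem ha hb
    obtain ⟨-, -, -, E, hE⟩ := jacobi_exists hmod.1 hmod.2
    have h : IsHyperbolaData a b (hyperbolaModulus a b) E := ⟨ha, hb, rfl, hE⟩
    exact ⟨hmod, h.meromorphic, h.residue, h.integral.1, fun u hu => h.exists_bjorlingPath hu,
      fun z w hzw hw => h.exists_parameter hzw hw, h.image_hyperbolaSurface,
      h.image_hyperbolaConjugate, h.isMinimalSurfaceOn_hyperbolaSurface,
      h.isMinimalSurfaceOn_hyperbolaConjugate, fun u hu => h.injective_fderiv_iff hu,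
      h.image_imaginary_axis, fun t ht => h.isPregeodesicAt ht⟩
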